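/- Let $d\in\{2,3\}$, let $p\ge 2$ be an integer, and let $\Omega\subset\mathbb R^d$ be a bounded convex polytopal open set. For every finite conforming partition $\mathcal T$ of $\overline\Omega$ into closed simplices, let $\vartheta_{\mathcal T}=\max_{K\in\mathcal T}\operatorname{diam}K/\rho_K$ be its shape-regularity parameter, where $\rho_K$ is the diameter of the largest ball inscribed in $K$. Let $\mathcal F^I$ and $\mathcal F^B$ be the sets of interior and boundary $(d-1)$-dimensional closed faces of $\mathcal T$, and let $h_F=\mathcal H^{d-1}(F)^{1/(d-1)}$ for a face $F$. Let $$\boldsymbol V_{\mathcal T}=\{\boldsymbol v\in L^2(\Omega;\mathbb R^d):\ \boldsymbol v|_K\in\mathbb P_{p-1}^d\ \ \forall K\in\mathcal T\},$$ where $\mathbb P_{p-1}$ is the space of polynomials of total degree at most $p-1$, and let $\boldsymbol H^1_T(\Omega)$ be the space of all $\boldsymbol v\in H^1(\Omega;\mathbb R^d)$ whose trace on $\partial\Omega$ has vanishing tangential component $\boldsymbol v_T=\boldsymbol v-(\boldsymbol v\cdot\boldsymbol n)\boldsymbol n$, with $\boldsymbol n$ the unit outward normal. For $\boldsymbol v\in\boldsymbol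 V_{\mathcal T}$ set $$|\boldsymbol v|_{J}^2=\sum_{F\in\mathcal F^I}\int_F h_F^{-1}\,|[\![\boldsymbol v]\!]|^2\,d\mathcal H^{d-1}+\sum_{F\in\mathcal F^B}\int_F h_F^{-1}\,|\boldsymbol v_T|^2\,d\mathcal H^{d-1},$$ $$\|\boldsymbol v\|_{\mathcal T}^2=\sum_{K\in\mathcal T}\int_K|\nabla(\boldsymbol v|_K)|^2\,dx+\int_\Omega|\boldsymbol v|^2\,dx+|\boldsymbol v|_{J}^2,$$ where $[\![\boldsymbol v]\!]$ is the difference of the traces of $\boldsymbol v$ from the two elements sharing $F$, and $|\nabla(\boldsymbol v|_K)|$ is the Frobenius norm. Then for every $\theta\in\mathbb R$ there is a constant $C>0$, depending only on $d$, $p$, $\Omega$ and $\theta$, such that for every such mesh $\mathcal T$ with $\vartheta_{\mathcal T}\le\theta$ there exists a linear operator $\boldsymbol E_{\mathcal T}\colon\boldsymbol V_{\mathcal T}\to\boldsymbol V_{\mathcal T}\cap\boldsymbol H^1_T(\Omega)$ with $$\|\boldsymbol v-\boldsymbol E_{\mathcal T}\boldsymbol v\|_{\mathcal T}\le C\,|\boldsymbol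 v|_{J}\qquad\text{for all }\boldsymbol v\in\boldsymbol V_{\mathcal T}.$$ -/

import Mathlib

open MeasureTheory Set Filter Topology
open scoped ContDiff ENNReal

noncomputable section

namespace DGVector

/-- Points and vectors of `ℝ^d`, with the Euclidean norm. -/
abbrev Vec (d : ℕ) : Type := EuclideanSpace ℝ (Fin d)

/-- Bounded convex polytopal open sets. -/
structure IsConvexPolytopalDomain {d : ℕ} (Ω : Set (Vec d)) : Prop where
  isOpen : IsOpen Ω
  convex : Convex ℝ Ω
  isBounded : Bornology.IsBounded Ω
  polytopal : ∃ S : Finset (Vec d), closure Ω = convexHull ℝ (S : Set (Vec d))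

/-- The space `L²(Ω; ℝ^d)`. -/
abbrev L2 {d : ℕ} (Ω : Set (Vec d)) : Type := Lp (Vec d) 2 (volume.restrict Ω)

/-! ### Weak gradients and traces -/

/-- The surface measure: the `(d-1)`-dimensional Hausdorff measure, normalized as usual so that it
is the Lebesgue measure on hyperplanes. -/
def surfaceMeasure (d : ℕ) : Measure (Vec d) := Measure.euclideanHausdorffMeasure (d - 1)

/-- `G` is the weak gradient of the vector field `v` in the open set `U`, with `G x i j` the
`j`-th partial derivative of the `i`-th component. -/
def HasWeakGradient {d : ℕ} (U : Set (Vec d)) (v : Vec d → Vec d)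
    (G : Vec d → Fin d → Fin d → ℝ) : Prop :=
  ∀ i j : Fin d,
    LocallyIntegrableOn (fun x => v x i) U ∧ LocallyIntegrableOn (fun x => G x i j) U ∧
    ∀ φ : Vec d → ℝ, ContDiff ℝ ∞ φ → HasCompactSupport φ → tsupport φ ⊆ U →
      ∫ x in U, v x i * fderiv ℝ φ x (EuclideanSpace.single j 1) = - ∫ x in U, G x i j * φ x

open Classical in
/-- The weak gradient of `v` in `U` (unique up to null sets when it exists). -/
def weakGradient {d : ℕ} (U : Set (Vec d)) (v : Vec d → Vec d) :
    Vec d → Fin d → Fin d → ℝ :=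
  if h : ∃ G, HasWeakGradient U v G then h.choose else 0

/-- The field `v` on `U` has the trace `g` at the point `x` of the closure of `U`:
the mean of `|v - g|` over `U ∩ B(x, r)` tends to `0` as `r → 0+`. For a `BV` field on a Lipschitz
domain this is the pointwise description of the boundary trace, valid at almost every boundary
point for the surface measure. -/
def HasTraceAt {d : ℕ} (U : Set (Vec d)) (v : Vec d → Vec d) (x g : Vec d) : Prop :=
  Tendsto (fun r : ℝ => ⨍⁻ y in U ∩ Metric.ball x r, ‖v y - g‖ₑ ∂volume) (𝓝[>] 0) (𝓝 0)

open Classical in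
/-- The trace of `v|_U` at `x`. -/
def trace {d : ℕ} (U : Set (Vec d)) (v : Vec d → Vec d) (x : Vec d) : Vec d :=
  if h : ∃ g, HasTraceAt U v x g then h.choose else 0

/-- `n` is a unit outward normal to the convex open set `Ω` at the boundary point `x`. For a
polytopal set it is unique at almost every boundary point. -/
def IsOutwardUnitNormal {d : ℕ} (Ω : Set (Vec d)) (x n : Vec d) : Prop :=
  ‖n‖ = 1 ∧ ∀ y ∈ Ω, inner ℝ n (y - x) ≤ 0

/-- `v ∈ H¹(Ω; ℝ^d)`, for a field `v` already known to lie in `L²(Ω; ℝ^d)`: the weak gradient of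
`v` exists and is square integrable. -/
def MemH1 {d : ℕ} (Ω : Set (Vec d)) (v : Vec d → Vec d) : Prop :=
  ∃ G, HasWeakGradient Ω v G ∧ ∀ i j, MemLp (fun x => G x i j) 2 (volume.restrict Ω)

/-- The tangential component `v - (v · n) n` of the trace of `v` vanishes at almost every point
of `∂Ω` for the surface measure. -/
def TangentialTraceVanishes {d : ℕ} (Ω : Set (Vec d)) (v : Vec d → Vec d) : Prop :=
  ∀ᵐ x ∂((surfaceMeasure d).restrict (frontier Ω)),
    ∃ g, HasTraceAt Ω v x g ∧ ∀ n, IsOutwardUnitNormal Ω x n → g - inner ℝ n g • n = 0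

section Closure

variable {d : ℕ} {Ω : Set (Vec d)}

theorem HasTraceAt.congr {v w : Vec d → Vec d} {x g : Vec d} (hv : HasTraceAt Ω v x g)
    (h : v =ᵐ[volume.restrict Ω] w) : HasTraceAt Ω w x g := by
  refine Tendsto.congr (fun r => ?_) hv
  refine laverage_congr ?_
  have h' := ae_mono (Measure.restrict_mono (μ := volume)
    (inter_subset_left (s := Ω) (t := Metric.ball x r)) le_rfl) h
  filter_upwards [h'] with y hy
  rw [hy]

theorem HasTraceAt.add {v w : Vec d → Vec d} {x g k : Vec d}
    (hm : AEStronglyMeasurable v (volume.restrict Ω))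
    (hv : HasTraceAt Ω v x g) (hw : HasTraceAt Ω w x k) :
    HasTraceAt Ω (fun y => v y + w y) x (g + k) := by
  have h := Tendsto.add hv hw
  rw [add_zero] at h
  refine tendsto_of_tendsto_of_tendsto_of_le_of_le tendsto_const_nhds h
    (fun _ => zero_le) fun r => ?_
  have hm' : AEMeasurable (fun y => ‖v y - g‖ₑ)
      (volume.restrict (Ω ∩ Metric.ball x r)) :=
    ((hm.mono_measure (Measure.restrict_mono inter_subset_left le_rfl)).sub
      aestronglyMeasurable_const).enorm
  simp only [laverage_eq]
  rw [← ENNReal.add_div, ← lintegral_add_left' hm']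
  gcongr with y
  calc ‖v y + w y - (g + k)‖ₑ = ‖(v y - g) + (w y - k)‖ₑ := by congr 1; abel
    _ ≤ _ := enorm_add_le _ _

theorem HasTraceAt.smul {v : Vec d → Vec d} {x g : Vec d} (c : ℝ)
    (hv : HasTraceAt Ω v x g) : HasTraceAt Ω (fun y => c • v y) x (c • g) := by
  have h := ENNReal.Tendsto.const_mul (a := ‖c‖ₑ) hv (Or.inr enorm_ne_top)
  rw [mul_zero] at h
  refine h.congr fun r => ?_
  simp only [laverage_eq]
  rw [← mul_div_assoc, ← lintegral_const_mul' _ _ enorm_ne_top]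
  congr 2
  funext y
  rw [← smul_sub, enorm_smul]

theorem hasTraceAt_zero (x : Vec d) : HasTraceAt Ω (fun _ => 0) x 0 := by
  simp [HasTraceAt]

theorem TangentialTraceVanishes.congr {v w : Vec d → Vec d} (hv : TangentialTraceVanishes Ω v)
    (h : v =ᵐ[volume.restrict Ω] w) : TangentialTraceVanishes Ω w := by
  filter_upwards [hv] with x ⟨g, hg, hn⟩
  exact ⟨g, hg.congr h, hn⟩

theorem HasWeakGradient.congr {v w : Vec d → Vec d} {G : Vec d → Fin d → Fin d → ℝ}
    (hw : ∀ i, LocallyIntegrableOn (fun x => w x i) Ω)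
    (hv : HasWeakGradient Ω v G) (h : v =ᵐ[volume.restrict Ω] w) : HasWeakGradient Ω w G := by
  intro i j
  obtain ⟨-, h2, h3⟩ := hv i j
  refine ⟨hw i, h2, fun φ a b c => ?_⟩
  rw [← h3 φ a b c]
  refine integral_congr_ae ?_
  filter_upwards [h] with y hy
  rw [hy]

theorem memLp_component (v : L2 Ω) (i : Fin d) :
    MemLp (fun x => (v : Vec d → Vec d) x i) 2 (volume.restrict Ω) :=
  (Lp.memLp v).eval_piLp i

theorem locallyIntegrableOn_component (v : L2 Ω) (i : Fin d) :
    LocallyIntegrableOn (fun x => (v : Vec d → Vec d) x i) Ω :=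
  locallyIntegrableOn_of_locallyIntegrable_restrict
    ((memLp_component v i).locallyIntegrable one_le_two)

theorem memLp_test {φ : Vec d → ℝ} (h1 : ContDiff ℝ ∞ φ) (h2 : HasCompactSupport φ) :
    MemLp φ 2 (volume.restrict Ω) :=
  (h1.continuous.memLp_of_hasCompactSupport h2).restrict Ω

theorem memLp_test_fderiv {φ : Vec d → ℝ} (h1 : ContDiff ℝ ∞ φ) (h2 : HasCompactSupport φ)
    (e : Vec d) : MemLp (fun x => fderiv ℝ φ x e) 2 (volume.restrict Ω) :=
  (((h1.continuous_fderiv (by simp)).clm_apply continuous_const).memLp_of_hasCompactSupport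
    (h2.fderiv_apply ℝ e)).restrict Ω

end Closure

/-- The space `H¹_T(Ω)` of fields in `H¹(Ω; ℝ^d)` whose tangential trace vanishes on `∂Ω`. -/
def H1T {d : ℕ} (Ω : Set (Vec d)) : Submodule ℝ (L2 Ω) where
  carrier := {v | MemH1 Ω v ∧ TangentialTraceVanishes Ω v}
  zero_mem' := by
    have h0 : (fun _ => 0 : Vec d → Vec d) =ᵐ[volume.restrict Ω] ((0 : L2 Ω) : Vec d → Vec d) :=
      (Lp.coeFn_zero _ _ _).symm
    refine ⟨⟨fun _ => 0, HasWeakGradient.congr (locallyIntegrableOn_component _) (v := fun _ => 0)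
      (fun i j => ⟨?_, ?_, ?_⟩) h0, fun i j => ?_⟩, ?_⟩
    · exact (integrable_zero (Vec d) ℝ volume).locallyIntegrable.locallyIntegrableOn Ω
    · exact (integrable_zero (Vec d) ℝ volume).locallyIntegrable.locallyIntegrableOn Ω
    · intro φ _ _ _
      simp
    · simp
    · refine TangentialTraceVanishes.congr (v := fun _ => 0) ?_ h0
      exact Eventually.of_forall fun x => ⟨0, hasTraceAt_zero x, by simp⟩
  add_mem' := by
    rintro v w ⟨⟨G, hG, hG2⟩, hv⟩ ⟨⟨H, hH, hH2⟩, hw⟩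
    have h0 : (fun x => (v : Vec d → Vec d) x + (w : Vec d → Vec d) x)
        =ᵐ[volume.restrict Ω] ((v + w : L2 Ω) : Vec d → Vec d) := (Lp.coeFn_add v w).symm
    refine ⟨⟨fun x i j => G x i j + H x i j, HasWeakGradient.congr (locallyIntegrableOn_component _)
      (fun i j => ⟨?_, ?_, ?_⟩) h0, fun i j => ?_⟩, ?_⟩
    · exact (hG i j).1.add (hH i j).1
    · exact (hG i j).2.1.add (hH i j).2.1
    · intro φ h1 h2 h3
      have e1 := (hG i j).2.2 φ h1 h2 h3
      have e2 := (hH i j).2.2 φ h1 h2 h3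
      have i1 := (memLp_component v i).integrable_mul
        (memLp_test_fderiv h1 h2 (EuclideanSpace.single j 1))
      have i2 := (memLp_component w i).integrable_mul
        (memLp_test_fderiv h1 h2 (EuclideanSpace.single j 1))
      have i3 := (hG2 i j).integrable_mul (memLp_test h1 h2)
      have i4 := (hH2 i j).integrable_mul (memLp_test h1 h2)
      simp only [PiLp.add_apply, add_mul]
      refine (integral_add i1 i2).trans ?_
      refine Eq.trans ?_ (congrArg Neg.neg (integral_add i3 i4).symm)
      simp only [Pi.mul_apply]
      rw [e1, e2, neg_add]
    · exact (hG2 i j).add (hH2 i j)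
    · refine TangentialTraceVanishes.congr ?_ h0
      filter_upwards [hv, hw] with x ⟨g, hg, hn⟩ ⟨k, hk, hm⟩
      refine ⟨g + k, hg.add (Lp.aestronglyMeasurable v) hk, fun n h => ?_⟩
      have a := hn n h
      have b := hm n h
      rw [inner_add_right, add_smul, add_sub_add_comm, a, b, add_zero]
  smul_mem' := by
    rintro c v ⟨⟨G, hG, hG2⟩, hv⟩
    have h0 : (fun x => c • (v : Vec d → Vec d) x)
        =ᵐ[volume.restrict Ω] ((c • v : L2 Ω) : Vec d → Vec d) := (Lp.coeFn_smul c v).symm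
    refine ⟨⟨fun x i j => c • G x i j, HasWeakGradient.congr (locallyIntegrableOn_component _)
      (fun i j => ⟨?_, ?_, ?_⟩) h0, fun i j => ?_⟩, ?_⟩
    · exact (hG i j).1.smul c
    · exact (hG i j).2.1.smul c
    · intro φ h1 h2 h3
      have e1 := (hG i j).2.2 φ h1 h2 h3
      simp only [PiLp.smul_apply, smul_eq_mul, mul_assoc]
      rw [integral_const_mul, integral_const_mul, e1, mul_neg]
    · exact (hG2 i j).const_mul c
    · refine TangentialTraceVanishes.congr ?_ h0
      filter_upwards [hv] with x ⟨g, hg, hn⟩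
      refine ⟨c • g, hg.smul c, fun n h => ?_⟩
      have a := hn n h
      rw [inner_smul_right, mul_smul, ← smul_sub, a, smul_zero]

/-! ### Meshes -/

/-- A finite conforming simplicial mesh of `Ω`: a finite simplicial complex whose underlying set is
the closure of `Ω`. Simplices are given by their vertex sets. -/
structure Mesh {d : ℕ} (Ω : Set (Vec d)) extends Geometry.SimplicialComplex ℝ (Vec d) where
  finite_faces : faces.Finite
  space_eq : toSimplicialComplex.space = closure Ω

/-- The closed simplex with a given vertex set. -/
def simplex {d : ℕ} (K : Finset (Vec d)) : Set (Vec d) := convexHull ℝ (K : Set (Vec d))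

namespace Mesh

variable {d : ℕ} {Ω : Set (Vec d)} (T : Mesh Ω)

/-- The elements: the `d`-dimensional simplices of the mesh. -/
def elements : Finset (Finset (Vec d)) := T.finite_faces.toFinset.filter fun K => K.card = d + 1

/-- The faces: the `(d-1)`-dimensional simplices of the mesh. -/
def meshFaces : Finset (Finset (Vec d)) := T.finite_faces.toFinset.filter fun F => F.card = d

open Classical in
/-- The faces contained in `∂Ω`. -/
def boundaryFaces : Finset (Finset (Vec d)) :=
  T.meshFaces.filter fun F => simplex F ⊆ frontier Ω

open Classical in
/-- The faces that are not contained in `∂Ω`. -/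
def interiorFaces : Finset (Finset (Vec d)) :=
  T.meshFaces.filter fun F => ¬ simplex F ⊆ frontier Ω

/-- The elements having `F` as a face: two of them if `F` is interior, one if `F` lies in `∂Ω`. -/
def adjacent (F : Finset (Vec d)) : Finset (Finset (Vec d)) := T.elements.filter fun K => F ⊆ K

end Mesh

/-- The diameter of the largest ball inscribed in `K`. -/
def inballDiameter {d : ℕ} (K : Set (Vec d)) : ℝ :=
  sSup {δ | ∃ (c : Vec d) (r : ℝ), 0 ≤ r ∧ Metric.closedBall c r ⊆ K ∧ δ = 2 * r}

/-- The shape-regularity parameter: the maximum over the elements `K` of `diam K / ρ_K`. -/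
def Mesh.shapeRegularity {d : ℕ} {Ω : Set (Vec d)} (T : Mesh Ω) : ℝ :=
  ⨆ K : {K // K ∈ T.elements}, Metric.diam (simplex K.1) / inballDiameter (simplex K.1)

/-- The size `h_F = |F|^(1/(d-1))` of a face. -/
def faceSize {d : ℕ} (F : Finset (Vec d)) : ℝ :=
  (surfaceMeasure d).real (simplex F) ^ (1 / ((d : ℝ) - 1))

/-! ### Piecewise polynomial vector fields, their norm and their seminorm -/

/-- The field `v`, defined almost everywhere in `Ω`, agrees almost everywhere in `K ∩ Ω` with a
vector of polynomials of total degree at most `k`. -/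
def IsPolynomialOn {d : ℕ} (Ω : Set (Vec d)) (k : ℕ) (K : Set (Vec d)) (v : Vec d → Vec d) :
    Prop :=
  ∃ q : Fin d → MvPolynomial (Fin d) ℝ, (∀ i, (q i).totalDegree ≤ k) ∧
    ∀ᵐ x ∂(volume.restrict Ω), x ∈ K → ∀ i, v x i = MvPolynomial.eval (fun j => x j) (q i)

/-- The space `V_T` of the fields in `L²(Ω; ℝ^d)` whose restriction to every element is a vector
of polynomials of total degree at most `p - 1`. -/
def V {d : ℕ} {Ω : Set (Vec d)} (T : Mesh Ω) (p : ℕ) :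
    Submodule ℝ (L2 Ω) where
  carrier := {v | ∀ K ∈ T.elements, IsPolynomialOn Ω (p - 1) (simplex K) v}
  zero_mem' := by
    intro K hK
    refine ⟨fun _ => 0, by simp, ?_⟩
    filter_upwards [Lp.coeFn_zero (Vec d) 2 (volume.restrict Ω)] with x hx _ i
    rw [hx]
    simp
  add_mem' := by
    intro v w hv hw K hK
    obtain ⟨q, hq, hq2⟩ := hv K hK
    obtain ⟨s, hs, hs2⟩ := hw K hK
    refine ⟨fun i => q i + s i, fun i => (MvPolynomial.totalDegree_add _ _).trans
      (max_le (hq i) (hs i)), ?_⟩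
    filter_upwards [hq2, hs2, Lp.coeFn_add v w] with x h1 h2 h3 hx i
    rw [h3]
    simp [h1 hx, h2 hx]
  smul_mem' := by
    intro c v hv K hK
    obtain ⟨q, hq, hq2⟩ := hv K hK
    refine ⟨fun i => c • q i, fun i => (MvPolynomial.totalDegree_smul_le _ _).trans (hq i), ?_⟩
    filter_upwards [hq2, Lp.coeFn_smul c v] with x h1 h3 hx i
    rw [h3]
    simp [h1 hx]

section Norms

variable {d : ℕ} {Ω : Set (Vec d)} (T : Mesh Ω)

/-- `|⟦v⟧|²` on an interior face `F`, where `⟦v⟧` is the difference of the traces on `F` taken from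
the two elements sharing `F`. The sum runs over the ordered pairs of elements having `F` as a
face, so it counts the jump twice. -/
def jumpSq (v : Vec d → Vec d) (F : Finset (Vec d)) (x : Vec d) : ℝ :=
  1 / 2 * ∑ K ∈ T.adjacent F, ∑ K' ∈ T.adjacent F,
    ‖trace (interior (simplex K)) v x - trace (interior (simplex K')) v x‖ ^ 2

/-- `|v_T|²` on a boundary face `F`, where `v_T` is the tangential component of the trace taken from
the one element having `F` as a face, that is, its orthogonal projection onto the tangent space
of `F`. -/
def tangentialSq (v : Vec d → Vec d) (F : Finset (Vec d)) (x : Vec d) : ℝ :=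
  ∑ K ∈ T.adjacent F,
    ‖(vectorSpan ℝ (F : Set (Vec d))).starProjection (trace (interior (simplex K)) v x)‖ ^ 2

/-- The square of the jump seminorm. -/
def jumpSeminormSq (v : Vec d → Vec d) : ℝ :=
  (∑ F ∈ T.interiorFaces,
    (∫ x in simplex F, (faceSize F)⁻¹ * jumpSq T v F x ∂(surfaceMeasure d))) +
  (∑ F ∈ T.boundaryFaces,
    (∫ x in simplex F, (faceSize F)⁻¹ * tangentialSq T v F x ∂(surfaceMeasure d)))

/-- The jump seminorm. -/
def jumpSeminorm (v : Vec d → Vec d) : ℝ := √(jumpSeminormSq T v)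

/-- The norm on piecewise polynomial vector fields; the gradient is the piecewise one, measured in
the Frobenius norm. -/
def dgNorm (v : Vec d → Vec d) : ℝ :=
  √((∑ K ∈ T.elements, (∫ x in interior (simplex K),
        (∑ i, ∑ j, (weakGradient (interior (simplex K)) v x i j) ^ 2)))
    + (∫ x in Ω, ‖v x‖ ^ 2) + jumpSeminormSq T v)

end Norms

end DGVector

end

/-!
The operator `E` acts on Bernstein coefficients. On a simplex `K`, a vector polynomial of degree at
most `k = p - 1` is a combination of the products of `k` barycentric coordinates, with coefficients
indexed by the multi-indices `α` of degree `k` on the vertices of `K`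
(`IsFullSimplex.exists_bpoly_eq`). On a face only the coefficients with support in the face matter,
and the products agree for the two simplices sharing the face. Hence a family of coefficients `e α`
that does not depend on the element defines a continuous field. It is Lipschitz, so it lies in `H¹`
(`memH1_of_lipschitz`), and its tangential trace vanishes if each `e α` is orthogonal to every
boundary face that contains the support of `α` (`exists_conforming`). The operator chooses, for each
`α`, an element of the star of the support of `α`, takes the coefficient of `v` there, and projects
it orthogonally to the space of admissible values (`conformingCoeffs`).

The estimate compares the coefficient of `v` on any element `K` of the star with `e α`. The first
three of the following facts bound the difference by the jumps on the faces of the star, and the last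
one turns this into a bound for the norms of `v - E v`.
* Stars are connected through interior faces: near the centroid of a cell, a generic segment avoids
  all cells of codimension two (`Mesh.starGraph_preconnected`). The number of elements of a star is
  bounded by shape regularity (`Mesh.card_adjacent_le`), so their diameters and the sizes of their
  faces are comparable (`exists_diam_le_faceSize`).
* Across an interior face the difference of the coefficients is bounded by the jump, and on a
  boundary face the tangential part of the coefficients is bounded by the tangential trace. This is
  an inverse inequality on the face (`exists_inverse_inequality`): the field is at least half its
  maximum on a homothetic copy of the face with a fixed ratio.
* The distance of a vector to the admissible values is bounded by its tangential components on the
  boundary faces (`exists_norm_sub_starProjection_le`). Every boundary face lies in a facet of the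
  polytope `Ω`, so only finitely many families of tangent spaces occur, for all meshes together, and
  the constant depends only on `Ω` (`exists_norm_sub_le_sum_tangential`).
* The gradient and `L²` norms on an element are bounded by the coefficients with the power
  `diam K ^ (d - 2)` (`exists_broken_norm_le`), which is the scaling of the weighted face terms.

Since the conforming field has no jumps and no tangential trace, `v - E v` has the jump seminorm of
`v` (`jumpSeminormSq_eq_of_hasCoeffs`).
-/

noncomputable section

namespace DGVector

variable {d : ℕ}

/-! ### Barycentric coordinates -/

/-- `K` is the vertex set of a nondegenerate `d`-simplex of `ℝ^d`. -/
structure IsFullSimplex (K : Finset (Vec d)) : Prop where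
  indep : AffineIndependent ℝ ((↑) : K → Vec d)
  card_eq : K.card = d + 1

/-- `lam` is the family of barycentric coordinates of the simplex `K`, extended by zero to the
points that are not vertices of `K`. -/
def IsBary (K : Finset (Vec d)) (lam : Vec d → Vec d →ᵃ[ℝ] ℝ) : Prop :=
  (∀ a ∉ K, lam a = 0) ∧ (∀ a ∈ K, ∀ b ∈ K, lam a b = if a = b then 1 else 0) ∧
    ∀ x, ∑ a ∈ K, lam a x = 1 ∧ ∑ a ∈ K, lam a x • a = x

theorem IsFullSimplex.affineSpan_eq_top {K : Finset (Vec d)} (hK : IsFullSimplex K) :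
    affineSpan ℝ (K : Set (Vec d)) = ⊤ := by
  have := hK.indep.affineSpan_eq_top_iff_card_eq_finrank_add_one.2 (by simp [hK.card_eq])
  simpa using this

theorem IsFullSimplex.exists_isBary {K : Finset (Vec d)} (hK : IsFullSimplex K) :
    ∃ lam, IsBary K lam := by
  classical
  let b : AffineBasis K ℝ (Vec d) := ⟨(↑), hK.indep, by simpa using hK.affineSpan_eq_top⟩
  have hb : ∀ i, b i = (i : Vec d) := fun i => rfl
  refine ⟨fun a => if h : a ∈ K then b.coord ⟨a, h⟩ else 0, fun a ha => by simp [ha], ?_, ?_⟩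
  · intro a ha c hc
    have := b.coord_apply ⟨a, ha⟩ ⟨c, hc⟩
    rw [hb] at this
    simpa [ha] using this
  · intro x
    have h1 := b.sum_coord_apply_eq_one x
    have h2 := b.linear_combination_coord_eq_self x
    refine ⟨?_, ?_⟩
    · rw [← h1, ← Finset.sum_coe_sort K]
      exact Finset.sum_congr rfl fun i _ => by simp
    · refine Eq.trans ?_ h2
      rw [← Finset.sum_coe_sort K]
      exact Finset.sum_congr rfl fun i _ => by simp [hb]

open Classical in
/-- The barycentric coordinate of the simplex `K` at the vertex `a`, as an affine function on the
whole space; zero if `a` is not a vertex of `K`. -/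
def bary (K : Finset (Vec d)) : Vec d → Vec d →ᵃ[ℝ] ℝ :=
  if h : ∃ lam, IsBary K lam then h.choose else 0

/-- An affine function maps affine combinations to affine combinations. -/
theorem affineMap_combination {ι : Type*} (s : Finset ι) (f : Vec d →ᵃ[ℝ] ℝ) (w : ι → ℝ)
    (y : ι → Vec d) (hw : ∑ i ∈ s, w i = 1) :
    f (∑ i ∈ s, w i • y i) = ∑ i ∈ s, w i * f (y i) := by
  have h : ∀ x, f x = f.linear x + f 0 := fun x => by
    have := f.map_vadd 0 x
    simpa using this
  have h2 : ∑ i ∈ s, w i * f (y i) = ∑ i ∈ s, (w i * f.linear (y i) + w i * f 0) :=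
    Finset.sum_congr rfl fun i _ => by rw [h (y i), mul_add]
  rw [h2, h, map_sum, Finset.sum_add_distrib, ← Finset.sum_mul, hw, one_mul]
  simp_rw [map_smul, smul_eq_mul]

section

variable {K : Finset (Vec d)} (hK : IsFullSimplex K)
include hK

theorem IsFullSimplex.isBary : IsBary K (bary K) := by
  have h := hK.exists_isBary
  rw [bary, dif_pos h]
  exact h.choose_spec

theorem IsFullSimplex.bary_of_notMem {a : Vec d} (ha : a ∉ K) (x : Vec d) : bary K a x = 0 := by
  rw [hK.isBary.1 a ha]; rfl

theorem IsFullSimplex.bary_vertex {a b : Vec d} (ha : a ∈ K) (hb : b ∈ K) :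
    bary K a b = if a = b then 1 else 0 := hK.isBary.2.1 a ha b hb

theorem IsFullSimplex.sum_bary (x : Vec d) : ∑ a ∈ K, bary K a x = 1 := (hK.isBary.2.2 x).1

theorem IsFullSimplex.sum_bary_smul (x : Vec d) : ∑ a ∈ K, bary K a x • a = x :=
  (hK.isBary.2.2 x).2

/-- The coordinates of an affine combination of vertices are its weights. -/
theorem IsFullSimplex.bary_combination {F : Finset (Vec d)} (hF : F ⊆ K) (w : Vec d → ℝ)
    (hw : ∑ b ∈ F, w b = 1) (a : Vec d) :
    bary K a (∑ b ∈ F, w b • b) = if a ∈ F then w a else 0 := by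
  by_cases haK : a ∈ K
  · rw [affineMap_combination F _ w (fun b => b) hw]
    rw [Finset.sum_congr rfl (fun b hb => by rw [hK.bary_vertex haK (hF hb)])]
    simp
  · rw [hK.bary_of_notMem haK, if_neg (fun h => haK (hF h))]

theorem IsFullSimplex.mem_simplex_iff {x : Vec d} : x ∈ simplex K ↔ ∀ a, 0 ≤ bary K a x := by
  rw [simplex, Finset.mem_convexHull']
  constructor
  · rintro ⟨w, hw, h1, rfl⟩ a
    rw [hK.bary_combination subset_rfl w h1]
    split_ifs with h
    exacts [hw a h, le_rfl]
  · intro h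
    exact ⟨fun a => bary K a x, fun a _ => h a, hK.sum_bary x, hK.sum_bary_smul x⟩

theorem IsFullSimplex.bary_nonneg {x : Vec d} (hx : x ∈ simplex K) (a : Vec d) :
    0 ≤ bary K a x := hK.mem_simplex_iff.1 hx a

theorem IsFullSimplex.bary_le_one {x : Vec d} (hx : x ∈ simplex K) (a : Vec d) :
    bary K a x ≤ 1 := by
  by_cases ha : a ∈ K
  · rw [← hK.sum_bary x]
    exact Finset.single_le_sum (fun b _ => hK.bary_nonneg hx b) ha
  · simp [hK.bary_of_notMem ha]

/-- On a face, the barycentric coordinates at the opposite vertices vanish. -/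
theorem IsFullSimplex.bary_eq_zero_of_mem_face {F : Finset (Vec d)} (hF : F ⊆ K) {x : Vec d}
    (hx : x ∈ simplex F) {a : Vec d} (ha : a ∉ F) : bary K a x = 0 := by
  obtain ⟨w, -, h1, rfl⟩ := Finset.mem_convexHull'.1 hx
  rw [hK.bary_combination hF w h1, if_neg ha]

/-- On a common face, the barycentric coordinates of two simplices agree. -/
theorem IsFullSimplex.bary_eq_of_mem_face {K' F : Finset (Vec d)} (hK' : IsFullSimplex K')
    (hF : F ⊆ K) (hF' : F ⊆ K') {x : Vec d} (hx : x ∈ simplex F) (a : Vec d) :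
    bary K a x = bary K' a x := by
  obtain ⟨w, -, h1, rfl⟩ := Finset.mem_convexHull'.1 hx
  rw [hK.bary_combination hF w h1, hK'.bary_combination hF' w h1]

/-- A point of `K` whose coordinates vanish off `F` lies in the face `F`. -/
theorem IsFullSimplex.mem_face_of_bary {F : Finset (Vec d)} (hF : F ⊆ K) {x : Vec d}
    (hx : ∀ a ∈ F, 0 ≤ bary K a x) (h0 : ∀ a ∈ K, a ∉ F → bary K a x = 0) :
    x ∈ simplex F := by
  refine Finset.mem_convexHull'.2 ⟨fun a => bary K a x, hx, ?_, ?_⟩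
  · rw [← hK.sum_bary x]
    exact Finset.sum_subset hF fun a h1 h2 => h0 a h1 h2
  · conv_rhs => rw [← hK.sum_bary_smul x]
    exact Finset.sum_subset hF fun a h1 h2 => by simp [h0 a h1 h2]

theorem IsFullSimplex.interior_nonempty : (interior (simplex K)).Nonempty :=
  interior_convexHull_nonempty_iff_affineSpan_eq_top.2 hK.affineSpan_eq_top

end

theorem simplex_mono {F K : Finset (Vec d)} (h : F ⊆ K) : simplex F ⊆ simplex K :=
  convexHull_mono (by exact_mod_cast h)

theorem isCompact_simplex (K : Finset (Vec d)) : IsCompact (simplex K) :=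
  K.finite_toSet.isCompact_convexHull ℝ

theorem isClosed_simplex (K : Finset (Vec d)) : IsClosed (simplex K) :=
  (isCompact_simplex K).isClosed

theorem convex_simplex (K : Finset (Vec d)) : Convex ℝ (simplex K) := convex_convexHull ℝ _

theorem measurableSet_simplex (K : Finset (Vec d)) : MeasurableSet (simplex K) :=
  (isClosed_simplex K).measurableSet

/-- Every affinely independent set of vertices extends to a nondegenerate `d`-simplex. -/
theorem exists_isFullSimplex_superset {F : Finset (Vec d)}
    (hF : AffineIndependent ℝ ((↑) : F → Vec d)) : ∃ K, F ⊆ K ∧ IsFullSimplex K := by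
  obtain ⟨t, hst, ht, htop⟩ := exists_subset_affineIndependent_affineSpan_eq_top
    (k := ℝ) (s := (F : Set (Vec d))) hF
  have hfin : t.Finite := by
    have := finite_of_fin_dim_affineIndependent ℝ ht
    exact Set.toFinite t
  lift t to Finset (Vec d) using hfin
  refine ⟨t, by exact_mod_cast hst, ht, ?_⟩
  have := ht.affineSpan_eq_top_iff_card_eq_finrank_add_one.1 (by simpa using htop)
  simpa using this

/-- The centroid of a nonempty set of vertices. -/
def center (F : Finset (Vec d)) : Vec d := ∑ a ∈ F, (F.card : ℝ)⁻¹ • a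

theorem sum_inv_card {F : Finset (Vec d)} (hF : F.Nonempty) : ∑ _a ∈ F, (F.card : ℝ)⁻¹ = 1 := by
  have : (F.card : ℝ) ≠ 0 := by exact_mod_cast hF.card_ne_zero
  simp [this]

theorem center_mem_simplex {F : Finset (Vec d)} (hF : F.Nonempty) : center F ∈ simplex F :=
  Finset.mem_convexHull'.2 ⟨fun _ => (F.card : ℝ)⁻¹, fun _ _ => by positivity, sum_inv_card hF, rfl⟩

theorem IsFullSimplex.bary_center {K F : Finset (Vec d)} (hK : IsFullSimplex K) (hF : F ⊆ K)
    (hne : F.Nonempty) (a : Vec d) :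
    bary K a (center F) = if a ∈ F then (F.card : ℝ)⁻¹ else 0 :=
  hK.bary_combination hF (fun _ => (F.card : ℝ)⁻¹) (sum_inv_card hne) a

/-- A face of a simplex containing the centroid of `F` contains `F`. -/
theorem subset_of_center_mem {F G : Finset (Vec d)}
    (hF : AffineIndependent ℝ ((↑) : F → Vec d)) (hG : G ⊆ F) {H : Finset (Vec d)} (hH : H ⊆ F)
    (hne : H.Nonempty) (h : center H ∈ simplex G) : H ⊆ G := by
  obtain ⟨K, hFK, hK⟩ := exists_isFullSimplex_superset hF
  intro a ha
  by_contra hcon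
  have h1 := hK.bary_center (hH.trans hFK) hne a
  rw [hK.bary_eq_zero_of_mem_face (hG.trans hFK) h hcon, if_pos ha] at h1
  have : (H.card : ℝ) ≠ 0 := by exact_mod_cast hne.card_ne_zero
  exact this (by simpa using h1.symm)

/-! ### Bernstein polynomials -/

theorem finsuppAntidiag_map {ι κ : Type*} [DecidableEq ι] [DecidableEq κ] (e : ι ↪ κ)
    (s : Finset ι) (k : ℕ) :
    (s.map e).finsuppAntidiag k =
      (s.finsuppAntidiag k).map ⟨Finsupp.embDomain e, Finsupp.embDomain_injective e⟩ := by
  ext β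
  simp only [Finset.mem_finsuppAntidiag, Finset.mem_map, Function.Embedding.coeFn_mk]
  constructor
  · rintro ⟨h1, h2⟩
    have h3 : (β.support : Set κ) ⊆ Set.range e := fun a ha => by
      obtain ⟨i, -, rfl⟩ := Finset.mem_map.1 (h2 ha)
      exact ⟨i, rfl⟩
    refine ⟨β.comapDomain e e.injective.injOn, ⟨?_, ?_⟩, Finsupp.embDomain_comapDomain h3⟩
    · rw [← h1, Finset.sum_map]
      rfl
    · intro i hi
      have : e i ∈ β.support := by simpa using hi
      simpa using h2 this
  · rintro ⟨γ, ⟨h1, h2⟩, rfl⟩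
    refine ⟨?_, ?_⟩
    · rw [← h1, Finset.sum_map]
      simp
    · rw [Finsupp.support_embDomain]
      exact Finset.map_subset_map.2 h2

/-- A homogeneous polynomial vanishing on the standard simplex has zero coefficients: by homogeneity
it vanishes on the positive orthant. -/
theorem coeff_eq_zero_of_stdSimplex {n k : ℕ} (hn : 0 < n)
    (c : (Finset.univ : Finset (Fin n)).finsuppAntidiag k → ℝ)
    (h : ∀ l ∈ stdSimplex ℝ (Fin n), ∑ β, c β * (β : Fin n →₀ ℕ).prod (fun a m => l a ^ m) = 0) :
    c = 0 := by
  let P : MvPolynomial (Fin n) ℝ := ∑ β : (Finset.univ : Finset (Fin n)).finsuppAntidiag k,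
    MvPolynomial.monomial (β : Fin n →₀ ℕ) (c β)
  have hP : ∀ l : Fin n → ℝ, MvPolynomial.eval l P =
      ∑ β, c β * (β : Fin n →₀ ℕ).prod (fun a m => l a ^ m) := fun l => by
    simp only [P, map_sum, MvPolynomial.eval_monomial]
  have hscale : ∀ (l : Fin n → ℝ) (t : ℝ), ∑ β, c β *
      (β : Fin n →₀ ℕ).prod (fun a m => (t * l a) ^ m) =
      t ^ k * ∑ β, c β * (β : Fin n →₀ ℕ).prod (fun a m => l a ^ m) := fun l t => by
    rw [Finset.mul_sum]
    refine Finset.sum_congr rfl fun β _ => ?_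
    have hβ : (β : Fin n →₀ ℕ).sum (fun _ m => m) = k :=
      (Finset.mem_finsuppAntidiag'.1 β.2).1
    have : (β : Fin n →₀ ℕ).prod (fun a m => (t * l a) ^ m) =
        t ^ k * (β : Fin n →₀ ℕ).prod (fun a m => l a ^ m) := by
      simp only [Finsupp.prod, mul_pow, Finset.prod_mul_distrib]
      rw [Finset.prod_pow_eq_pow_sum]
      congr 2
    rw [this]; ring
  have hzero : P = 0 := by
    refine MvPolynomial.funext_set (fun _ => Set.Ioi (0 : ℝ)) (fun _ => Set.Ioi_infinite 0) ?_
    intro x hx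
    have hx' : ∀ i, 0 < x i := fun i => hx i (Set.mem_univ i)
    have : Nonempty (Fin n) := ⟨⟨0, hn⟩⟩
    have hs : 0 < ∑ i, x i := Finset.sum_pos (fun i _ => hx' i) Finset.univ_nonempty
    have h1 := h (fun i => (∑ i, x i)⁻¹ * x i) ⟨fun i => by have := hx' i; positivity, by
      rw [← Finset.mul_sum, inv_mul_cancel₀ hs.ne']⟩
    rw [hscale] at h1
    rw [hP, map_zero]
    exact (mul_eq_zero.1 h1).resolve_left (by positivity)
  funext β
  have h2 : MvPolynomial.coeff (β : Fin n →₀ ℕ) P = c β := by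
    simp only [P, MvPolynomial.coeff_sum, MvPolynomial.coeff_monomial]
    rw [Finset.sum_eq_single β]
    · simp
    · intro b _ hb
      rw [if_neg (fun hh => hb (Subtype.ext hh))]
    · simp
  rw [← h2, hzero]; simp

/-- The coefficients of a homogeneous polynomial are bounded by its maximum on the standard simplex:
the restriction to the simplex is an injective linear map on a space of finite dimension. -/
theorem exists_coeff_bound_fin (n k : ℕ) (hn : 0 < n) : ∃ C : ℝ, 0 < C ∧
    ∀ (c : (Finset.univ : Finset (Fin n)).finsuppAntidiag k → ℝ) (M : ℝ),
      (∀ l ∈ stdSimplex ℝ (Fin n),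
        |∑ β, c β * (β : Fin n →₀ ℕ).prod (fun a m => l a ^ m)| ≤ M) → ∀ β, |c β| ≤ C * M := by
  let φ : ((Finset.univ : Finset (Fin n)).finsuppAntidiag k → ℝ) →ₗ[ℝ]
      C(stdSimplex ℝ (Fin n), ℝ) :=
    { toFun := fun c => ⟨fun l =>
          ∑ β, c β * (β : Fin n →₀ ℕ).prod (fun a m => (l : Fin n → ℝ) a ^ m),
        by
          refine continuous_finsetSum _ fun β _ => continuous_const.mul ?_
          exact continuous_finsetProd _ fun a _ =>
            ((continuous_apply a).comp continuous_subtype_val).pow _⟩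
      map_add' := fun c c' => by
        ext l; simp [add_mul, Finset.sum_add_distrib]
      map_smul' := fun t c => by
        ext l; simp [Finset.mul_sum, mul_assoc] }
  have hker : φ.ker = ⊥ := by
    rw [LinearMap.ker_eq_bot']
    intro c hc
    refine coeff_eq_zero_of_stdSimplex hn c fun l hl => ?_
    exact congrArg (fun f : C(stdSimplex ℝ (Fin n), ℝ) => f ⟨l, hl⟩) hc
  obtain ⟨K, hK, hK2⟩ := φ.exists_antilipschitzWith hker
  refine ⟨K, hK, fun c M hM β => ?_⟩
  have hM0 : 0 ≤ M := (abs_nonneg _).trans (hM (Pi.single ⟨0, hn⟩ 1) (single_mem_stdSimplex ℝ _))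
  have h1 : ‖φ c‖ ≤ M := (ContinuousMap.norm_le _ hM0).2 fun l => hM l l.2
  have h2 := hK2.le_mul_dist c 0
  rw [map_zero, dist_zero_right, dist_zero_right] at h2
  calc |c β| ≤ ‖c‖ := norm_le_pi_norm c β
    _ ≤ K * ‖φ c‖ := h2
    _ ≤ K * M := by gcongr

/-- On a simplex with `n` vertices, the coefficients of a homogeneous polynomial in the barycentric
coordinates are bounded by its maximum, with a constant depending only on `n` and the degree. -/
theorem exists_coeff_bound (n k : ℕ) (hn : 0 < n) : ∃ C : ℝ, 0 < C ∧
    ∀ {ι : Type} [DecidableEq ι] (F : Finset ι), F.card = n → ∀ (c : (ι →₀ ℕ) → ℝ) (M : ℝ),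
      (∀ l : ι → ℝ, (∀ a ∈ F, 0 ≤ l a) → ∑ a ∈ F, l a = 1 →
        |∑ β ∈ F.finsuppAntidiag k, c β * β.prod (fun a m => l a ^ m)| ≤ M) →
      ∀ α ∈ F.finsuppAntidiag k, |c α| ≤ C * M := by
  obtain ⟨C, hC, h⟩ := exists_coeff_bound_fin n k hn
  refine ⟨C, hC, fun {ι} _ F hF c M hM => ?_⟩
  let e : Fin n ↪ ι := (F.equivFinOfCardEq hF).symm.toEmbedding.trans (Function.Embedding.subtype _)
  have hFe : F = (Finset.univ : Finset (Fin n)).map e := by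
    ext a
    simp only [Finset.mem_map, Finset.mem_univ, true_and]
    constructor
    · intro ha
      exact ⟨F.equivFinOfCardEq hF ⟨a, ha⟩, by simp [e]⟩
    · rintro ⟨i, rfl⟩
      exact ((F.equivFinOfCardEq hF).symm i).2
  clear_value e
  subst hFe
  have key := h (fun β => c (Finsupp.embDomain e β)) M fun l hl => by
    have hl' : ∀ i, Function.extend e l 0 (e i) = l i := fun i => e.injective.extend_apply l 0 i
    have := hM (Function.extend e l 0)
      (fun a ha => by
        obtain ⟨i, -, rfl⟩ := Finset.mem_map.1 ha
        rw [hl']; exact hl.1 i)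
      (by rw [Finset.sum_map]; simp_rw [hl']; exact hl.2)
    rw [finsuppAntidiag_map, Finset.sum_map] at this
    simp only [Function.Embedding.coeFn_mk, Finsupp.prod_embDomain, hl'] at this
    rw [← Finset.sum_coe_sort] at this
    exact this
  intro α hα
  rw [finsuppAntidiag_map] at hα
  obtain ⟨β, hβ, rfl⟩ := Finset.mem_map.1 hα
  exact key ⟨β, hβ⟩

/-- The Bernstein polynomial (without its multinomial factor) `∏ₐ λₐ ^ αₐ` in the barycentric
coordinates of the simplex `K`. -/
def bern (K : Finset (Vec d)) (α : Vec d →₀ ℕ) (x : Vec d) : ℝ :=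
  α.prod fun a m => bary K a x ^ m

/-- The vector field of degree `k` with the Bernstein coefficients `c` on the simplex `K`. Only the
coefficients whose index is supported in the vertices of `K` matter. -/
def bpoly (k : ℕ) (K : Finset (Vec d)) (c : (Vec d →₀ ℕ) → Vec d) (x : Vec d) : Vec d :=
  ∑ α ∈ K.finsuppAntidiag k, bern K α x • c α

theorem bary_continuous (K : Finset (Vec d)) (a : Vec d) : Continuous (bary K a) :=
  (bary K a).continuous_of_finiteDimensional

theorem bern_continuous (K : Finset (Vec d)) (α : Vec d →₀ ℕ) : Continuous (bern K α) := by
  unfold bern Finsupp.prod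
  exact continuous_finsetProd _ fun a _ => (bary_continuous K a).pow _

theorem bpoly_continuous (k : ℕ) (K : Finset (Vec d)) (c : (Vec d →₀ ℕ) → Vec d) :
    Continuous (bpoly k K c) :=
  continuous_finsetSum _ fun α _ => (bern_continuous K α).smul continuous_const

theorem bpoly_add (k : ℕ) (K : Finset (Vec d)) (c c' : (Vec d →₀ ℕ) → Vec d) (x : Vec d) :
    bpoly k K (c + c') x = bpoly k K c x + bpoly k K c' x := by
  simp [bpoly, smul_add, Finset.sum_add_distrib]

theorem bpoly_smul (k : ℕ) (K : Finset (Vec d)) (t : ℝ) (c : (Vec d →₀ ℕ) → Vec d) (x : Vec d) :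
    bpoly k K (t • c) x = t • bpoly k K c x := by
  simp [bpoly, Finset.smul_sum, smul_comm t]

theorem bpoly_sub (k : ℕ) (K : Finset (Vec d)) (c c' : (Vec d →₀ ℕ) → Vec d) (x : Vec d) :
    bpoly k K (c - c') x = bpoly k K c x - bpoly k K c' x := by
  simp [bpoly, smul_sub]

theorem bpoly_congr {k : ℕ} {K : Finset (Vec d)} {c c' : (Vec d →₀ ℕ) → Vec d}
    (h : ∀ α ∈ K.finsuppAntidiag k, c α = c' α) : bpoly k K c = bpoly k K c' := by
  funext x
  exact Finset.sum_congr rfl fun α hα => by rw [h α hα]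

section

variable {K : Finset (Vec d)} (hK : IsFullSimplex K)
include hK

theorem IsFullSimplex.bern_eq_zero {F : Finset (Vec d)} (hF : F ⊆ K) {x : Vec d}
    (hx : x ∈ simplex F) {α : Vec d →₀ ℕ} (hα : ¬ α.support ⊆ F) : bern K α x = 0 := by
  obtain ⟨a, ha, haF⟩ := Finset.not_subset.1 hα
  refine Finset.prod_eq_zero ha ?_
  simp only
  rw [hK.bary_eq_zero_of_mem_face hF hx haF, zero_pow (Finsupp.mem_support_iff.1 ha)]

/-- On a face, only the coefficients with index supported in the face matter. -/
theorem IsFullSimplex.bpoly_face {F : Finset (Vec d)} (hF : F ⊆ K) (k : ℕ)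
    (c : (Vec d →₀ ℕ) → Vec d) {x : Vec d} (hx : x ∈ simplex F) :
    bpoly k K c x = ∑ α ∈ F.finsuppAntidiag k, bern K α x • c α := by
  refine (Finset.sum_subset (Finset.finsuppAntidiag_mono hF k) fun α h1 h2 => ?_).symm
  rw [hK.bern_eq_zero hF hx, zero_smul]
  intro h3
  refine h2 (Finset.mem_finsuppAntidiag'.2 ⟨(Finset.mem_finsuppAntidiag'.1 h1).1, h3⟩)

theorem IsFullSimplex.bern_eq_of_mem_face {K' F : Finset (Vec d)} (hK' : IsFullSimplex K')
    (hF : F ⊆ K) (hF' : F ⊆ K') {x : Vec d} (hx : x ∈ simplex F) (α : Vec d →₀ ℕ) :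
    bern K α x = bern K' α x := by
  unfold bern Finsupp.prod
  exact Finset.prod_congr rfl fun a _ => by
    simp only [hK.bary_eq_of_mem_face hK' hF hF' hx]

/-- On a common face, the fields with the same coefficients in two simplices agree. -/
theorem IsFullSimplex.bpoly_eq_of_mem_face {K' F : Finset (Vec d)} (hK' : IsFullSimplex K')
    (hF : F ⊆ K) (hF' : F ⊆ K') (k : ℕ) (c : (Vec d →₀ ℕ) → Vec d) {x : Vec d}
    (hx : x ∈ simplex F) : bpoly k K c x = bpoly k K' c x := by
  rw [hK.bpoly_face hF k c hx, hK'.bpoly_face hF' k c hx]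
  exact Finset.sum_congr rfl fun α _ => by rw [hK.bern_eq_of_mem_face hK' hF hF' hx]

theorem IsFullSimplex.bern_nonneg {x : Vec d} (hx : x ∈ simplex K) (α : Vec d →₀ ℕ) :
    0 ≤ bern K α x := Finset.prod_nonneg fun a _ => pow_nonneg (hK.bary_nonneg hx a) _

theorem IsFullSimplex.bern_le_one {x : Vec d} (hx : x ∈ simplex K) (α : Vec d →₀ ℕ) :
    bern K α x ≤ 1 :=
  Finset.prod_le_one (fun a _ => pow_nonneg (hK.bary_nonneg hx a) _)
    fun a _ => pow_le_one₀ (hK.bary_nonneg hx a) (hK.bary_le_one hx a)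

theorem IsFullSimplex.norm_bpoly_le {x : Vec d} (hx : x ∈ simplex K) (k : ℕ)
    (c : (Vec d →₀ ℕ) → Vec d) : ‖bpoly k K c x‖ ≤ ∑ α ∈ K.finsuppAntidiag k, ‖c α‖ := by
  refine (norm_sum_le _ _).trans (Finset.sum_le_sum fun α _ => ?_)
  rw [norm_smul, Real.norm_eq_abs, abs_of_nonneg (hK.bern_nonneg hx α)]
  exact mul_le_of_le_one_left (norm_nonneg _) (hK.bern_le_one hx α)

end

theorem abs_pow_sub_pow_le_of_unit {x y : ℝ} (hx : x ∈ Icc (0 : ℝ) 1) (hy : y ∈ Icc (0 : ℝ) 1)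
    (n : ℕ) : |x ^ n - y ^ n| ≤ n * |x - y| := by
  induction n with
  | zero => simp
  | succ n ih =>
    have : x ^ (n + 1) - y ^ (n + 1) = x * (x ^ n - y ^ n) + (x - y) * y ^ n := by ring
    rw [this]
    refine (abs_add_le _ _).trans ?_
    rw [abs_mul, abs_mul, abs_of_nonneg hx.1, abs_of_nonneg (pow_nonneg hy.1 n)]
    have h1 := mul_le_of_le_one_left (abs_nonneg (x ^ n - y ^ n)) hx.2
    have h2 := mul_le_of_le_one_right (abs_nonneg (x - y)) (pow_le_one₀ hy.1 hy.2 (n := n))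
    push_cast
    linarith

theorem abs_prod_sub_prod_le_of_unit {ι : Type*} (s : Finset ι) (f g : ι → ℝ)
    (hf : ∀ i ∈ s, f i ∈ Icc (0 : ℝ) 1) (hg : ∀ i ∈ s, g i ∈ Icc (0 : ℝ) 1) :
    |∏ i ∈ s, f i - ∏ i ∈ s, g i| ≤ ∑ i ∈ s, |f i - g i| := by
  classical
  induction s using Finset.induction_on with
  | empty => simp
  | insert a s ha ih =>
    rw [Finset.prod_insert ha, Finset.prod_insert ha, Finset.sum_insert ha]
    have ih' := ih (fun i hi => hf i (Finset.mem_insert_of_mem hi))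
      (fun i hi => hg i (Finset.mem_insert_of_mem hi))
    have e : f a * ∏ i ∈ s, f i - g a * ∏ i ∈ s, g i =
        (f a - g a) * ∏ i ∈ s, g i + f a * (∏ i ∈ s, f i - ∏ i ∈ s, g i) := by ring
    rw [e]
    refine (abs_add_le _ _).trans ?_
    have hfa := hf a (Finset.mem_insert_self a s)
    have hp0 : 0 ≤ ∏ i ∈ s, g i :=
      Finset.prod_nonneg fun i hi => (hg i (Finset.mem_insert_of_mem hi)).1
    have hp1 : ∏ i ∈ s, g i ≤ 1 :=
      Finset.prod_le_one (fun i hi => (hg i (Finset.mem_insert_of_mem hi)).1)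
        fun i hi => (hg i (Finset.mem_insert_of_mem hi)).2
    rw [abs_mul, abs_mul, abs_of_nonneg hp0, abs_of_nonneg hfa.1]
    have h1 := mul_le_of_le_one_right (abs_nonneg (f a - g a)) hp1
    have h2 := mul_le_of_le_one_left (abs_nonneg (∏ i ∈ s, f i - ∏ i ∈ s, g i)) hfa.2
    linarith

section

variable {K : Finset (Vec d)} (hK : IsFullSimplex K)
include hK

theorem IsFullSimplex.abs_bern_sub_le {k : ℕ} {α : Vec d →₀ ℕ} (hα : α ∈ K.finsuppAntidiag k)
    {x y : Vec d} (hx : x ∈ simplex K) (hy : y ∈ simplex K) {δ : ℝ}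
    (hδ : ∀ a ∈ K, |bary K a x - bary K a y| ≤ δ) : |bern K α x - bern K α y| ≤ k * δ := by
  obtain ⟨h1, h2⟩ := Finset.mem_finsuppAntidiag'.1 hα
  have hu : ∀ {z}, z ∈ simplex K → ∀ a, bary K a z ∈ Icc (0 : ℝ) 1 := fun hz a =>
    ⟨hK.bary_nonneg hz a, hK.bary_le_one hz a⟩
  have hp : ∀ {z}, z ∈ simplex K → ∀ a n, bary K a z ^ n ∈ Icc (0 : ℝ) 1 := fun hz a n =>
    ⟨pow_nonneg (hu hz a).1 n, pow_le_one₀ (hu hz a).1 (hu hz a).2⟩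
  calc |bern K α x - bern K α y|
      ≤ ∑ a ∈ α.support, |bary K a x ^ α a - bary K a y ^ α a| :=
        abs_prod_sub_prod_le_of_unit _ _ _ (fun a _ => hp hx a _) (fun a _ => hp hy a _)
    _ ≤ ∑ a ∈ α.support, (α a : ℝ) * δ := by
        refine Finset.sum_le_sum fun a ha => ?_
        exact (abs_pow_sub_pow_le_of_unit (hu hx a) (hu hy a) _).trans
          (mul_le_mul_of_nonneg_left (hδ a (h2 ha)) (Nat.cast_nonneg _))
    _ = k * δ := by
        rw [← Finset.sum_mul, ← h1, Finsupp.sum]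
        push_cast
        rfl

theorem IsFullSimplex.norm_bpoly_sub_le {k : ℕ} (c : (Vec d →₀ ℕ) → Vec d)
    {x y : Vec d} (hx : x ∈ simplex K) (hy : y ∈ simplex K) {δ : ℝ}
    (hδ : ∀ a ∈ K, |bary K a x - bary K a y| ≤ δ) :
    ‖bpoly k K c x - bpoly k K c y‖ ≤ (∑ α ∈ K.finsuppAntidiag k, ‖c α‖) * (k * δ) := by
  rw [bpoly, bpoly, ← Finset.sum_sub_distrib, Finset.sum_mul]
  refine (norm_sum_le _ _).trans (Finset.sum_le_sum fun α hα => ?_)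
  rw [← sub_smul, norm_smul, mul_comm]
  exact mul_le_mul_of_nonneg_left (hK.abs_bern_sub_le hα hx hy hδ) (norm_nonneg _)

/-- Every polynomial vector field of degree at most `k` has Bernstein coefficients of degree `k`:
substitute `x = ∑ₐ λₐ a` and multiply each monomial by a power of `∑ₐ λₐ = 1`. -/
theorem IsFullSimplex.exists_bpoly_eq {k : ℕ} (q : Fin d → MvPolynomial (Fin d) ℝ)
    (hq : ∀ i, (q i).totalDegree ≤ k) : ∃ c : (Vec d →₀ ℕ) → Vec d,
      ∀ x i, bpoly k K c x i = MvPolynomial.eval (fun j => x j) (q i) := by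
  let X (j : Fin d) : MvPolynomial (Vec d) ℝ := ∑ a ∈ K, MvPolynomial.C (a j) * MvPolynomial.X a
  let S : MvPolynomial (Vec d) ℝ := ∑ a ∈ K, MvPolynomial.X a
  let P (i : Fin d) : MvPolynomial (Vec d) ℝ := ∑ m ∈ (q i).support,
    MvPolynomial.C ((q i).coeff m) * ((∏ j, X j ^ m j) * S ^ (k - ∑ j, m j))
  have hX : ∀ j, (X j).IsHomogeneous 1 := fun j =>
    MvPolynomial.IsHomogeneous.sum _ _ _ fun a _ => by
      simpa using (MvPolynomial.isHomogeneous_C _ (a j)).mul (MvPolynomial.isHomogeneous_X ℝ a)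
  have hS : S.IsHomogeneous 1 :=
    MvPolynomial.IsHomogeneous.sum _ _ _ fun a _ => MvPolynomial.isHomogeneous_X ℝ a
  have hdeg : ∀ i, ∀ m ∈ (q i).support, ∑ j, m j ≤ k := fun i m hm => by
    refine le_trans ?_ (hq i)
    have := MvPolynomial.le_totalDegree hm
    rwa [Finsupp.sum_fintype _ _ (fun _ => rfl)] at this
  have hP : ∀ i, (P i).IsHomogeneous k := fun i =>
    MvPolynomial.IsHomogeneous.sum _ _ _ fun m hm => by
      have h1 : (∏ j, X j ^ m j).IsHomogeneous (∑ j, m j) :=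
        MvPolynomial.IsHomogeneous.prod _ _ _ fun j _ => by simpa using (hX j).pow (m j)
      have h2 : (S ^ (k - ∑ j, m j)).IsHomogeneous (k - ∑ j, m j) := by simpa using hS.pow _
      have := (MvPolynomial.isHomogeneous_C (Vec d) ((q i).coeff m)).mul (h1.mul h2)
      rwa [zero_add, Nat.add_sub_cancel' (hdeg i m hm)] at this
  have hev : ∀ i x, MvPolynomial.eval (fun a => bary K a x) (P i) =
      MvPolynomial.eval (fun j => x j) (q i) := fun i x => by
    have hXx : ∀ j, MvPolynomial.eval (fun a => bary K a x) (X j) = x j := fun j => by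
      have := congrArg (fun y : Vec d => y j) (hK.sum_bary_smul x)
      simpa [X, mul_comm] using this
    have hSx : MvPolynomial.eval (fun a => bary K a x) S = 1 := by
      simpa [S] using hK.sum_bary x
    simp only [P, map_sum, map_mul, MvPolynomial.eval_C, map_prod, map_pow, hXx, hSx, one_pow,
      mul_one]
    rw [MvPolynomial.eval_eq]
    exact Finset.sum_congr rfl fun m _ => by
      rw [← Finsupp.prod_fintype m (fun j n => x j ^ n) (fun _ => pow_zero _)]; rfl
  refine ⟨fun α => WithLp.toLp 2 fun i => (P i).coeff α, fun x i => ?_⟩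
  rw [← hev, MvPolynomial.eval_eq, bpoly]
  have hlhs : (∑ α ∈ K.finsuppAntidiag k, bern K α x • (WithLp.toLp 2 fun i => (P i).coeff α :
      Vec d)) i = ∑ α ∈ K.finsuppAntidiag k, (P i).coeff α * bern K α x := by
    simp [mul_comm]
  rw [hlhs]
  -- the sums over the multi-indices of degree `k` and over the support of `P i` have the same
  -- nonzero terms
  have hcut : ∀ s : Finset (Vec d →₀ ℕ), ∑ α ∈ s, (P i).coeff α * bern K α x =
      ∑ α ∈ s.filter (fun α => α ∈ (P i).support ∧ α.support ⊆ K),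
        (P i).coeff α * bern K α x := fun s => by
    rw [Finset.sum_filter]
    refine Finset.sum_congr rfl fun α _ => ?_
    split_ifs with h
    · rfl
    · rw [not_and_or] at h
      rcases h with h | h
      · rw [MvPolynomial.notMem_support_iff.1 h, zero_mul]
      · obtain ⟨a, ha, haF⟩ := Finset.not_subset.1 h
        have : bern K α x = 0 := Finset.prod_eq_zero ha (by
          simp only
          rw [hK.bary_of_notMem haF, zero_pow (Finsupp.mem_support_iff.1 ha)])
        rw [this, mul_zero]
  change _ = ∑ α ∈ (P i).support, (P i).coeff α * bern K α x
  rw [hcut, hcut (P i).support]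
  refine Finset.sum_congr ?_ fun _ _ => rfl
  ext α
  simp only [Finset.mem_filter, Finset.mem_finsuppAntidiag']
  constructor
  · rintro ⟨-, h⟩
    exact ⟨h.1, h⟩
  · rintro ⟨h1, h⟩
    refine ⟨⟨?_, h.2⟩, h⟩
    have := (hP i) (MvPolynomial.mem_support_iff.1 h1)
    rw [← this, Finsupp.weight_apply]
    simp [Finsupp.sum]

end

/-- A field with Bernstein coefficients of degree `k` is a polynomial of degree at most `k`. -/
theorem exists_eval_eq_bpoly (k : ℕ) (K : Finset (Vec d)) (c : (Vec d →₀ ℕ) → Vec d) :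
    ∃ q : Fin d → MvPolynomial (Fin d) ℝ, (∀ i, (q i).totalDegree ≤ k) ∧
      ∀ x i, bpoly k K c x i = MvPolynomial.eval (fun j => x j) (q i) := by
  let L (a : Vec d) : MvPolynomial (Fin d) ℝ := MvPolynomial.C (bary K a 0) +
    ∑ j, MvPolynomial.C ((bary K a).linear (EuclideanSpace.single j 1)) * MvPolynomial.X j
  have hL : ∀ a, (L a).totalDegree ≤ 1 := fun a => by
    refine (MvPolynomial.totalDegree_add _ _).trans (max_le (by simp) ?_)
    refine MvPolynomial.totalDegree_finsetSum_le fun j _ => ?_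
    refine (MvPolynomial.totalDegree_mul _ _).trans ?_
    simp
  have hLx : ∀ a (x : Vec d), MvPolynomial.eval (fun j => x j) (L a) = bary K a x := fun a x => by
    have h1 : bary K a x = (bary K a).linear x + bary K a 0 := by
      simpa using (bary K a).map_vadd 0 x
    have h2 : x = ∑ j, x j • EuclideanSpace.single j (1 : ℝ) := by
      ext i
      simp [Finset.sum_apply, Pi.single_apply]
    have h3 : (bary K a).linear x = ∑ j, x j * (bary K a).linear (EuclideanSpace.single j 1) := by
      conv_lhs => rw [h2]
      simp
    rw [h1, h3]
    simp [L, add_comm, mul_comm]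
  refine ⟨fun i => ∑ α ∈ K.finsuppAntidiag k, MvPolynomial.C (c α i) * α.prod fun a m => L a ^ m,
    fun i => ?_, fun x i => ?_⟩
  · refine MvPolynomial.totalDegree_finsetSum_le fun α hα => ?_
    refine (MvPolynomial.totalDegree_mul _ _).trans ?_
    rw [MvPolynomial.totalDegree_C, zero_add]
    refine (MvPolynomial.totalDegree_finsetProd _ _).trans ?_
    rw [← (Finset.mem_finsuppAntidiag'.1 hα).1, Finsupp.sum]
    refine Finset.sum_le_sum fun a _ => ?_
    refine (MvPolynomial.totalDegree_pow _ _).trans ?_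
    exact (Nat.mul_le_mul_left _ (hL a)).trans (by simp)
  · simp [bpoly, bern, Finsupp.prod, hLx, mul_comm]

/-! ### Size and shape of simplices -/

theorem dist_le_diam_simplex {K : Finset (Vec d)} {x y : Vec d} (hx : x ∈ simplex K)
    (hy : y ∈ simplex K) : ‖x - y‖ ≤ Metric.diam (simplex K) := by
  rw [← dist_eq_norm]
  exact Metric.dist_le_diam_of_mem (isCompact_simplex K).isBounded hx hy

theorem vertex_mem_simplex {K : Finset (Vec d)} {a : Vec d} (ha : a ∈ K) : a ∈ simplex K :=
  subset_convexHull ℝ _ ha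

theorem bddAbove_inball (hd : 0 < d) (K : Finset (Vec d)) :
    BddAbove {δ | ∃ (c : Vec d) (r : ℝ), 0 ≤ r ∧ Metric.closedBall c r ⊆ simplex K ∧
      δ = 2 * r} := by
  refine ⟨Metric.diam (simplex K), ?_⟩
  rintro _ ⟨c, r, hr, hc, rfl⟩
  let e : Vec d := EuclideanSpace.single ⟨0, hd⟩ 1
  have he : ‖e‖ = 1 := by simp [e]
  have h1 : c + r • e ∈ simplex K := hc (by simp [norm_smul, he, abs_of_nonneg hr])
  have h2 : c - r • e ∈ simplex K := hc (by simp [norm_smul, he, abs_of_nonneg hr])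
  have h3 := dist_le_diam_simplex h1 h2
  have h4 : c + r • e - (c - r • e) = (2 * r) • e := by rw [mul_smul, two_smul]; abel
  rwa [h4, norm_smul, he, mul_one, Real.norm_eq_abs, abs_of_nonneg (by positivity)] at h3

section

variable {K : Finset (Vec d)} (hK : IsFullSimplex K)
include hK

theorem IsFullSimplex.inballDiameter_pos (hd : 0 < d) : 0 < inballDiameter (simplex K) := by
  obtain ⟨c, hc⟩ := hK.interior_nonempty
  obtain ⟨r, hr, hr2⟩ := Metric.nhds_basis_closedBall.mem_iff.1 (mem_interior_iff_mem_nhds.1 hc)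
  exact (by positivity : 0 < 2 * r).trans_le
    (le_csSup (bddAbove_inball hd K) ⟨c, r, hr.le, hr2, rfl⟩)

/-- The supremum defining the inball diameter need not be attained a priori, which costs a factor
two in the radius. -/
theorem IsFullSimplex.exists_closedBall_subset (hd : 0 < d) :
    ∃ c, Metric.closedBall c (inballDiameter (simplex K) / 4) ⊆ simplex K := by
  have hpos := hK.inballDiameter_pos hd
  obtain ⟨x, hx⟩ := hK.interior_nonempty
  obtain ⟨_, ⟨c, r, hr, hc, rfl⟩, h⟩ := exists_lt_of_lt_csSup
    (s := {δ | ∃ (c : Vec d) (r : ℝ), 0 ≤ r ∧ Metric.closedBall c r ⊆ simplex K ∧ δ = 2 * r})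
    ⟨_, x, 0, le_rfl, by simpa using interior_subset hx, rfl⟩
    (half_lt_self hpos)
  refine ⟨c, (Metric.closedBall_subset_closedBall ?_).trans hc⟩
  change inballDiameter (simplex K) / 2 < 2 * r at h
  linarith

/-- The gradients of the barycentric coordinates are bounded by the inverse of the inball diameter:
an affine function with values in `[0, 1]` on a ball of diameter `δ` has slope at most `1 / δ`. -/
theorem IsFullSimplex.abs_bary_sub_mul_le (a x y : Vec d) :
    |bary K a x - bary K a y| * inballDiameter (simplex K) ≤ ‖x - y‖ := by
  rcases eq_or_ne (|bary K a x - bary K a y|) 0 with h0 | h0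
  · rw [h0, zero_mul]; exact norm_nonneg _
  have hD : 0 < |bary K a x - bary K a y| := lt_of_le_of_ne (abs_nonneg _) h0.symm
  have hxy : 0 < ‖x - y‖ := by
    rw [norm_pos_iff, sub_ne_zero]
    rintro rfl
    simp at h0
  rw [mul_comm, ← le_div_iff₀ hD]
  obtain ⟨z, hz⟩ := hK.interior_nonempty
  refine csSup_le ⟨_, z, 0, le_rfl, by simpa using interior_subset hz, rfl⟩ ?_
  rintro _ ⟨c, r, hr, hc, rfl⟩
  rw [le_div_iff₀ hD]
  let e : Vec d := ‖x - y‖⁻¹ • (x - y)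
  have he : ‖e‖ = 1 := by simp [e, norm_smul, inv_mul_cancel₀ hxy.ne']
  have h1 : c + r • e ∈ simplex K := hc (by simp [norm_smul, he, abs_of_nonneg hr])
  have h2 : c - r • e ∈ simplex K := hc (by simp [norm_smul, he, abs_of_nonneg hr])
  have hlin : ∀ u v, bary K a u - bary K a v = (bary K a).linear (u - v) := fun u v => by
    simpa using ((bary K a).linearMap_vsub u v).symm
  have h4 : c + r • e - (c - r • e) = (2 * r * ‖x - y‖⁻¹) • (x - y) := by
    simp only [e]; rw [mul_smul, mul_smul, two_smul]; abel
  have h5 : |bary K a (c + r • e) - bary K a (c - r • e)| ≤ 1 := by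
    rw [abs_le]
    constructor <;> linarith [hK.bary_nonneg h1 a, hK.bary_le_one h1 a, hK.bary_nonneg h2 a,
      hK.bary_le_one h2 a]
  rw [hlin, h4, map_smul, ← hlin, smul_eq_mul, abs_mul, abs_of_nonneg (by positivity)] at h5
  have h6 : 2 * r * ‖x - y‖⁻¹ * |bary K a x - bary K a y| * ‖x - y‖ ≤ 1 * ‖x - y‖ := by gcongr
  calc 2 * r * |bary K a x - bary K a y|
      = 2 * r * ‖x - y‖⁻¹ * |bary K a x - bary K a y| * ‖x - y‖ := by field_simp
    _ ≤ ‖x - y‖ := by linarith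

/-- The edges of a simplex are at least as long as its inball diameter. -/
theorem IsFullSimplex.inballDiameter_le_edge {a b : Vec d} (ha : a ∈ K) (hb : b ∈ K)
    (hab : a ≠ b) : inballDiameter (simplex K) ≤ ‖a - b‖ := by
  have := hK.abs_bary_sub_mul_le a a b
  rwa [hK.bary_vertex ha ha, hK.bary_vertex ha hb, if_pos rfl, if_neg hab, sub_zero, abs_one,
    one_mul] at this

/-- A simplex whose diameter is at most `θ` times its inball diameter contains, in the ball of
radius `s` about any of its points, a ball of radius `s / (4 θ)`. -/
theorem IsFullSimplex.exists_closedBall_subset_inter (hd : 0 < d) {θ : ℝ} (hθ : 0 < θ)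
    (hs : Metric.diam (simplex K) ≤ θ * inballDiameter (simplex K)) {a : Vec d}
    (ha : a ∈ simplex K) {s : ℝ} (hs0 : 0 < s) (hsd : s ≤ Metric.diam (simplex K)) :
    ∃ c, Metric.closedBall c (s / (4 * θ)) ⊆ simplex K ∩ Metric.closedBall a s := by
  obtain ⟨c, hc⟩ := hK.exists_closedBall_subset hd
  set D := Metric.diam (simplex K)
  have hD : 0 < D := hs0.trans_le hsd
  -- shrink the simplex and its ball towards `a` by the factor `s / D`
  have hl0 : 0 < s / D := by positivity
  have hl1 : s / D ≤ 1 := (div_le_one hD).2 hsd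
  refine ⟨a + (s / D) • (c - a), fun y hy => ?_⟩
  let x : Vec d := a + (s / D)⁻¹ • (y - a)
  have hyx : y = a + (s / D) • (x - a) := by
    simp only [x, add_sub_cancel_left, smul_smul]
    rw [mul_inv_cancel₀ hl0.ne', one_smul]; abel
  have hx : x ∈ simplex K := by
    refine hc ?_
    rw [Metric.mem_closedBall, dist_eq_norm] at hy ⊢
    have e : y - (a + (s / D) • (c - a)) = (s / D) • (x - c) := by
      rw [hyx, add_sub_add_left_eq_sub, ← smul_sub]; congr 1; abel
    rw [e, norm_smul, Real.norm_eq_abs, abs_of_pos hl0] at hy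
    have h1 : ‖x - c‖ ≤ D / (4 * θ) := by
      have : s / D * ‖x - c‖ ≤ s / D * (D / (4 * θ)) := by
        refine hy.trans_eq ?_
        field_simp
      exact le_of_mul_le_mul_left this hl0
    refine h1.trans ?_
    rw [div_le_div_iff₀ (by positivity) (by norm_num)]
    linarith
  constructor
  · have := convex_simplex K ha hx (sub_nonneg.2 hl1) hl0.le (by ring)
    rw [hyx]
    convert this using 1
    rw [smul_sub, sub_smul, one_smul]; abel
  · rw [Metric.mem_closedBall, dist_eq_norm, hyx, add_sub_cancel_left, norm_smul,
      Real.norm_eq_abs, abs_of_pos hl0]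
    calc s / D * ‖x - a‖ ≤ s / D * D := by
          gcongr
          exact dist_le_diam_simplex hx ha
      _ = s := by field_simp

theorem IsFullSimplex.diam_pos (hd : 0 < d) : 0 < Metric.diam (simplex K) := by
  have h2 : 1 < K.card := by rw [hK.card_eq]; omega
  obtain ⟨a, ha, b, hb, hab⟩ := Finset.one_lt_card.1 h2
  exact (norm_pos_iff.2 (sub_ne_zero.2 hab)).trans_le
    (dist_le_diam_simplex (vertex_mem_simplex ha) (vertex_mem_simplex hb))

theorem IsFullSimplex.inballDiameter_le_diam (hd : 0 < d) :
    inballDiameter (simplex K) ≤ Metric.diam (simplex K) := by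
  have h2 : 1 < K.card := by rw [hK.card_eq]; omega
  obtain ⟨a, ha, b, hb, hab⟩ := Finset.one_lt_card.1 h2
  exact (hK.inballDiameter_le_edge ha hb hab).trans
    (dist_le_diam_simplex (vertex_mem_simplex ha) (vertex_mem_simplex hb))

end

/-- The affine span of at most `d` points is a null set. -/
theorem volume_affineSpan_eq_zero {F : Finset (Vec d)} (hF : F.card ≤ d) :
    volume (affineSpan ℝ (F : Set (Vec d)) : Set (Vec d)) = 0 := by
  refine Measure.addHaar_affineSubspace _ _ fun htop => ?_
  rcases F.eq_empty_or_nonempty with rfl | hne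
  · rw [Finset.coe_empty, AffineSubspace.span_empty] at htop
    exact AffineSubspace.bot_ne_top ℝ (Vec d) (Vec d) htop
  · have : Nonempty F := hne.to_subtype
    have h1 := finrank_vectorSpan_range_add_one_le ℝ ((↑) : F → Vec d)
    have h2 : vectorSpan ℝ (F : Set (Vec d)) = ⊤ := by
      rw [← direction_affineSpan, htop, AffineSubspace.direction_top]
    have h3 : Set.range ((↑) : F → Vec d) = F := by simp
    rw [h3, h2, finrank_top] at h1
    simp at h1
    omega

theorem simplex_subset_affineSpan (F : Finset (Vec d)) :
    simplex F ⊆ affineSpan ℝ (F : Set (Vec d)) := convexHull_subset_affineSpan _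

theorem volume_simplex_eq_zero {F : Finset (Vec d)} (hF : F.card ≤ d) : volume (simplex F) = 0 :=
  measure_mono_null (simplex_subset_affineSpan F) (volume_affineSpan_eq_zero hF)

/-! ### Elements and stars of a mesh -/

namespace Mesh

variable {Ω : Set (Vec d)} (T : Mesh Ω)

theorem mem_elements {K : Finset (Vec d)} : K ∈ T.elements ↔ K ∈ T.faces ∧ K.card = d + 1 := by
  simp [elements]

theorem mem_meshFaces {F : Finset (Vec d)} : F ∈ T.meshFaces ↔ F ∈ T.faces ∧ F.card = d := by
  simp [meshFaces]

theorem mem_boundaryFaces {F : Finset (Vec d)} :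
    F ∈ T.boundaryFaces ↔ F ∈ T.meshFaces ∧ simplex F ⊆ frontier Ω := by
  simp [boundaryFaces]

theorem mem_interiorFaces {F : Finset (Vec d)} :
    F ∈ T.interiorFaces ↔ F ∈ T.meshFaces ∧ ¬ simplex F ⊆ frontier Ω := by
  simp [interiorFaces]

theorem mem_adjacent {F K : Finset (Vec d)} : K ∈ T.adjacent F ↔ K ∈ T.elements ∧ F ⊆ K := by
  simp [adjacent]

variable {T}

theorem isFullSimplex {K : Finset (Vec d)} (hK : K ∈ T.elements) : IsFullSimplex K :=
  ⟨T.indep (T.mem_elements.1 hK).1, (T.mem_elements.1 hK).2⟩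

theorem simplex_subset_closure {K : Finset (Vec d)} (hK : K ∈ T.faces) :
    simplex K ⊆ closure Ω := by
  rw [← T.space_eq]
  exact T.convexHull_subset_space hK

theorem mem_simplex_inter {K K' : Finset (Vec d)} (hK : K ∈ T.faces) (hK' : K' ∈ T.faces)
    {x : Vec d} (hx : x ∈ simplex K) (hx' : x ∈ simplex K') : x ∈ simplex (K ∩ K') := by
  have := T.inter_subset_convexHull hK hK' ⟨hx, hx'⟩
  rwa [← Finset.coe_inter] at this

theorem card_le {F : Finset (Vec d)} (hF : F ∈ T.faces) : F.card ≤ d + 1 := by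
  have h1 := (T.indep hF).card_le_finrank_succ
  have h2 := Submodule.finrank_le (vectorSpan ℝ (Set.range ((↑) : F → Vec d)))
  simp only [Fintype.card_coe, finrank_euclideanSpace, Fintype.card_fin] at h1 h2
  omega

/-- The elements cover the closure of the domain: the simplices of lower dimension are null sets. -/
theorem exists_mem_element (hΩ : IsOpen Ω) {x : Vec d} (hx : x ∈ closure Ω) :
    ∃ K ∈ T.elements, x ∈ simplex K := by
  have hcl : IsClosed (⋃ K ∈ T.elements, simplex K) :=
    Set.Finite.isClosed_biUnion T.elements.finite_toSet fun K _ => isClosed_simplex K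
  have hopen : IsOpen (Ω \ ⋃ K ∈ T.elements, simplex K) := hΩ.sdiff hcl
  have hnull : volume (Ω \ ⋃ K ∈ T.elements, simplex K) = 0 := by
    have h0 : volume (⋃ F ∈ T.finite_faces.toFinset.filter (fun F => F.card ≤ d), simplex F) = 0 :=
      (measure_biUnion_null_iff (Finset.countable_toSet _)).2 fun F hF =>
        volume_simplex_eq_zero (Finset.mem_filter.1 hF).2
    refine measure_mono_null ?_ h0
    rintro y ⟨hy, hy2⟩
    have : y ∈ T.toSimplicialComplex.space := by rw [T.space_eq]; exact subset_closure hy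
    obtain ⟨F, hF, hyF⟩ := Geometry.SimplicialComplex.mem_space_iff.1 this
    refine Set.mem_biUnion (x := F) ?_ hyF
    simp only [Finset.coe_filter, Set.mem_ofPred_eq, Set.Finite.mem_toFinset]
    refine ⟨hF, ?_⟩
    by_contra hcon
    refine hy2 (Set.mem_biUnion (x := F) (T.mem_elements.2 ⟨hF, ?_⟩) hyF)
    have := card_le hF
    omega
  rw [hopen.measure_eq_zero_iff volume, Set.sdiff_eq_empty] at hnull
  have := closure_minimal hnull hcl hx
  simpa using this

/-- A cell whose centroid lies in a simplex of the mesh is a face of this simplex. -/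
theorem subset_of_center {σ K : Finset (Vec d)} (hσ : σ ∈ T.faces) (hK : K ∈ T.faces)
    (h : center σ ∈ simplex K) : σ ⊆ K := by
  have hne := T.nonempty_of_mem_faces hσ
  have h1 := mem_simplex_inter hσ hK (center_mem_simplex hne) h
  exact (subset_of_center_mem (T.indep hσ) Finset.inter_subset_left subset_rfl hne h1).trans
    Finset.inter_subset_right

theorem exists_mem_adjacent (hΩ : IsOpen Ω) {σ : Finset (Vec d)} (hσ : σ ∈ T.faces) :
    ∃ K, K ∈ T.adjacent σ := by
  obtain ⟨K, hK, h⟩ := exists_mem_element (T := T) hΩ (simplex_subset_closure hσ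
    (center_mem_simplex (T.nonempty_of_mem_faces hσ)))
  exact ⟨K, T.mem_adjacent.2 ⟨hK, subset_of_center hσ (T.mem_elements.1 hK).1 h⟩⟩

theorem interior_simplex_subset (hΩ : IsOpen Ω) (hc : Convex ℝ Ω) {K : Finset (Vec d)}
    (hK : K ∈ T.elements) : interior (simplex K) ⊆ Ω := by
  have h1 := simplex_subset_closure (T.mem_elements.1 hK).1
  obtain ⟨x, hx⟩ := (isFullSimplex hK).interior_nonempty
  have hne : (interior Ω).Nonempty := by
    rw [hΩ.interior_eq]
    exact closure_nonempty_iff.1 ⟨x, h1 (interior_subset hx)⟩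
  have h2 := hc.interior_closure_eq_interior_of_nonempty_interior hne
  rw [hΩ.interior_eq] at h2
  rw [← h2]
  exact interior_mono h1

theorem closure_interior_simplex {K : Finset (Vec d)} (hK : IsFullSimplex K) :
    closure (interior (simplex K)) = simplex K := by
  rw [(convex_simplex K).closure_interior_eq_closure_of_nonempty_interior hK.interior_nonempty,
    (isClosed_simplex K).closure_eq]

/-- The elements of the star of `σ`, linked when they share an interior face containing `σ`. -/
def starGraph (T : Mesh Ω) (σ : Finset (Vec d)) : SimpleGraph {K // K ∈ T.adjacent σ} where
  Adj K K' := K ≠ K' ∧ ∃ F ∈ T.interiorFaces, σ ⊆ F ∧ F ⊆ K.1 ∧ F ⊆ K'.1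
  symm := ⟨fun _ _ h => ⟨h.1.symm, by
    obtain ⟨F, h1, h2, h3, h4⟩ := h.2
    exact ⟨F, h1, h2, h4, h3⟩⟩⟩
  loopless := ⟨fun _ h => h.1 rfl⟩

theorem card_lt_of_ne {K K' : Finset (Vec d)} (hK : K ∈ T.elements) (hK' : K' ∈ T.elements)
    (hne : K ≠ K') : (K ∩ K').card ≤ d := by
  have h1 := (T.mem_elements.1 hK).2
  have h2 := (T.mem_elements.1 hK').2
  by_contra hcon
  have h3 : K ∩ K' = K := Finset.eq_of_subset_of_card_le Finset.inter_subset_left (by omega)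
  have h4 : K ∩ K' = K' := Finset.eq_of_subset_of_card_le Finset.inter_subset_right (by omega)
  exact hne (h3.symm.trans h4)

theorem mem_star_of_adjacent_subtype {σ : Finset (Vec d)} (K : {K // K ∈ T.adjacent σ}) :
    K.1 ∈ T.elements ∧ σ ⊆ K.1 := T.mem_adjacent.1 K.2

/-- Near the centroid of a cell there are only elements of its star. -/
theorem exists_ball_star {σ : Finset (Vec d)} (hσ : σ ∈ T.faces) :
    ∃ ε > 0, ∀ x ∈ Metric.ball (center σ) ε, ∀ K ∈ T.elements, x ∈ simplex K → σ ⊆ K := by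
  have hcl : IsClosed (⋃ K ∈ T.elements.filter (fun K => ¬ σ ⊆ K), simplex K) :=
    Set.Finite.isClosed_biUnion (Finset.finite_toSet _) fun K _ => isClosed_simplex K
  have hz : center σ ∈ (⋃ K ∈ T.elements.filter (fun K => ¬ σ ⊆ K), simplex K)ᶜ := by
    simp only [Finset.mem_filter, Set.mem_compl_iff, Set.mem_iUnion, not_exists]
    rintro K ⟨hK, hK2⟩ hz
    exact hK2 (subset_of_center hσ (T.mem_elements.1 hK).1 hz)
  obtain ⟨ε, hε, h⟩ := Metric.isOpen_iff.1 hcl.isOpen_compl _ hz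
  refine ⟨ε, hε, fun x hx K hK hxK => ?_⟩
  by_contra hK2
  exact h hx (Set.mem_biUnion (x := K) (Finset.mem_filter.2 ⟨hK, hK2⟩) hxK)

/-- An element of a star has interior points near the centroid outside any given null set. -/
theorem exists_interior_notMem {σ K : Finset (Vec d)} (hσ : σ.Nonempty) (hK : IsFullSimplex K)
    (hσK : σ ⊆ K) {ε : ℝ} (hε : 0 < ε) {N : Set (Vec d)} (hN : volume N = 0) :
    ∃ x ∈ interior (simplex K), x ∈ Metric.ball (center σ) ε ∧ x ∉ N := by
  by_contra! h
  have h1 : volume (interior (simplex K) ∩ Metric.ball (center σ) ε) = 0 :=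
    measure_mono_null (fun x hx => h x hx.1 hx.2) hN
  rw [(isOpen_interior.inter Metric.isOpen_ball).measure_eq_zero_iff volume] at h1
  have h2 : center σ ∈ closure (interior (simplex K)) := by
    rw [closure_interior_simplex hK]
    exact simplex_mono hσK (center_mem_simplex hσ)
  obtain ⟨x, h3, h4⟩ := mem_closure_iff.1 h2 _ Metric.isOpen_ball (Metric.mem_ball_self hε)
  exact h1.subset ⟨h4, h3⟩

/-- Between the interiors of two elements of a star there is a segment near the centroid that avoids
all cells of codimension at least two: the points `y` for which the segment from `x` to `y` meets
such a cell lie in the affine span of `x` and the cell, which is a null set. -/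
theorem exists_generic_segment {σ K K' : Finset (Vec d)} (hσ : σ.Nonempty) (hK : IsFullSimplex K)
    (hK' : IsFullSimplex K') (hσK : σ ⊆ K) (hσK' : σ ⊆ K') {ε : ℝ} (hε : 0 < ε) :
    ∃ x ∈ interior (simplex K), ∃ y ∈ interior (simplex K'),
      x ∈ Metric.ball (center σ) ε ∧ y ∈ Metric.ball (center σ) ε ∧
      ∀ w ∈ segment ℝ x y, ∀ G ∈ T.faces, w ∈ simplex G → d ≤ G.card := by
  have hN₁ : volume (⋃ F ∈ T.finite_faces.toFinset.filter (fun F => F.card ≤ d),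
      simplex F) = 0 :=
    (measure_biUnion_null_iff (Finset.countable_toSet _)).2 fun F hF =>
      volume_simplex_eq_zero (Finset.mem_filter.1 hF).2
  obtain ⟨x, hxK, hxb, hxN⟩ := exists_interior_notMem hσ hK hσK hε hN₁
  have hN₂ : volume (⋃ F ∈ T.finite_faces.toFinset.filter (fun F => F.card + 1 ≤ d),
      (affineSpan ℝ ((insert x F : Finset (Vec d)) : Set (Vec d)) : Set (Vec d))) = 0 :=
    (measure_biUnion_null_iff (Finset.countable_toSet _)).2 fun F hF =>
      volume_affineSpan_eq_zero ((Finset.card_insert_le _ _).trans (Finset.mem_filter.1 hF).2)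
  obtain ⟨y, hyK, hyb, hyN⟩ := exists_interior_notMem hσ hK' hσK' hε hN₂
  refine ⟨x, hxK, y, hyK, hxb, hyb, fun w hw G hG hwG => ?_⟩
  by_contra! hcard
  rw [segment_eq_image] at hw
  obtain ⟨t, ht, rfl⟩ := hw
  rcases eq_or_ne t 0 with rfl | ht0
  · refine hxN (Set.mem_biUnion (x := G) ?_ (by simpa using hwG))
    simp only [Finset.coe_filter, Set.mem_ofPred_eq, Set.Finite.mem_toFinset]
    exact ⟨hG, hcard.le⟩
  · refine hyN (Set.mem_biUnion (x := G) ?_ ?_)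
    · simp only [Finset.coe_filter, Set.mem_ofPred_eq, Set.Finite.mem_toFinset]
      exact ⟨hG, hcard⟩
    · have h1 : x ∈ affineSpan ℝ ((insert x G : Finset (Vec d)) : Set (Vec d)) :=
        subset_affineSpan ℝ _ (by simp)
      have h2 : (1 - t) • x + t • y ∈
          affineSpan ℝ ((insert x G : Finset (Vec d)) : Set (Vec d)) :=
        affineSpan_mono ℝ (by simp) (simplex_subset_affineSpan _ hwG)
      have h3 := AffineMap.lineMap_mem (t⁻¹) h1 h2
      convert h3 using 1
      rw [AffineMap.lineMap_apply, vsub_eq_sub, vadd_eq_add,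
        show (1 - t) • x + t • y - x = t • (y - x) by rw [sub_smul, one_smul, smul_sub]; abel,
        smul_smul, inv_mul_cancel₀ ht0, one_smul, sub_add_cancel]
      exact Iff.rfl

theorem isClosed_iUnion_simplex {σ : Finset (Vec d)} (s : Set {K // K ∈ T.adjacent σ}) :
    IsClosed (⋃ K ∈ s, simplex K.1) :=
  (Set.toFinite s).isClosed_biUnion fun K _ => isClosed_simplex K.1

/-- Two elements of a star that meet in a point of `Ω` off the cells of codimension two are
linked. -/
theorem starGraph_adj (hΩ : IsOpen Ω) {σ : Finset (Vec d)} (hσ : σ.Nonempty)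
    {A B : {K // K ∈ T.adjacent σ}} (hne : A ≠ B) {w : Vec d} (hw : w ∈ Ω)
    (hwA : w ∈ simplex A.1) (hwB : w ∈ simplex B.1)
    (h : ∀ G ∈ T.faces, w ∈ simplex G → d ≤ G.card) : (T.starGraph σ).Adj A B := by
  have hA := mem_star_of_adjacent_subtype A
  have hB := mem_star_of_adjacent_subtype B
  have hwG := mem_simplex_inter (T.mem_elements.1 hA.1).1 (T.mem_elements.1 hB.1).1 hwA hwB
  have hG : A.1 ∩ B.1 ∈ T.faces :=
    T.down_closed (T.mem_elements.1 hA.1).1 Finset.inter_subset_left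
      (hσ.mono (Finset.subset_inter hA.2 hB.2))
  have hcard := le_antisymm (card_lt_of_ne hA.1 hB.1 fun h => hne (Subtype.ext h)) (h _ hG hwG)
  exact ⟨hne, A.1 ∩ B.1,
    T.mem_interiorFaces.2 ⟨T.mem_meshFaces.2 ⟨hG, hcard⟩, fun h =>
      (hΩ.inter_frontier_eq.subset ⟨hw, h hwG⟩ :)⟩,
    Finset.subset_inter hA.2 hB.2, Finset.inter_subset_left, Finset.inter_subset_right⟩

/-- The star of a cell is connected through interior faces. Otherwise the elements of the star split
into two classes that only meet in cells of codimension at least two; but near the centroid of the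
cell, a generic segment between interior points of elements of the two classes avoids these. -/
theorem starGraph_preconnected (hΩ : IsOpen Ω) (hc : Convex ℝ Ω) {σ : Finset (Vec d)}
    (hσ : σ ∈ T.faces) : (T.starGraph σ).Preconnected := by
  intro K₀ K₁
  by_contra hcon
  have h₀ := mem_star_of_adjacent_subtype K₀
  have h₁ := mem_star_of_adjacent_subtype K₁
  have hσne := T.nonempty_of_mem_faces hσ
  obtain ⟨ε, hε, hball⟩ := exists_ball_star hσ
  obtain ⟨x, hxK, y, hyK, hxb, hyb, hgen⟩ := exists_generic_segment (T := T) hσne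
    (isFullSimplex h₀.1) (isFullSimplex h₁.1) h₀.2 h₁.2 hε
  have hsegΩ : segment ℝ x y ⊆ Ω := hc.segment_subset
    (interior_simplex_subset hΩ hc h₀.1 hxK) (interior_simplex_subset hΩ hc h₁.1 hyK)
  have hsegb : segment ℝ x y ⊆ Metric.ball (center σ) ε :=
    (convex_ball _ _).segment_subset hxb hyb
  have hcov : segment ℝ x y ⊆ (⋃ K ∈ {K | (T.starGraph σ).Reachable K₀ K}, simplex K.1) ∪
      ⋃ K ∈ {K | ¬ (T.starGraph σ).Reachable K₀ K}, simplex K.1 := fun w hw => by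
    obtain ⟨K, hK, hwK⟩ := exists_mem_element (T := T) hΩ (subset_closure (hsegΩ hw))
    have hK' : K ∈ T.adjacent σ := T.mem_adjacent.2 ⟨hK, hball w (hsegb hw) K hK hwK⟩
    by_cases h : (T.starGraph σ).Reachable K₀ ⟨K, hK'⟩
    · exact Or.inl (Set.mem_biUnion (x := ⟨K, hK'⟩) h hwK)
    · exact Or.inr (Set.mem_biUnion (x := ⟨K, hK'⟩) h hwK)
  obtain ⟨w, hw, hwA, hwB⟩ := isPreconnected_closed_iff.1 (convex_segment x y).isPreconnected
    _ _ (isClosed_iUnion_simplex _) (isClosed_iUnion_simplex _) hcov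
    ⟨x, left_mem_segment ℝ x y, Set.mem_biUnion (x := K₀) (SimpleGraph.Reachable.refl K₀)
      (interior_subset hxK)⟩
    ⟨y, right_mem_segment ℝ x y, Set.mem_biUnion (x := K₁) hcon (interior_subset hyK)⟩
  obtain ⟨A, hA, hwA⟩ := Set.mem_iUnion₂.1 hwA
  obtain ⟨B, hB, hwB⟩ := Set.mem_iUnion₂.1 hwB
  have hne : A ≠ B := by rintro rfl; exact hB hA
  exact hB (SimpleGraph.Reachable.trans hA
    (starGraph_adj hΩ hσne hne (hsegΩ hw) hwA hwB (hgen w hw)).reachable)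

section Shape

variable {θ : ℝ}

theorem diam_le_of_shapeRegularity (hd : 0 < d) (hθ : T.shapeRegularity ≤ θ)
    {K : Finset (Vec d)} (hK : K ∈ T.elements) :
    Metric.diam (simplex K) ≤ θ * inballDiameter (simplex K) := by
  rw [← div_le_iff₀ ((isFullSimplex hK).inballDiameter_pos hd)]
  refine le_trans ?_ hθ
  exact le_ciSup (f := fun K : {K // K ∈ T.elements} =>
    Metric.diam (simplex K.1) / inballDiameter (simplex K.1)) (Set.finite_range _).bddAbove ⟨K, hK⟩

theorem one_le_of_shapeRegularity (hd : 0 < d) (hθ : T.shapeRegularity ≤ θ)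
    {K : Finset (Vec d)} (hK : K ∈ T.elements) : 1 ≤ θ := by
  have h1 := diam_le_of_shapeRegularity hd hθ hK
  have h2 := (isFullSimplex hK).inballDiameter_le_diam hd
  have h3 := (isFullSimplex hK).inballDiameter_pos hd
  by_contra! h
  nlinarith

/-- Shape regularity bounds the number of elements of a star: the elements contain disjoint balls of
comparable size in a common ball. -/
theorem card_adjacent_le (hd : 0 < d) (hθ : T.shapeRegularity ≤ θ) {σ : Finset (Vec d)}
    (hσ : σ.Nonempty) : ((T.adjacent σ).card : ℝ) ≤ (4 * θ) ^ d := by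
  -- an empty star only needs `0 ≤ θ`, which holds since the shape regularity is nonnegative, also
  -- for a mesh without elements
  rcases (T.adjacent σ).eq_empty_or_nonempty with h0 | hne
  · rw [h0, Finset.card_empty, Nat.cast_zero]
    by_cases h : d = 0
    · omega
    by_cases hθ0 : 0 ≤ θ
    · positivity
    · exfalso
      refine hθ0 (le_trans ?_ hθ)
      exact Real.iSup_nonneg fun K => div_nonneg Metric.diam_nonneg
        ((isFullSimplex K.2).inballDiameter_pos hd).le
  obtain ⟨a, ha⟩ := hσ
  obtain ⟨K₀, hK₀, hmin⟩ := Finset.exists_min_image (T.adjacent σ)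
    (fun K => Metric.diam (simplex K)) hne
  have hel : ∀ K ∈ T.adjacent σ, K ∈ T.elements := fun K hK => (T.mem_adjacent.1 hK).1
  have hθ1 := one_le_of_shapeRegularity hd hθ (hel K₀ hK₀)
  have hθ0 : 0 < θ := by linarith
  -- with the smallest diameter `s` in the star, balls of radius `s / (4 θ)` fit into every element
  -- within the distance `s` of a vertex of `σ`
  set s := Metric.diam (simplex K₀)
  have hs : 0 < s := (isFullSimplex (hel K₀ hK₀)).diam_pos hd
  have hball : ∀ K : Finset (Vec d), ∃ c, K ∈ T.adjacent σ →
      Metric.closedBall c (s / (4 * θ)) ⊆ simplex K ∩ Metric.closedBall a s := fun K => by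
    by_cases hK : K ∈ T.adjacent σ
    · obtain ⟨c, hc⟩ := (isFullSimplex (hel K hK)).exists_closedBall_subset_inter hd hθ0
        (diam_le_of_shapeRegularity hd hθ (hel K hK))
        (vertex_mem_simplex ((T.mem_adjacent.1 hK).2 ha)) hs (hmin K hK)
      exact ⟨c, fun _ => hc⟩
    · exact ⟨0, fun h => absurd h hK⟩
  choose c hc using hball
  have hdisj : ((T.adjacent σ : Finset (Finset (Vec d))) : Set (Finset (Vec d))).Pairwise
      (Function.onFun (AEDisjoint volume) fun K => Metric.closedBall (c K) (s / (4 * θ))) := by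
    intro K hK K' hK' hKK
    refine measure_mono_null (fun x hx => ?_)
      (volume_simplex_eq_zero (card_lt_of_ne (hel K hK) (hel K' hK') hKK))
    exact mem_simplex_inter (T.mem_elements.1 (hel K hK)).1 (T.mem_elements.1 (hel K' hK')).1
      (hc K hK hx.1).1 (hc K' hK' hx.2).1
  have h1 := measure_biUnion_finset₀ (μ := (volume : Measure (Vec d))) hdisj
    (fun K _ => Metric.isClosed_closedBall.measurableSet.nullMeasurableSet)
  have h2 : volume (⋃ K ∈ T.adjacent σ, Metric.closedBall (c K) (s / (4 * θ))) ≤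
      volume (Metric.closedBall a s) :=
    measure_mono (Set.iUnion₂_subset fun K hK => (hc K hK).trans Set.inter_subset_right)
  rw [h1] at h2
  have hb0 : volume (Metric.ball (0 : Vec d) 1) ≠ 0 := (Metric.measure_ball_pos _ _ one_pos).ne'
  have hb1 : volume (Metric.ball (0 : Vec d) 1) ≠ ⊤ := measure_ball_lt_top.ne
  simp only [Measure.addHaar_closedBall _ _ (show 0 ≤ s / (4 * θ) by positivity),
    Measure.addHaar_closedBall _ _ hs.le, finrank_euclideanSpace, Fintype.card_fin,
    Finset.sum_const, nsmul_eq_mul] at h2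
  rw [← mul_assoc, ENNReal.mul_le_mul_iff_left hb0 hb1, ← ENNReal.ofReal_natCast,
    ← ENNReal.ofReal_mul (Nat.cast_nonneg _), ENNReal.ofReal_le_ofReal_iff (by positivity),
    div_pow, mul_div_assoc', div_le_iff₀ (by positivity), mul_comm] at h2
  exact le_of_mul_le_mul_left h2 (by positivity)

/-- Elements that share a face have comparable diameters: each edge of the face is at least as long
as the inball diameter of the one and at most as long as the diameter of the other. -/
theorem diam_le_mul_diam (hd : 2 ≤ d) (hθ : T.shapeRegularity ≤ θ) {K K' F : Finset (Vec d)}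
    (hK : K ∈ T.elements) (hF : F.card = d) (hFK : F ⊆ K) (hFK' : F ⊆ K') :
    Metric.diam (simplex K) ≤ θ * Metric.diam (simplex K') := by
  have hθ1 := one_le_of_shapeRegularity (by omega) hθ hK
  obtain ⟨a, ha, b, hb, hab⟩ := Finset.one_lt_card.1 (show 1 < F.card by omega)
  calc _ ≤ θ * inballDiameter (simplex K) := diam_le_of_shapeRegularity (by omega) hθ hK
    _ ≤ θ * ‖a - b‖ := by
        gcongr
        exact (isFullSimplex hK).inballDiameter_le_edge (hFK ha) (hFK hb) hab
    _ ≤ _ := by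
        gcongr
        exact dist_le_diam_simplex (vertex_mem_simplex (hFK' ha)) (vertex_mem_simplex (hFK' hb))

/-- A quantity that varies by at most `ε` across the interior faces containing `σ` varies by at most
`N ε` in the star of `σ`, where `N` bounds the number of elements of the star. -/
theorem norm_sub_le_of_star (hΩ : IsOpen Ω) (hc : Convex ℝ Ω) {σ : Finset (Vec d)}
    (hσ : σ ∈ T.faces) {N : ℝ} (hN : ((T.adjacent σ).card : ℝ) ≤ N) {E : Type*}
    [SeminormedAddCommGroup E] (f : Finset (Vec d) → E) {ε : ℝ} (hε : 0 ≤ ε)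
    (h : ∀ F ∈ T.interiorFaces, σ ⊆ F → ∀ K ∈ T.elements, ∀ K' ∈ T.elements, F ⊆ K → F ⊆ K' →
      ‖f K - f K'‖ ≤ ε) {K K' : Finset (Vec d)} (hK : K ∈ T.adjacent σ)
    (hK' : K' ∈ T.adjacent σ) : ‖f K - f K'‖ ≤ N * ε := by
  obtain ⟨w, hw⟩ := (starGraph_preconnected hΩ hc hσ ⟨K, hK⟩ ⟨K', hK'⟩).exists_isPath
  have hlen : (w.length : ℝ) ≤ N := by
    refine le_trans ?_ hN
    have := hw.length_lt
    rw [Fintype.card_coe] at this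
    exact_mod_cast this.le
  have key : ∀ {A B : {K // K ∈ T.adjacent σ}} (w : (T.starGraph σ).Walk A B),
      ‖f A - f B‖ ≤ w.length * ε := fun {A B} w => by
    induction w with
    | nil => simp
    | @cons u v z huv p ih =>
      obtain ⟨-, F, hF, h1, h2, h3⟩ := id huv
      have := h F hF h1 u (T.mem_adjacent.1 u.2).1 v (T.mem_adjacent.1 v.2).1 h2 h3
      have h4 := norm_sub_le_norm_sub_add_norm_sub (f u) (f v) (f z)
      rw [SimpleGraph.Walk.length_cons]
      push_cast
      linarith
  exact (key w).trans (by gcongr)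

/-- Along a path in the star, the diameter grows by at most the factor `θ` at each step. -/
theorem diam_le_of_star (hd : 2 ≤ d) (hθ : T.shapeRegularity ≤ θ) (hΩ : IsOpen Ω)
    (hc : Convex ℝ Ω) {σ : Finset (Vec d)} (hσ : σ ∈ T.faces) {N : ℕ}
    (hN : (T.adjacent σ).card ≤ N) {K K' : Finset (Vec d)} (hK : K ∈ T.adjacent σ)
    (hK' : K' ∈ T.adjacent σ) :
    Metric.diam (simplex K) ≤ θ ^ N * Metric.diam (simplex K') := by
  obtain ⟨w, hw⟩ := (starGraph_preconnected hΩ hc hσ ⟨K, hK⟩ ⟨K', hK'⟩).exists_isPath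
  have hθ1 := one_le_of_shapeRegularity (by omega) hθ (T.mem_adjacent.1 hK).1
  have hlen : w.length ≤ N := by
    have := hw.length_lt
    rw [Fintype.card_coe] at this
    omega
  have key : ∀ {A B : {K // K ∈ T.adjacent σ}} (w : (T.starGraph σ).Walk A B),
      Metric.diam (simplex A.1) ≤ θ ^ w.length * Metric.diam (simplex B.1) := fun {A B} w => by
    induction w with
    | nil => simp
    | @cons u v z huv p ih =>
      obtain ⟨-, F, hF, h1, h2, h3⟩ := id huv
      have hcard := (T.mem_meshFaces.1 (T.mem_interiorFaces.1 hF).1).2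
      have := diam_le_mul_diam hd hθ (T.mem_adjacent.1 u.2).1 hcard h2 h3
      rw [SimpleGraph.Walk.length_cons, pow_succ', mul_assoc]
      exact this.trans (by gcongr)
  refine (key w).trans ?_
  gcongr

end Shape

end Mesh

/-! ### Surface measure of faces -/

theorem finrank_vectorSpan_add_one_le {F : Finset (Vec d)} (hF : F.Nonempty) :
    Module.finrank ℝ (vectorSpan ℝ (F : Set (Vec d))) + 1 ≤ F.card := by
  have : Nonempty F := hF.to_subtype
  have h1 := finrank_vectorSpan_range_add_one_le ℝ ((↑) : F → Vec d)
  have h3 : Set.range ((↑) : F → Vec d) = F := by simp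
  rwa [h3, Fintype.card_coe] at h1

theorem finrank_vectorSpan_face {F : Finset (Vec d)} (hd : 0 < d)
    (hF : AffineIndependent ℝ ((↑) : F → Vec d)) (hc : F.card = d) :
    Module.finrank ℝ (vectorSpan ℝ (F : Set (Vec d))) = d - 1 := by
  have h := hF.finrank_vectorSpan (n := d - 1) (by rw [Fintype.card_coe, hc]; omega)
  have h3 : Set.range ((↑) : F → Vec d) = F := by simp
  rwa [h3] at h

/-- A simplex of codimension at least two is a null set for the surface measure. -/
theorem surfaceMeasure_simplex_eq_zero {F : Finset (Vec d)} (hF : F.card + 1 ≤ d) :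
    surfaceMeasure d (simplex F) = 0 := by
  rcases F.eq_empty_or_nonempty with rfl | hne
  · simp [simplex]
  obtain ⟨a, ha⟩ := hne
  have hsub : simplex F ⊆ Set.range fun v : vectorSpan ℝ (F : Set (Vec d)) => (v : Vec d) + a := by
    intro x hx
    have h1 := simplex_subset_affineSpan F hx
    have h2 : a ∈ affineSpan ℝ (F : Set (Vec d)) := subset_affineSpan ℝ _ ha
    have h3 := AffineSubspace.vsub_mem_direction h1 h2
    rw [direction_affineSpan] at h3
    exact ⟨⟨_, h3⟩, by simp⟩
  refine measure_mono_null hsub ?_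
  have hdim : dimH (Set.range fun v : vectorSpan ℝ (F : Set (Vec d)) => (v : Vec d) + a) <
      ((d - 1 : ℕ) : NNReal) := by
    have hsm : ContDiff ℝ 1 fun v : vectorSpan ℝ (F : Set (Vec d)) => (v : Vec d) + a :=
      (vectorSpan ℝ (F : Set (Vec d))).subtypeL.contDiff.add contDiff_const
    refine hsm.dimH_range_le.trans_lt ?_
    have := finrank_vectorSpan_add_one_le (F := F) ⟨a, ha⟩
    have h2 : Module.finrank ℝ (vectorSpan ℝ (F : Set (Vec d))) < d - 1 := by omega
    exact_mod_cast h2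
  have := hausdorffMeasure_of_dimH_lt hdim
  rw [surfaceMeasure, Measure.euclideanHausdorffMeasure_def, Measure.smul_apply]
  simp only [NNReal.coe_natCast] at this
  rw [this, smul_zero]

/-- An isometric parametrization of the hyperplane spanned by a face. -/
theorem exists_isometry_face {F : Finset (Vec d)} (hd : 0 < d)
    (hF : AffineIndependent ℝ ((↑) : F → Vec d)) (hc : F.card = d) {p : Vec d}
    (hp : p ∈ affineSpan ℝ (F : Set (Vec d))) :
    ∃ Φ : EuclideanSpace ℝ (Fin (d - 1)) → Vec d, Isometry Φ ∧ Φ 0 = p ∧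
      Set.range Φ = affineSpan ℝ (F : Set (Vec d)) := by
  let b := (stdOrthonormalBasis ℝ (vectorSpan ℝ (F : Set (Vec d)))).reindex
    (finCongr (finrank_vectorSpan_face hd hF hc))
  refine ⟨fun t => (b.repr.symm t : Vec d) + p, ?_, by simp, ?_⟩
  · refine Isometry.of_dist_eq fun s t => ?_
    rw [dist_add_right, ← b.repr.symm.dist_map s t]
    rfl
  · ext x
    constructor
    · rintro ⟨t, rfl⟩
      have : ((b.repr.symm t : vectorSpan ℝ (F : Set (Vec d))) : Vec d) ∈
          (affineSpan ℝ (F : Set (Vec d))).direction := by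
        rw [direction_affineSpan]; exact (b.repr.symm t).2
      exact AffineSubspace.vadd_mem_of_mem_direction this hp
    · intro hx
      have h3 := AffineSubspace.vsub_mem_direction hx hp
      rw [direction_affineSpan] at h3
      exact ⟨b.repr ⟨_, h3⟩, by simp⟩

theorem surfaceMeasure_image_isometry {Φ : EuclideanSpace ℝ (Fin (d - 1)) → Vec d}
    (hΦ : Isometry Φ) (s : Set (EuclideanSpace ℝ (Fin (d - 1)))) :
    surfaceMeasure d (Φ '' s) = volume s := by
  rw [surfaceMeasure, hΦ.euclideanHausdorffMeasure_image,
    EuclideanSpace.euclideanHausdorffMeasure_eq_volume]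

theorem surfaceMeasure_simplex_lt_top {F : Finset (Vec d)} (hd : 0 < d)
    (hF : AffineIndependent ℝ ((↑) : F → Vec d)) (hc : F.card = d) :
    surfaceMeasure d (simplex F) < ⊤ := by
  have hne : F.Nonempty := Finset.card_pos.1 (by omega)
  obtain ⟨Φ, hΦ, -, hr⟩ := exists_isometry_face hd hF hc
    (simplex_subset_affineSpan F (center_mem_simplex hne))
  have h1 : simplex F = Φ '' (Φ ⁻¹' simplex F) := by
    rw [Set.image_preimage_eq_inter_range, hr]
    exact (Set.inter_eq_left.2 (simplex_subset_affineSpan F)).symm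
  rw [h1, surfaceMeasure_image_isometry hΦ]
  exact (hΦ.antilipschitz.isBounded_preimage (isCompact_simplex F).isBounded).measure_lt_top

/-- The volume of the unit ball of `ℝ^(d-1)`. -/
def faceBallVolume (d : ℕ) : ℝ :=
  volume.real (Metric.closedBall (0 : EuclideanSpace ℝ (Fin (d - 1))) 1)

theorem faceBallVolume_pos (d : ℕ) : 0 < faceBallVolume d :=
  ENNReal.toReal_pos (Metric.measure_closedBall_pos _ _ one_pos).ne' measure_closedBall_lt_top.ne

/-- A face of `K` contains a `(d-1)`-dimensional ball of radius `ρ_K / d` about its centroid. -/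
theorem IsFullSimplex.le_surfaceMeasure {K F : Finset (Vec d)} (hK : IsFullSimplex K) (hd : 0 < d)
    (hF : F ⊆ K) (hc : F.card = d) :
    faceBallVolume d * (inballDiameter (simplex K) / d) ^ (d - 1) ≤
      (surfaceMeasure d).real (simplex F) := by
  have hne : F.Nonempty := Finset.card_pos.1 (by omega)
  have hFi : AffineIndependent ℝ ((↑) : F → Vec d) := hK.indep.mono (by exact_mod_cast hF)
  obtain ⟨Φ, hΦ, h0, hr⟩ := exists_isometry_face hd hFi hc
    (simplex_subset_affineSpan F (center_mem_simplex hne))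
  have hρ := hK.inballDiameter_pos hd
  set ρ := inballDiameter (simplex K)
  have hd' : (0 : ℝ) < d := by exact_mod_cast hd
  have hsub : Φ '' Metric.closedBall 0 (ρ / d) ⊆ simplex F := by
    rintro _ ⟨t, ht, rfl⟩
    have h1 : ‖Φ t - center F‖ ≤ ρ / d := by
      rw [← h0, ← dist_eq_norm, hΦ.dist_eq]; exact ht
    refine hK.mem_face_of_bary hF (fun a ha => ?_) (fun a haK haF => ?_)
    · have h2 := hK.abs_bary_sub_mul_le a (Φ t) (center F)
      rw [hK.bary_center hF hne, if_pos ha, hc] at h2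
      have h3 : |bary K a (Φ t) - (d : ℝ)⁻¹| ≤ (d : ℝ)⁻¹ := by
        have := h2.trans h1
        rw [div_eq_mul_inv, mul_comm ρ] at this
        exact le_of_mul_le_mul_right this hρ
      linarith [(abs_le.1 h3).1]
    · have h2 : Φ t ∈ affineSpan ℝ (F : Set (Vec d)) := by
        have : Φ t ∈ Set.range Φ := ⟨t, rfl⟩
        rwa [hr] at this
      refine affineSpan_induction (p := fun x => bary K a x = 0) h2 (fun b hb => ?_) ?_
      · rw [hK.bary_vertex haK (hF hb), if_neg]
        rintro rfl
        exact haF hb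
      · intro s u v w hu hv hw
        simp only [vsub_eq_sub, vadd_eq_add]
        have hlin : ∀ y, bary K a y = (bary K a).linear y + bary K a 0 := fun y => by
          simpa using (bary K a).map_vadd 0 y
        rw [hlin, map_add, map_smul, map_sub, add_assoc, ← hlin, hw]
        rw [hlin] at hu hv
        have : (bary K a).linear u - (bary K a).linear v = 0 := by linarith
        simp [this]
  have h1 : (surfaceMeasure d).real (Φ '' Metric.closedBall 0 (ρ / d)) =
      faceBallVolume d * (ρ / d) ^ (d - 1) := by
    rw [Measure.real, surfaceMeasure_image_isometry hΦ,
      Measure.addHaar_closedBall' _ _ (by positivity), ENNReal.toReal_mul,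
      ENNReal.toReal_ofReal (by positivity), finrank_euclideanSpace, Fintype.card_fin, mul_comm]
    rfl
  rw [← h1]
  exact measureReal_mono hsub (surfaceMeasure_simplex_lt_top hd hFi hc).ne

theorem faceSize_pow {F : Finset (Vec d)} (hd : 2 ≤ d) :
    faceSize F ^ (d - 1) = (surfaceMeasure d).real (simplex F) := by
  have h1 : ((d - 1 : ℕ) : ℝ) = (d : ℝ) - 1 := by
    rw [Nat.cast_sub (by omega)]; simp
  have h2 : (d : ℝ) - 1 ≠ 0 := by
    have : (2 : ℝ) ≤ d := by exact_mod_cast hd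
    linarith
  rw [faceSize, ← Real.rpow_natCast, ← Real.rpow_mul measureReal_nonneg, h1,
    one_div_mul_cancel h2, Real.rpow_one]

theorem faceSize_nonneg (F : Finset (Vec d)) : 0 ≤ faceSize F :=
  Real.rpow_nonneg measureReal_nonneg _

/-- The size of a face is bounded below by the inball diameter of the simplex. -/
theorem exists_le_faceSize (hd : 2 ≤ d) : ∃ c : ℝ, 0 < c ∧ ∀ {K F : Finset (Vec d)},
    IsFullSimplex K → F ⊆ K → F.card = d → c * inballDiameter (simplex K) ≤ faceSize F := by
  have hd' : (0 : ℝ) < d := by exact_mod_cast (show 0 < d by omega)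
  have hb := faceBallVolume_pos d
  refine ⟨min (faceBallVolume d) 1 / d, by positivity, fun {K F} hK hF hc => ?_⟩
  have hρ := hK.inballDiameter_pos (by omega)
  refine le_of_pow_le_pow_left₀ (n := d - 1) (by omega) (faceSize_nonneg F) ?_
  rw [faceSize_pow hd]
  refine le_trans ?_ (hK.le_surfaceMeasure (by omega) hF hc)
  rw [show min (faceBallVolume d) 1 / d * inballDiameter (simplex K) =
    min (faceBallVolume d) 1 * (inballDiameter (simplex K) / d) by ring, mul_pow]
  gcongr
  -- the minimum with `1` absorbs the exponent `d - 1`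
  calc min (faceBallVolume d) 1 ^ (d - 1) ≤ min (faceBallVolume d) 1 ^ 1 :=
        pow_le_pow_of_le_one (by positivity) (min_le_right _ _) (by omega)
    _ ≤ faceBallVolume d := by rw [pow_one]; exact min_le_left _ _

/-! ### The inverse inequality for Bernstein coefficients on faces -/

/-- The number of multi-indices of degree `k` in `n` variables. -/
def numIndices (n k : ℕ) : ℕ := ((Finset.univ : Finset (Fin n)).finsuppAntidiag k).card

theorem card_finsuppAntidiag (F : Finset (Vec d)) (k : ℕ) :
    (F.finsuppAntidiag k).card = numIndices F.card k := by
  let e : Fin F.card ↪ Vec d := F.equivFin.symm.toEmbedding.trans (Function.Embedding.subtype _)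
  have hFe : F = (Finset.univ : Finset (Fin F.card)).map e := by
    ext a
    simp only [Finset.mem_map, Finset.mem_univ, true_and]
    constructor
    · intro ha
      exact ⟨F.equivFin ⟨a, ha⟩, by simp [e]⟩
    · rintro ⟨i, rfl⟩
      exact (F.equivFin.symm i).2
  conv_lhs => rw [hFe, finsuppAntidiag_map, Finset.card_map]
  rfl

/-- The Bernstein coefficients on a face are bounded by the maximum of the field. -/
theorem exists_norm_coeff_le (n k : ℕ) (hn : 0 < n) : ∃ C : ℝ, 0 < C ∧
    ∀ {d : ℕ} {K F : Finset (Vec d)}, IsFullSimplex K → F ⊆ K → F.card = n →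
      ∀ (c : (Vec d →₀ ℕ) → Vec d) (M : ℝ),
      (∀ x ∈ simplex F, ‖∑ β ∈ F.finsuppAntidiag k, bern K β x • c β‖ ≤ M) →
      ∀ α ∈ F.finsuppAntidiag k, ‖c α‖ ≤ C * M := by
  obtain ⟨C, hC, h⟩ := exists_coeff_bound n k hn
  refine ⟨C, hC, fun {d K F} hK hF hc c M hM α hα => ?_⟩
  rcases eq_or_ne (c α) 0 with h0 | h0
  · rw [h0, norm_zero]
    obtain ⟨a, ha⟩ := Finset.card_pos.1 (show 0 < F.card by omega)
    have := (norm_nonneg _).trans (hM a (vertex_mem_simplex ha))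
    positivity
  have hpos : 0 < ‖c α‖ := norm_pos_iff.2 h0
  -- apply the scalar bound to the component of the field along `c α`
  have key := h F hc (fun β => inner ℝ (c α) (c β)) (‖c α‖ * M) (fun l hl hl1 => by
    have hx : ∑ a ∈ F, l a • a ∈ simplex F := Finset.mem_convexHull'.2 ⟨l, hl, hl1, rfl⟩
    have hb : ∀ β ∈ F.finsuppAntidiag k, bern K β (∑ a ∈ F, l a • a) =
        β.prod fun a m => l a ^ m := fun β hβ => by
      unfold bern Finsupp.prod
      refine Finset.prod_congr rfl fun a ha => ?_
      simp only
      rw [hK.bary_combination hF l hl1, if_pos ((Finset.mem_finsuppAntidiag.1 hβ).2 ha)]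
    have h1 : ∑ β ∈ F.finsuppAntidiag k, inner ℝ (c α) (c β) * β.prod (fun a m => l a ^ m) =
        inner ℝ (c α) (∑ β ∈ F.finsuppAntidiag k, bern K β (∑ a ∈ F, l a • a) • c β) := by
      rw [inner_sum]
      refine Finset.sum_congr rfl fun β hβ => ?_
      rw [inner_smul_right, hb β hβ, mul_comm]
    rw [h1]
    exact (abs_real_inner_le_norm _ _).trans (by gcongr; exact hM _ hx)) α hα
  simp only [real_inner_self_eq_norm_sq, abs_pow, abs_norm] at key
  have : ‖c α‖ * ‖c α‖ ≤ ‖c α‖ * (C * M) := by nlinarith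
  exact le_of_mul_le_mul_left this hpos

theorem mul_measureReal_le_setIntegral {X : Type*} [MeasurableSpace X] {μ : Measure X}
    {S F : Set X} (hSF : S ⊆ F) (hS : MeasurableSet S) (hF : μ F < ⊤) {f : X → ℝ} {m : ℝ}
    (hf : IntegrableOn f F μ) (hf0 : ∀ x, 0 ≤ f x) (h : ∀ x ∈ S, m ≤ f x) :
    m * μ.real S ≤ ∫ x in F, f x ∂μ := by
  have h1 := setIntegral_mono_on (μ := μ) (s := S) (f := fun _ => m)
    (integrableOn_const ((measure_mono hSF).trans_lt hF).ne) (hf.mono_set hSF) hS h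
  rw [setIntegral_const, smul_eq_mul, mul_comm] at h1
  exact h1.trans (setIntegral_mono_set hf (Eventually.of_forall hf0) (LE.le.eventuallyLE hSF))

/-- If the field on a face attains its maximum `M` at `y`, then it is at least `M / 2` on the
homothetic copy of the face with center `y` and small ratio. -/
theorem IsFullSimplex.half_max_le {K F : Finset (Vec d)} (hK : IsFullSimplex K) (hF : F ⊆ K)
    {k : ℕ} {c : (Vec d →₀ ℕ) → Vec d} {M A ε : ℝ}
    (hA : ∑ β ∈ F.finsuppAntidiag k, ‖c β‖ ≤ A * M) (hε : 0 < ε) (hε1 : ε ≤ 1)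
    (hAε : A * k * ε ≤ 1 / 2) {y u : Vec d} (hy : y ∈ simplex F) (hu : u ∈ simplex F)
    (hM : ‖∑ β ∈ F.finsuppAntidiag k, bern K β y • c β‖ = M) :
    M / 2 ≤ ‖∑ β ∈ F.finsuppAntidiag k, bern K β (AffineMap.homothety y ε u) • c β‖ := by
  have hM0 : 0 ≤ M := hM ▸ norm_nonneg _
  have hxu : AffineMap.homothety y ε u = ε • (u - y) + y := by
    simp [AffineMap.homothety_apply]
  have hx : AffineMap.homothety y ε u ∈ simplex F := by
    have := convex_simplex F hy hu (sub_nonneg.2 hε1) hε.le (by ring)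
    convert this using 1
    rw [hxu, smul_sub, sub_smul, one_smul]
    abel
  have hδ : ∀ a ∈ K, |bary K a (AffineMap.homothety y ε u) - bary K a y| ≤ ε := fun a _ => by
    have hlin : ∀ u v, bary K a u - bary K a v = (bary K a).linear (u - v) := fun u v => by
      simpa using ((bary K a).linearMap_vsub u v).symm
    rw [hlin, hxu, add_sub_cancel_right, map_smul, ← hlin, smul_eq_mul, abs_mul, abs_of_pos hε]
    refine mul_le_of_le_one_right hε.le ?_
    have h1 := simplex_mono hF hu
    have h2 := simplex_mono hF hy
    rw [abs_le]
    constructor <;> linarith [hK.bary_nonneg h1 a, hK.bary_le_one h1 a, hK.bary_nonneg h2 a,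
      hK.bary_le_one h2 a]
  have h3 : ‖∑ β ∈ F.finsuppAntidiag k, bern K β (AffineMap.homothety y ε u) • c β -
      ∑ β ∈ F.finsuppAntidiag k, bern K β y • c β‖ ≤ M / 2 := by
    rw [← Finset.sum_sub_distrib]
    calc _ ≤ ∑ β ∈ F.finsuppAntidiag k, ‖c β‖ * (k * ε) := by
          refine (norm_sum_le _ _).trans (Finset.sum_le_sum fun β hβ => ?_)
          rw [← sub_smul, norm_smul, mul_comm]
          exact mul_le_mul_of_nonneg_left (hK.abs_bern_sub_le (Finset.finsuppAntidiag_mono hF k hβ)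
            (simplex_mono hF hx) (simplex_mono hF hy) hδ) (norm_nonneg _)
      _ ≤ A * M * (k * ε) := by
          rw [← Finset.sum_mul]
          gcongr
      _ = A * k * ε * M := by ring
      _ ≤ 1 / 2 * M := by gcongr
      _ = M / 2 := by ring
  have h5 := norm_sub_norm_le (∑ β ∈ F.finsuppAntidiag k, bern K β y • c β)
    (∑ β ∈ F.finsuppAntidiag k, bern K β (AffineMap.homothety y ε u) • c β)
  rw [norm_sub_rev, hM] at h5
  linarith

/-- A field with values of size at least `m` on a homothetic copy of a face has an integral bounded
below by the surface measure of the face. -/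
theorem le_setIntegral_of_homothety {F : Finset (Vec d)} {q : Vec d → Vec d} (hq : Continuous q)
    (hfin : surfaceMeasure d (simplex F) < ⊤) {y : Vec d} (hy : y ∈ simplex F) {ε m : ℝ}
    (hε : 0 < ε) (hε1 : ε ≤ 1) (hm : 0 ≤ m)
    (hlow : ∀ u ∈ simplex F, m ≤ ‖q (AffineMap.homothety y ε u)‖) :
    m ^ 2 * (ε ^ (d - 1) * (surfaceMeasure d).real (simplex F)) ≤
      ∫ x in simplex F, ‖q x‖ ^ 2 ∂(surfaceMeasure d) := by
  have hSF : AffineMap.homothety y ε '' simplex F ⊆ simplex F := by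
    rintro _ ⟨u, hu, rfl⟩
    have := convex_simplex F hy hu (sub_nonneg.2 hε1) hε.le (by ring)
    convert this using 1
    rw [AffineMap.homothety_apply, vsub_eq_sub, vadd_eq_add, smul_sub, sub_smul, one_smul]
    abel
  have hSm : MeasurableSet (AffineMap.homothety y ε '' simplex F) :=
    ((isCompact_simplex F).image (AffineMap.homothety_continuous y ε)).measurableSet
  have hSμ : (surfaceMeasure d).real (AffineMap.homothety y ε '' simplex F) =
      ε ^ (d - 1) * (surfaceMeasure d).real (simplex F) := by
    rw [Measure.real, surfaceMeasure, euclideanHausdorffMeasure_homothety_image _ _ hε.ne',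
      ENNReal.smul_def, smul_eq_mul, ENNReal.toReal_mul]
    simp only [ENNReal.coe_toReal, NNReal.coe_pow, coe_nnnorm, Real.norm_eq_abs, abs_of_pos hε]
    rfl
  have hint : IntegrableOn (fun x => ‖q x‖ ^ 2) (simplex F) (surfaceMeasure d) := by
    obtain ⟨B, hB⟩ :=
      (isCompact_simplex F).exists_bound_of_continuousOn (hq.norm.pow 2).continuousOn
    refine Measure.integrableOn_of_bounded (M := B) hfin.ne
      (hq.norm.pow 2).aestronglyMeasurable ?_
    filter_upwards [ae_restrict_mem (measurableSet_simplex F)] with x hx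
    exact hB x hx
  rw [← hSμ]
  refine mul_measureReal_le_setIntegral hSF hSm hfin hint (fun x => by positivity) ?_
  rintro _ ⟨u, hu, rfl⟩
  exact pow_le_pow_left₀ hm (hlow u hu) 2

/-- The inverse inequality on a face. Near a point where the field attains its maximum `M`, it is at
least `M / 2` on a homothetic copy of the face with a fixed ratio `ε`. -/
theorem exists_inverse_inequality (k : ℕ) (hd : 0 < d) : ∃ C : ℝ, 0 < C ∧
    ∀ {K F : Finset (Vec d)}, IsFullSimplex K → F ⊆ K → F.card = d →
      ∀ (c : (Vec d →₀ ℕ) → Vec d), ∀ α ∈ F.finsuppAntidiag k,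
      ‖c α‖ ^ 2 * (surfaceMeasure d).real (simplex F) ≤
        C * ∫ x in simplex F, ‖∑ β ∈ F.finsuppAntidiag k, bern K β x • c β‖ ^ 2
          ∂(surfaceMeasure d) := by
  obtain ⟨C, hC, hcoef⟩ := exists_norm_coeff_le d k hd
  obtain ⟨N, hNdef⟩ : ∃ N : ℝ, (numIndices d k : ℝ) = N := ⟨_, rfl⟩
  have hN : 0 ≤ N := hNdef ▸ Nat.cast_nonneg _
  -- on the scale `ε` the field varies by at most half its maximum
  obtain ⟨ε, hε, hε1, hεN⟩ : ∃ ε : ℝ, 0 < ε ∧ ε ≤ 1 ∧ N * C * k * ε ≤ 1 / 2 := by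
    have hA : 0 ≤ N * C * k := by positivity
    refine ⟨(2 * (N * C * k + 1))⁻¹, by positivity, inv_le_one_of_one_le₀ (by linarith), ?_⟩
    rw [← div_eq_mul_inv, div_le_div_iff₀ (by positivity) (by norm_num)]
    linarith
  refine ⟨4 * C ^ 2 * (ε ^ (d - 1))⁻¹, by positivity, fun {K F} hK hF hc c α hα => ?_⟩
  have hne : F.Nonempty := Finset.card_pos.1 (by omega)
  have hFi : AffineIndependent ℝ ((↑) : F → Vec d) := hK.indep.mono (by exact_mod_cast hF)
  set q : Vec d → Vec d := fun x => ∑ β ∈ F.finsuppAntidiag k, bern K β x • c β with hq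
  have hqc : Continuous q :=
    continuous_finsetSum _ fun β _ => (bern_continuous K β).smul continuous_const
  obtain ⟨y, hy, hmax⟩ := (isCompact_simplex F).exists_isMaxOn ⟨_, center_mem_simplex hne⟩
    hqc.norm.continuousOn
  obtain ⟨M, hMdef⟩ : ∃ M, ‖q y‖ = M := ⟨_, rfl⟩
  have hM0 : 0 ≤ M := hMdef ▸ norm_nonneg _
  have hmax' : ∀ x ∈ simplex F, ‖q x‖ ≤ M := fun x hx => hMdef ▸ hmax hx
  have hM : ∀ β ∈ F.finsuppAntidiag k, ‖c β‖ ≤ C * M :=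
    hcoef hK hF hc c M hmax'
  have hfin := surfaceMeasure_simplex_lt_top hd hFi hc
  have hsum : ∑ β ∈ F.finsuppAntidiag k, ‖c β‖ ≤ N * C * M := by
    refine (Finset.sum_le_sum hM).trans_eq ?_
    rw [Finset.sum_const, card_finsuppAntidiag, hc, nsmul_eq_mul, hNdef, mul_assoc]
  have h3 := le_setIntegral_of_homothety hqc hfin hy hε hε1 (by positivity : 0 ≤ M / 2)
    fun u hu => hK.half_max_le hF hsum hε hε1 hεN hy hu hMdef
  have hμ : 0 ≤ (surfaceMeasure d).real (simplex F) := measureReal_nonneg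
  have hp : 0 < ε ^ (d - 1) := by positivity
  calc ‖c α‖ ^ 2 * (surfaceMeasure d).real (simplex F)
      ≤ (C * M) ^ 2 * (surfaceMeasure d).real (simplex F) := by
        gcongr
        exact hM α hα
    _ = 4 * C ^ 2 * (ε ^ (d - 1))⁻¹ *
        ((M / 2) ^ 2 * (ε ^ (d - 1) * (surfaceMeasure d).real (simplex F))) := by
        field_simp
        ring
    _ ≤ _ := mul_le_mul_of_nonneg_left h3 (by positivity)

/-! ### Traces and weak gradients -/

theorem hasTraceAt_of_continuousWithinAt {U : Set (Vec d)} {q : Vec d → Vec d} {x : Vec d}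
    (hq : ContinuousWithinAt q U x) (hU : MeasurableSet U) : HasTraceAt U q x (q x) := by
  rw [HasTraceAt, ENNReal.tendsto_nhds_zero]
  intro ε hε
  have h1 : ∀ᶠ y in 𝓝[U] x, edist (q y) (q x) < ε := (EMetric.tendsto_nhds.1 hq) ε hε
  obtain ⟨δ, hδ, hball⟩ := Metric.mem_nhdsWithin_iff.1 h1
  filter_upwards [Ioo_mem_nhdsGT hδ] with r hr
  rw [setLAverage_eq]
  refine ENNReal.div_le_of_le_mul ?_
  rw [← setLIntegral_const]
  refine setLIntegral_mono' (hU.inter measurableSet_ball) fun y hy => ?_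
  rw [← edist_eq_enorm_sub]
  exact (hball ⟨Metric.ball_subset_ball hr.2.le hy.2, hy.1⟩).le

theorem HasTraceAt.unique {U : Set (Vec d)} (hU : IsOpen U) {q : Vec d → Vec d} {x g g' : Vec d}
    (hx : x ∈ closure U) (hm : AEStronglyMeasurable q (volume.restrict U))
    (h : HasTraceAt U q x g) (h' : HasTraceAt U q x g') : g = g' := by
  have h1 := h.add hm (h'.smul (-1))
  have h2 : HasTraceAt U (fun _ => (0 : Vec d)) x (g + (-1 : ℝ) • g') :=
    h1.congr (Eventually.of_forall fun y => by simp)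
  have h3 : Tendsto (fun _ : ℝ => ‖g + (-1 : ℝ) • g'‖ₑ) (𝓝[>] 0) (𝓝 0) := by
    refine Tendsto.congr' ?_ h2
    filter_upwards [self_mem_nhdsWithin] with r (hr : 0 < r)
    have hpos : volume (U ∩ Metric.ball x r) ≠ 0 := by
      obtain ⟨y, hy1, hy2⟩ := mem_closure_iff.1 hx _ Metric.isOpen_ball (Metric.mem_ball_self hr)
      exact ((hU.inter Metric.isOpen_ball).measure_pos volume ⟨y, hy2, hy1⟩).ne'
    have hfin : volume (U ∩ Metric.ball x r) ≠ ⊤ :=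
      ((measure_mono Set.inter_subset_right).trans_lt measure_ball_lt_top).ne
    simp only [zero_sub, enorm_neg]
    rw [setLAverage_const hpos hfin]
  have h4 := tendsto_nhds_unique h3 tendsto_const_nhds
  rw [eq_comm, enorm_eq_zero] at h4
  simpa [add_neg_eq_zero] using h4

/-- The trace of a field that agrees almost everywhere with a continuous field. -/
theorem trace_eq {U : Set (Vec d)} (hU : IsOpen U) {v q : Vec d → Vec d} {x : Vec d}
    (hx : x ∈ closure U) (hq : Continuous q) (h : v =ᵐ[volume.restrict U] q) :
    trace U v x = q x := by
  have h1 : HasTraceAt U q x (q x) :=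
    hasTraceAt_of_continuousWithinAt hq.continuousWithinAt hU.measurableSet
  have hex : ∃ g, HasTraceAt U v x g := ⟨q x, h1.congr h.symm⟩
  rw [trace, dif_pos hex]
  exact HasTraceAt.unique hU hx hq.aestronglyMeasurable (hex.choose_spec.congr h) h1

theorem integrable_mul_test {U : Set (Vec d)} {f φ : Vec d → ℝ}
    (hf : LocallyIntegrableOn f U) (h1 : ContDiff ℝ ∞ φ) (h2 : HasCompactSupport φ)
    (h3 : tsupport φ ⊆ U) : Integrable (fun x => f x * φ x) := by
  have h4 : IntegrableOn f (tsupport φ) := hf.integrableOn_compact_subset h3 h2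
  have h5 : IntegrableOn (fun x => f x * φ x) (tsupport φ) :=
    h4.mul_continuousOn h1.continuous.continuousOn h2
  rwa [integrableOn_iff_integrable_of_support_subset] at h5
  exact (Function.support_mul_subset_right _ _).trans subset_closure

theorem setIntegral_mul_test {U : Set (Vec d)} {f φ : Vec d → ℝ}
    (h3 : Function.support φ ⊆ U) : ∫ x in U, f x * φ x = ∫ x, f x * φ x :=
  setIntegral_eq_integral_of_forall_compl_eq_zero fun x hx => by
    rw [Function.notMem_support.1 fun h => hx (h3 h), mul_zero]

/-- Weak gradients are unique up to null sets. -/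
theorem HasWeakGradient.ae_eq {U : Set (Vec d)} (hU : IsOpen U) {v : Vec d → Vec d}
    {G G' : Vec d → Fin d → Fin d → ℝ} (h : HasWeakGradient U v G) (h' : HasWeakGradient U v G')
    (i j : Fin d) : ∀ᵐ x ∂(volume.restrict U), G x i j = G' x i j := by
  rw [ae_restrict_iff' hU.measurableSet]
  have h0 : ∀ᵐ x, x ∈ U → G x i j - G' x i j = 0 := by
    refine hU.ae_eq_zero_of_integral_contDiff_smul_eq_zero
      ((h i j).2.1.sub (h' i j).2.1) fun φ h1 h2 h3 => ?_
    have e1 := (h i j).2.2 φ h1 h2 h3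
    have e2 := (h' i j).2.2 φ h1 h2 h3
    have e3 : ∫ x in U, G x i j * φ x = ∫ x in U, G' x i j * φ x := by linarith
    have hs : Function.support φ ⊆ U := subset_closure.trans h3
    rw [setIntegral_mul_test hs, setIntegral_mul_test hs] at e3
    have e4 : (fun x => φ x • (G x i j - G' x i j)) =
        fun x => G x i j * φ x - G' x i j * φ x := by
      funext x; rw [smul_eq_mul]; ring
    rw [e4, integral_sub (integrable_mul_test (h i j).2.1 h1 h2 h3)
      (integrable_mul_test (h' i j).2.1 h1 h2 h3), e3, sub_self]
  filter_upwards [h0] with x hx hxU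
  exact sub_eq_zero.1 (hx hxU)

/-- A Lipschitz field has a weak gradient with entries bounded by the Lipschitz constant, namely the
almost everywhere derivative of a Lipschitz extension. -/
theorem exists_hasWeakGradient {U : Set (Vec d)} (hU : IsOpen U) {f : Vec d → Vec d} {L : NNReal}
    (hf : LipschitzOnWith L f U) : ∃ G, HasWeakGradient U f G ∧
      (∀ x i j, |G x i j| ≤ L) ∧ ∀ i j, AEStronglyMeasurable (fun x => G x i j) := by
  have hcomp : ∀ i, LipschitzOnWith L (fun x => f x i) U := fun i =>
    LipschitzOnWith.of_dist_le_mul fun x hx y hy => by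
      refine le_trans ?_ (hf.dist_le_mul x hx y hy)
      rw [Real.dist_eq, dist_eq_norm]
      exact PiLp.norm_apply_le (f x - f y) i
  choose F hF hFe using fun i => (hcomp i).extend_real
  have hFe' : ∀ i, ∀ x ∈ U, f x i = F i x := fun i x hx => hFe i hx
  refine ⟨fun x i j => lineDeriv ℝ (F i) x (EuclideanSpace.single j 1), fun i j => ⟨?_, ?_, ?_⟩,
    fun x i j => ?_, fun i j => ?_⟩
  · have h1 : LocallyIntegrableOn (F i) U :=
      ((hF i).continuous.locallyIntegrable).locallyIntegrableOn U
    intro x hx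
    obtain ⟨s, hs, hs2⟩ := h1 x hx
    refine ⟨s ∩ U, inter_mem hs self_mem_nhdsWithin, ?_⟩
    refine (integrableOn_congr_fun_ae ?_).2 (hs2.mono_set Set.inter_subset_left)
    have : ∀ᵐ y ∂volume.restrict U, f y i = F i y := by
      filter_upwards [ae_restrict_mem hU.measurableSet] with y hy
      exact hFe' i y hy
    exact ae_mono (Measure.restrict_mono Set.inter_subset_right le_rfl) this
  · exact ((hF i).locallyIntegrable_lineDeriv _).locallyIntegrableOn U
  · intro φ h1 h2 h3
    have hs : Function.support φ ⊆ U := subset_closure.trans h3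
    have hs' : Function.support (fun x => fderiv ℝ φ x (EuclideanSpace.single j 1)) ⊆ U := by
      refine (Function.support_subset_iff'.2 fun x hx => ?_).trans h3
      rw [fderiv_of_notMem_tsupport ℝ hx]
      rfl
    obtain ⟨D, hD⟩ := ContDiff.lipschitzWith_of_hasCompactSupport h2 h1 (by simp)
    have key := LipschitzWith.integral_lineDeriv_mul_eq (μ := (volume : Measure (Vec d))) (hF i) hD
      h2 (EuclideanSpace.single j 1)
    have e1 : ∫ x in U, f x i * fderiv ℝ φ x (EuclideanSpace.single j 1) =
        ∫ x in U, F i x * fderiv ℝ φ x (EuclideanSpace.single j 1) :=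
      setIntegral_congr_fun hU.measurableSet fun x hx => by simp only [hFe' i x hx]
    rw [e1, setIntegral_mul_test hs', setIntegral_mul_test hs, key, ← integral_neg]
    refine integral_congr_ae (Eventually.of_forall fun x => ?_)
    have hdx : DifferentiableAt ℝ φ x := h1.differentiable (by simp) x
    simp only
    rw [hdx.lineDeriv_eq_fderiv, map_neg]
    ring
  · have := norm_lineDeriv_le_of_lipschitz ℝ (x₀ := x) (v := EuclideanSpace.single j (1 : ℝ)) (hF i)
    simpa using this
  · exact (((hF i).memLp_lineDeriv (μ := volume) (EuclideanSpace.single j 1))).1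

/-- The weak gradient of a Lipschitz field is bounded by the Lipschitz constant. -/
theorem abs_weakGradient_le {U : Set (Vec d)} (hU : IsOpen U) {v f : Vec d → Vec d} {L : NNReal}
    (hf : LipschitzOnWith L f U) (hv : ∀ i, LocallyIntegrableOn (fun x => v x i) U)
    (h : f =ᵐ[volume.restrict U] v) (i j : Fin d) :
    ∀ᵐ x ∂(volume.restrict U), |weakGradient U v x i j| ≤ L := by
  obtain ⟨G, hG, hL, -⟩ := exists_hasWeakGradient hU hf
  have hG' : HasWeakGradient U v G := hG.congr hv h
  have hex : ∃ G, HasWeakGradient U v G := ⟨G, hG'⟩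
  have hw : HasWeakGradient U v (weakGradient U v) := by
    rw [weakGradient, dif_pos hex]
    exact hex.choose_spec
  filter_upwards [hw.ae_eq hU hG' i j] with x hx
  rw [hx]
  exact hL x i j

theorem memH1_of_lipschitz {Ω : Set (Vec d)} (hΩ : IsOpen Ω) (hb : Bornology.IsBounded Ω)
    {f : Vec d → Vec d} {L : NNReal} (hf : LipschitzOnWith L f Ω) (v : L2 Ω)
    (h : f =ᵐ[volume.restrict Ω] v) : MemH1 Ω v := by
  obtain ⟨G, hG, hL, hm⟩ := exists_hasWeakGradient hΩ hf
  refine ⟨G, hG.congr (locallyIntegrableOn_component v) h, fun i j => ?_⟩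
  have : IsFiniteMeasure (volume.restrict Ω) := isFiniteMeasure_restrict.2 hb.measure_lt_top.ne
  exact MemLp.of_bound (hm i j).restrict L (Eventually.of_forall fun x => hL x i j)

/-! ### Piecewise Lipschitz functions on convex sets -/

/-- A function that is locally Lipschitz at every point of an interval with the same constant is
Lipschitz from the left end. -/
theorem norm_sub_le_of_local {E : Type*} [NormedAddCommGroup E] {h : ℝ → E} {C : ℝ}
    (hloc : ∀ t ∈ Icc (0 : ℝ) 1, ∀ᶠ s in 𝓝[Icc (0 : ℝ) 1] t, ‖h s - h t‖ ≤ C * |s - t|) :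
    ‖h 1 - h 0‖ ≤ C := by
  have hcont : ContinuousOn h (Icc 0 1) := fun t ht => by
    rw [ContinuousWithinAt, tendsto_iff_norm_sub_tendsto_zero]
    refine squeeze_zero' (Eventually.of_forall fun _ => norm_nonneg _) (hloc t ht) ?_
    have : Tendsto (fun s : ℝ => C * |s - t|) (𝓝 t) (𝓝 (C * |t - t|)) :=
      Continuous.tendsto (by fun_prop) t
    simp only [sub_self, abs_zero, mul_zero] at this
    exact this.mono_left nhdsWithin_le_nhds
  have hsub : Icc (0 : ℝ) 1 ⊆ {t | ‖h t - h 0‖ ≤ C * t} := by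
    refine IsClosed.Icc_subset_of_forall_exists_gt ?_ (by simp) ?_
    · have : {t | ‖h t - h 0‖ ≤ C * t} ∩ Icc 0 1 =
          {t | t ∈ Icc (0 : ℝ) 1 ∧ ‖h t - h 0‖ ≤ C * t} := by
        ext t; exact and_comm
      rw [this]
      exact isClosed_Icc.isClosed_le (hcont.sub continuousOn_const).norm (by fun_prop)
    · rintro t ⟨ht, ht01⟩ y hy
      have h1 := hloc t ⟨ht01.1, ht01.2.le⟩
      have h2 : 𝓝[>] t ≤ 𝓝[Icc (0 : ℝ) 1] t := by
        refine nhdsWithin_le_of_mem ?_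
        filter_upwards [Ioo_mem_nhdsGT ht01.2] with s hs
        exact ⟨ht01.1.trans hs.1.le, hs.2.le⟩
      have h3 := Filter.Eventually.and (h1.filter_mono h2) (Ioc_mem_nhdsGT hy)
      obtain ⟨s, hs1, hs2⟩ := h3.exists
      refine ⟨s, ?_, hs2⟩
      simp only [Set.mem_ofPred_eq] at ht ⊢
      have h4 := norm_sub_le_norm_sub_add_norm_sub (h s) (h t) (h 0)
      rw [abs_of_pos (sub_pos.2 hs2.1)] at hs1
      linarith
  simpa using hsub (right_mem_Icc.2 zero_le_one)

/-- A function on a convex set that is Lipschitz on each set of a finite closed cover is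
Lipschitz. -/
theorem lipschitzOnWith_of_cover {ι : Type*} {S : Set (Vec d)} (hS : Convex ℝ S) (I : Finset ι)
    (A : ι → Set (Vec d)) (hA : ∀ i ∈ I, IsClosed (A i)) (hcov : S ⊆ ⋃ i ∈ I, A i)
    {f : Vec d → Vec d} {L : NNReal} (hf : ∀ i ∈ I, LipschitzOnWith L f (A i)) :
    LipschitzOnWith L f S := by
  classical
  have hloc : ∀ x ∈ S, ∀ᶠ y in 𝓝[S] x, ‖f y - f x‖ ≤ L * ‖y - x‖ := fun x hx => by
    have hcl : IsClosed (⋃ i ∈ I.filter (fun i => x ∉ A i), A i) :=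
      Set.Finite.isClosed_biUnion (Finset.finite_toSet _) fun i hi =>
        hA i (Finset.mem_filter.1 hi).1
    have hxn : x ∈ (⋃ i ∈ I.filter (fun i => x ∉ A i), A i)ᶜ := by
      simp only [Finset.mem_filter, Set.mem_compl_iff, Set.mem_iUnion, not_exists]
      rintro i ⟨-, hi⟩ h
      exact hi h
    filter_upwards [nhdsWithin_le_nhds (hcl.isOpen_compl.mem_nhds hxn), self_mem_nhdsWithin]
      with y hy hyS
    obtain ⟨i, hi, hyi⟩ := Set.mem_iUnion₂.1 (hcov hyS)
    have hxi : x ∈ A i := by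
      by_contra hxi
      exact hy (Set.mem_biUnion (x := i) (Finset.mem_filter.2 ⟨hi, hxi⟩) hyi)
    rw [← dist_eq_norm, ← dist_eq_norm]
    exact (hf i hi).dist_le_mul y hyi x hxi
  refine LipschitzOnWith.of_dist_le_mul fun x hx y hy => ?_
  rw [dist_comm, dist_comm x y, dist_eq_norm, dist_eq_norm]
  have hγ : ∀ t ∈ Icc (0 : ℝ) 1, x + t • (y - x) ∈ S := fun t ht =>
    hS.add_smul_sub_mem hx hy ht
  have := norm_sub_le_of_local (h := fun t => f (x + t • (y - x))) (C := L * ‖y - x‖)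
    fun t ht => by
      have hc : Tendsto (fun s : ℝ => x + s • (y - x)) (𝓝[Icc 0 1] t) (𝓝[S] (x + t • (y - x))) := by
        refine tendsto_nhdsWithin_of_tendsto_nhds_of_eventually_within _ ?_ ?_
        · exact (Continuous.tendsto (by fun_prop) t).mono_left nhdsWithin_le_nhds
        · filter_upwards [self_mem_nhdsWithin] with s hs using hγ s hs
      filter_upwards [hc.eventually (hloc _ (hγ t ht))] with s hs
      refine hs.trans_eq ?_
      rw [add_sub_add_left_eq_sub, ← sub_smul, norm_smul, Real.norm_eq_abs]
      ring
  simpa using this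

/-! ### Faces on the boundary of a convex polytope -/

/-- The subspace of the values compatible with the vanishing of the components along all `W`. -/
def normalSpace (𝒲 : Finset (Submodule ℝ (Vec d))) : Submodule ℝ (Vec d) := ⨅ W ∈ 𝒲, Wᗮ

theorem mem_normalSpace {𝒲 : Finset (Submodule ℝ (Vec d))} {c : Vec d} :
    c ∈ normalSpace 𝒲 ↔ ∀ W ∈ 𝒲, c ∈ Wᗮ := by
  simp [normalSpace]

/-- The distance to the normal space is controlled by the components along the subspaces: on the
orthogonal complement of the normal space, these components determine the vector. -/
theorem exists_norm_sub_starProjection_le (𝒲 : Finset (Submodule ℝ (Vec d))) :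
    ∃ C : ℝ, 0 ≤ C ∧ ∀ c : Vec d, ‖c - (normalSpace 𝒲).starProjection c‖ ^ 2 ≤
      C * ∑ W ∈ 𝒲, ‖W.starProjection c‖ ^ 2 := by
  let φ : Vec d →ₗ[ℝ] (𝒲 → Vec d) := LinearMap.pi fun W => (W.1.starProjection : Vec d →ₗ[ℝ] Vec d)
  have hφ : ∀ c W, φ c W = W.1.starProjection c := fun c W => rfl
  have hker : (φ.comp (normalSpace 𝒲)ᗮ.subtype).ker = ⊥ := by
    rw [LinearMap.ker_eq_bot']
    intro u hu
    have h1 : (u : Vec d) ∈ normalSpace 𝒲 := by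
      rw [mem_normalSpace]
      intro W hW
      have := congrFun hu ⟨W, hW⟩
      exact (Submodule.starProjection_apply_eq_zero_iff _).1 this
    have h2 := (normalSpace 𝒲).inner_right_of_mem_orthogonal h1 u.2
    exact Subtype.ext (inner_self_eq_zero.1 h2)
  obtain ⟨K, -, hK⟩ := (φ.comp (normalSpace 𝒲)ᗮ.subtype).exists_antilipschitzWith hker
  refine ⟨K ^ 2, by positivity, fun c => ?_⟩
  have hmem : c - (normalSpace 𝒲).starProjection c ∈ (normalSpace 𝒲)ᗮ :=
    Submodule.sub_starProjection_mem_orthogonal c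
  have h1 := hK.le_mul_dist ⟨_, hmem⟩ 0
  rw [map_zero, dist_zero_right, dist_zero_right] at h1
  have h2 : φ.comp (normalSpace 𝒲)ᗮ.subtype ⟨_, hmem⟩ = φ c := by
    funext W
    simp only [LinearMap.comp_apply, Submodule.subtype_apply, hφ, map_sub]
    rw [(Submodule.starProjection_apply_eq_zero_iff _).2
      (mem_normalSpace.1 (Submodule.starProjection_apply_mem _ c) W.1 W.2), sub_zero]
  rw [h2] at h1
  have h3 : ‖φ c‖ ≤ √(∑ W ∈ 𝒲, ‖W.starProjection c‖ ^ 2) := by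
    refine (pi_norm_le_iff_of_nonneg (Real.sqrt_nonneg _)).2 fun W => ?_
    refine Real.le_sqrt_of_sq_le ?_
    exact Finset.single_le_sum (f := fun W : Submodule ℝ (Vec d) => ‖W.starProjection c‖ ^ 2)
      (fun _ _ => by positivity) W.2
  have h4 : 0 ≤ ∑ W ∈ 𝒲, ‖W.starProjection c‖ ^ 2 := Finset.sum_nonneg fun _ _ => by positivity
  calc ‖c - (normalSpace 𝒲).starProjection c‖ ^ 2
      ≤ (K * √(∑ W ∈ 𝒲, ‖W.starProjection c‖ ^ 2)) ^ 2 := by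
        refine pow_le_pow_left₀ (norm_nonneg _) (h1.trans ?_) 2
        gcongr
    _ = _ := by rw [mul_pow, Real.sq_sqrt h4]

/-- The constant can be chosen for all subfamilies of a finite family of subspaces. -/
theorem exists_norm_sub_starProjection_le_of_subset (𝒮 : Finset (Submodule ℝ (Vec d))) :
    ∃ C : ℝ, 0 ≤ C ∧ ∀ 𝒲 ⊆ 𝒮, ∀ c : Vec d, ‖c - (normalSpace 𝒲).starProjection c‖ ^ 2 ≤
      C * ∑ W ∈ 𝒲, ‖W.starProjection c‖ ^ 2 := by
  choose C hC h using exists_norm_sub_starProjection_le (d := d)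
  refine ⟨∑ 𝒲 ∈ 𝒮.powerset, C 𝒲, Finset.sum_nonneg fun _ _ => hC _, fun 𝒲 h𝒲 c => ?_⟩
  refine (h 𝒲 c).trans (mul_le_mul_of_nonneg_right ?_ (Finset.sum_nonneg fun _ _ => by positivity))
  exact Finset.single_le_sum (f := C) (fun _ _ => hC _) (Finset.mem_powerset.2 h𝒲)

/-- The tangent space of a face on the boundary of the polytope `closure Ω = conv S` is spanned by
points of `S`: it is the tangent space of the facet of the polytope in a supporting hyperplane. -/
theorem vectorSpan_boundaryFace {Ω : Set (Vec d)} (hd : 0 < d) (hΩ : IsOpen Ω) (hc : Convex ℝ Ω)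
    {S : Finset (Vec d)} (hS : closure Ω = convexHull ℝ (S : Set (Vec d))) {T : Mesh Ω}
    {F : Finset (Vec d)} (hF : F ∈ T.boundaryFaces) :
    ∃ A ⊆ S, vectorSpan ℝ (F : Set (Vec d)) = vectorSpan ℝ (A : Set (Vec d)) := by
  classical
  obtain ⟨hFm, hFf⟩ := T.mem_boundaryFaces.1 hF
  obtain ⟨hFT, hFc⟩ := T.mem_meshFaces.1 hFm
  have hne := T.nonempty_of_mem_faces hFT
  have hxf := hFf (center_mem_simplex hne)
  have hx : center F ∉ Ω := fun h => (hΩ.inter_frontier_eq.subset ⟨h, hxf⟩ :)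
  -- `f` attains its maximum over the polytope at the centroid of `F`, hence on all of `F`
  obtain ⟨f, hf⟩ := geometric_hahn_banach_open_point hc hΩ hx
  have hle : ∀ y ∈ closure Ω, f y ≤ f (center F) := fun y hy =>
    closure_minimal (fun z hz => (hf z hz).le) (isClosed_le f.continuous continuous_const) hy
  have heq : ∀ b ∈ F, f b = f (center F) := by
    have hcard : (F.card : ℝ) ≠ 0 := by exact_mod_cast hne.card_ne_zero
    have hsum : ∑ b ∈ F, (f (center F) - f b) = 0 := by
      have : f (center F) = ∑ b ∈ F, (F.card : ℝ)⁻¹ * f b := by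
        simp [center]
      rw [Finset.sum_sub_distrib, Finset.sum_const, nsmul_eq_mul, this, ← Finset.mul_sum,
        ← mul_assoc, mul_inv_cancel₀ hcard, one_mul, sub_self]
    have h0 := (Finset.sum_eq_zero_iff_of_nonneg fun b hb => sub_nonneg.2
      (hle b (Mesh.simplex_subset_closure hFT (vertex_mem_simplex hb)))).1 hsum
    exact fun b hb => (sub_eq_zero.1 (h0 b hb)).symm
  refine ⟨S.filter (fun s => f s = f (center F)), Finset.filter_subset _ _, ?_⟩
  set A := S.filter (fun s => f s = f (center F)) with hA
  have hFA : (F : Set (Vec d)) ⊆ affineSpan ℝ (A : Set (Vec d)) := fun b hb => by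
    refine convexHull_subset_affineSpan _ ?_
    have hb2 : b ∈ convexHull ℝ (S : Set (Vec d)) := by
      rw [← hS]
      exact Mesh.simplex_subset_closure hFT (vertex_mem_simplex hb)
    obtain ⟨w, hw, hw1, hwb⟩ := Finset.mem_convexHull'.1 hb2
    have hSle : ∀ s ∈ S, f s ≤ f (center F) := fun s hs =>
      hle s (by rw [hS]; exact subset_convexHull ℝ _ hs)
    have hsum : ∑ s ∈ S, w s * (f (center F) - f s) = 0 := by
      have h1 : f b = ∑ s ∈ S, w s * f s := by rw [← hwb]; simp
      simp_rw [mul_sub]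
      rw [Finset.sum_sub_distrib, ← Finset.sum_mul, hw1, one_mul, ← h1, heq b hb, sub_self]
    have h0 := (Finset.sum_eq_zero_iff_of_nonneg fun s hs => mul_nonneg (hw s hs)
      (sub_nonneg.2 (hSle s hs))).1 hsum
    have hz : ∀ s ∈ S, s ∉ A → w s = 0 := fun s hs hsA => by
      refine (mul_eq_zero.1 (h0 s hs)).resolve_right fun h => hsA ?_
      exact Finset.mem_filter.2 ⟨hs, (sub_eq_zero.1 h).symm⟩
    refine Finset.mem_convexHull'.2 ⟨w, fun s hs => hw s (Finset.mem_filter.1 hs).1, ?_, ?_⟩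
    · rw [← hw1]
      exact Finset.sum_subset (Finset.filter_subset _ _) hz
    · rw [← hwb]
      exact Finset.sum_subset (Finset.filter_subset _ _) fun s hs hsA => by simp [hz s hs hsA]
  have hle1 : vectorSpan ℝ (F : Set (Vec d)) ≤ vectorSpan ℝ (A : Set (Vec d)) := by
    rw [← direction_affineSpan, ← direction_affineSpan]
    exact AffineSubspace.direction_le (affineSpan_le.2 hFA)
  have hle2 : vectorSpan ℝ (A : Set (Vec d)) ≤ (f : Vec d →ₗ[ℝ] ℝ).ker := by
    rw [vectorSpan_def, Submodule.span_le]
    rintro _ ⟨a, ha, b, hb, rfl⟩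
    have h1 := (Finset.mem_filter.1 ha).2
    have h2 := (Finset.mem_filter.1 hb).2
    simp [h1, h2]
  have hf0 : (f : Vec d →ₗ[ℝ] ℝ) ≠ 0 := by
    intro h0
    have hne : Ω.Nonempty := closure_nonempty_iff.1
      ⟨_, Mesh.simplex_subset_closure hFT (center_mem_simplex hne)⟩
    obtain ⟨y, hy⟩ := hne
    have h1 := hf y hy
    have h2 : ∀ z, f z = 0 := fun z => LinearMap.congr_fun h0 z
    rw [h2, h2] at h1
    exact lt_irrefl _ h1
  have hrank := Module.Dual.finrank_ker_add_one_of_ne_zero (f := (f : Vec d →ₗ[ℝ] ℝ)) hf0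
  rw [finrank_euclideanSpace, Fintype.card_fin] at hrank
  refine Submodule.eq_of_le_of_finrank_le hle1 ?_
  rw [finrank_vectorSpan_face hd (T.indep hFT) hFc]
  have := Submodule.finrank_mono hle2
  omega

open Classical in
/-- The tangent spaces of the boundary faces containing `σ`. -/
def Mesh.tangentSpaces {Ω : Set (Vec d)} (T : Mesh Ω) (σ : Finset (Vec d)) :
    Finset (Submodule ℝ (Vec d)) :=
  (T.boundaryFaces.filter fun F => σ ⊆ F).image
    fun F : Finset (Vec d) => vectorSpan ℝ (F : Set (Vec d))

theorem Mesh.mem_tangentSpaces {Ω : Set (Vec d)} {T : Mesh Ω} {σ : Finset (Vec d)}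
    {W : Submodule ℝ (Vec d)} : W ∈ T.tangentSpaces σ ↔
      ∃ F ∈ T.boundaryFaces, σ ⊆ F ∧ vectorSpan ℝ (F : Set (Vec d)) = W := by
  simp [tangentSpaces, and_assoc]

/-- The distance to the normal space at a cell is controlled by the tangential components, with a
constant that only depends on the polytope: it has finitely many facets. -/
theorem exists_norm_sub_le_sum_tangential {Ω : Set (Vec d)} (hd : 0 < d)
    (hΩ : IsConvexPolytopalDomain Ω) : ∃ C : ℝ, 0 ≤ C ∧ ∀ (T : Mesh Ω) (σ : Finset (Vec d))
      (c : Vec d), ‖c - (normalSpace (T.tangentSpaces σ)).starProjection c‖ ^ 2 ≤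
        C * ∑ F ∈ T.boundaryFaces with σ ⊆ F,
          ‖(vectorSpan ℝ (F : Set (Vec d))).starProjection c‖ ^ 2 := by
  classical
  obtain ⟨S, hS⟩ := hΩ.polytopal
  obtain ⟨C, hC, h⟩ := exists_norm_sub_starProjection_le_of_subset
    (S.powerset.image fun A : Finset (Vec d) => vectorSpan ℝ (A : Set (Vec d)))
  refine ⟨C, hC, fun T σ c => ?_⟩
  refine (h (T.tangentSpaces σ) (fun W hW => ?_) c).trans (mul_le_mul_of_nonneg_left ?_ hC)
  · obtain ⟨F, hF, -, rfl⟩ := Mesh.mem_tangentSpaces.1 hW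
    obtain ⟨A, hA, hFA⟩ := vectorSpan_boundaryFace hd hΩ.isOpen hΩ.convex hS hF
    exact Finset.mem_image.2 ⟨A, Finset.mem_powerset.2 hA, hFA.symm⟩
  -- several faces may have the same tangent space
  · unfold Mesh.tangentSpaces
    refine Finset.sum_image_le_of_nonneg (s := T.boundaryFaces.filter fun F => σ ⊆ F)
      (g := fun F : Finset (Vec d) => vectorSpan ℝ (F : Set (Vec d)))
      (f := fun W : Submodule ℝ (Vec d) => ‖W.starProjection c‖ ^ 2) ?_
    intro W _
    positivity

/-- Almost every point of the boundary lies in a boundary face whose normal space is spanned by the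
outward unit normal at the point. -/
theorem ae_mem_boundaryFace {Ω : Set (Vec d)} (hd : 2 ≤ d) (hΩ : IsOpen Ω) (T : Mesh Ω) :
    ∀ᵐ x ∂((surfaceMeasure d).restrict (frontier Ω)), x ∈ frontier Ω ∧
      ∀ n, IsOutwardUnitNormal Ω x n → ∃ F ∈ T.boundaryFaces, x ∈ simplex F ∧
        ∀ g ∈ (vectorSpan ℝ (F : Set (Vec d)))ᗮ, g - inner ℝ n g • n = 0 := by
  have hnull : surfaceMeasure d
      (⋃ F ∈ T.finite_faces.toFinset.filter (fun F => F.card + 1 ≤ d), simplex F) = 0 :=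
    (measure_biUnion_null_iff (Finset.countable_toSet _)).2 fun F hF =>
      surfaceMeasure_simplex_eq_zero (Finset.mem_filter.1 hF).2
  have h1 : ∀ᵐ x ∂((surfaceMeasure d).restrict (frontier Ω)),
      x ∉ ⋃ F ∈ T.finite_faces.toFinset.filter (fun F => F.card + 1 ≤ d), simplex F :=
    ae_restrict_of_ae (measure_eq_zero_iff_ae_notMem.1 hnull)
  filter_upwards [h1, ae_restrict_mem isClosed_frontier.measurableSet] with x hxN hxf
  refine ⟨hxf, fun n hn => ?_⟩
  obtain ⟨K, hK, hxK⟩ := Mesh.exists_mem_element (T := T) hΩ (frontier_subset_closure hxf)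
  have hKf := Mesh.isFullSimplex hK
  have hhalf : IsClosed {y : Vec d | inner ℝ n (y - x) ≤ 0} :=
    isClosed_le (by fun_prop) continuous_const
  have hcl : ∀ y ∈ closure Ω, inner ℝ n (y - x) ≤ 0 := fun y hy =>
    closure_minimal (fun z hz => hn.2 z hz) hhalf hy
  -- the vertices of the cell containing `x` in its relative interior
  set σ := K.filter (fun a => 0 < bary K a x) with hσ
  have hσK : σ ⊆ K := Finset.filter_subset _ _
  have hz : ∀ a ∈ K, a ∉ σ → bary K a x = 0 := fun a ha haσ => by
    refine le_antisymm ?_ (hKf.bary_nonneg hxK a)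
    by_contra! h
    exact haσ (Finset.mem_filter.2 ⟨ha, h⟩)
  have hxσ : x ∈ simplex σ := hKf.mem_face_of_bary hσK (fun a _ => hKf.bary_nonneg hxK a) hz
  have hσne : σ.Nonempty := by
    rw [Finset.nonempty_iff_ne_empty]
    intro h
    rw [h] at hxσ
    simp [simplex] at hxσ
  have hσT : σ ∈ T.faces := T.down_closed (T.mem_elements.1 hK).1 hσK hσne
  have hlin : ∀ y, inner ℝ n (y - x) = ∑ a ∈ K, bary K a y * inner ℝ n (a - x) := fun y => by
    have : y - x = ∑ a ∈ K, bary K a y • (a - x) := by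
      simp_rw [smul_sub]
      rw [Finset.sum_sub_distrib, hKf.sum_bary_smul, ← Finset.sum_smul, hKf.sum_bary, one_smul]
    rw [this, inner_sum]
    exact Finset.sum_congr rfl fun a _ => inner_smul_right _ _ _
  -- a convex combination of nonpositive numbers vanishes only if the terms of positive weight do
  have horth : ∀ a ∈ σ, inner ℝ n (a - x) = 0 := by
    have h0 : ∑ a ∈ K, bary K a x * -inner ℝ n (a - x) = 0 := by
      have := hlin x
      simp only [sub_self, inner_zero_right] at this
      simp only [mul_neg, Finset.sum_neg_distrib, ← this, neg_zero]
    have h2 := (Finset.sum_eq_zero_iff_of_nonneg fun a ha => mul_nonneg (hKf.bary_nonneg hxK a)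
      (neg_nonneg.2 (hcl a (Mesh.simplex_subset_closure (T.mem_elements.1 hK).1
        (vertex_mem_simplex ha))))).1 h0
    intro a ha
    have h3 := (mul_eq_zero.1 (h2 a (hσK ha))).resolve_left (Finset.mem_filter.1 ha).2.ne'
    linarith
  -- almost every `x` lies in no cell of codimension two, and `n ≠ 0` excludes the interior of `K`
  have hcard : σ.card = d := by
    have hle : d ≤ σ.card := by
      by_contra! h
      refine hxN (Set.mem_biUnion (x := σ) ?_ hxσ)
      simp only [Finset.coe_filter, Set.mem_ofPred_eq, Set.Finite.mem_toFinset]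
      exact ⟨hσT, h⟩
    have hlt : σ.card ≠ d + 1 := fun h => by
      have hKσ : σ = K := Finset.eq_of_subset_of_card_le hσK (by rw [h, hKf.card_eq])
      have h3 := hlin (x + n)
      rw [add_sub_cancel_left, real_inner_self_eq_norm_sq, hn.1,
        Finset.sum_eq_zero fun a ha => by rw [horth a (hKσ ▸ ha), mul_zero]] at h3
      norm_num at h3
    have := Finset.card_le_card hσK
    rw [hKf.card_eq] at this
    omega
  have hperp : ∀ y ∈ simplex σ, inner ℝ n (y - x) = 0 := fun y hy => by
    rw [hlin, Finset.sum_eq_zero]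
    intro a _
    by_cases ha : a ∈ σ
    · rw [horth a ha, mul_zero]
    · rw [hKf.bary_eq_zero_of_mem_face hσK hy ha, zero_mul]
  have hσb : σ ∈ T.boundaryFaces := by
    refine T.mem_boundaryFaces.2 ⟨T.mem_meshFaces.2 ⟨hσT, hcard⟩, fun y hy => ?_⟩
    rw [hΩ.frontier_eq]
    refine ⟨Mesh.simplex_subset_closure hσT hy, fun hyΩ => ?_⟩
    obtain ⟨ε, hε, hball⟩ := Metric.isOpen_iff.1 hΩ y hyΩ
    have h3 := hn.2 (y + (ε / 2) • n) (hball (by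
      rw [Metric.mem_ball, dist_eq_norm, add_sub_cancel_left, norm_smul, hn.1, Real.norm_eq_abs,
        abs_of_pos (half_pos hε), mul_one]
      exact half_lt_self hε))
    rw [add_sub_right_comm, inner_add_right, hperp y hy, inner_smul_right,
      real_inner_self_eq_norm_sq, hn.1] at h3
    linarith
  refine ⟨σ, hσb, hxσ, fun g hg => ?_⟩
  have hnW : n ∈ (vectorSpan ℝ (σ : Set (Vec d)))ᗮ := by
    rw [Submodule.mem_orthogonal, vectorSpan_def]
    intro u hu
    induction hu using Submodule.span_induction with
    | mem u hu =>
      obtain ⟨a, ha, b, hb, rfl⟩ := hu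
      have : a -ᵥ b = (a - x) - (b - x) := by rw [vsub_eq_sub]; abel
      simp only [this]
      rw [real_inner_comm, inner_sub_right, horth a ha, horth b hb, sub_zero]
    | zero => exact inner_zero_left _
    | add u v _ _ hu hv => rw [inner_add_left, hu, hv, add_zero]
    | smul t u _ hu => rw [inner_smul_left, hu, mul_zero]
  have hrank : Module.finrank ℝ (vectorSpan ℝ (σ : Set (Vec d)))ᗮ = 1 := by
    have h3 := Submodule.finrank_add_finrank_orthogonal (vectorSpan ℝ (σ : Set (Vec d)))
    rw [finrank_vectorSpan_face (by omega) (T.indep hσT) hcard, finrank_euclideanSpace,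
      Fintype.card_fin] at h3
    omega
  have hn0 : (⟨n, hnW⟩ : (vectorSpan ℝ (σ : Set (Vec d)))ᗮ) ≠ 0 := fun h => by
    have h3 : n = 0 := congrArg Subtype.val h
    have h4 := hn.1
    rw [h3, norm_zero] at h4
    exact zero_ne_one h4
  obtain ⟨t, ht⟩ := exists_smul_eq_of_finrank_eq_one hrank hn0 ⟨g, hg⟩
  have ht' : t • n = g := congrArg Subtype.val ht
  rw [← ht', inner_smul_right, real_inner_self_eq_norm_sq, hn.1]
  simp

/-! ### Bernstein coefficients of piecewise polynomial fields -/

/-- The field `v` on `Ω` has the Bernstein coefficients `c` of degree `k` on the simplex `K`. -/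
def HasCoeffs (Ω : Set (Vec d)) (k : ℕ) (K : Finset (Vec d)) (v : Vec d → Vec d)
    (c : (Vec d →₀ ℕ) → Vec d) : Prop :=
  ∀ᵐ x ∂(volume.restrict Ω), x ∈ simplex K → v x = bpoly k K c x

section HasCoeffs

variable {Ω : Set (Vec d)} {k : ℕ} {K : Finset (Vec d)}

theorem HasCoeffs.add {v w : L2 Ω} {c c' : (Vec d →₀ ℕ) → Vec d} (hv : HasCoeffs Ω k K v c)
    (hw : HasCoeffs Ω k K w c') : HasCoeffs Ω k K (v + w : L2 Ω) (c + c') := by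
  filter_upwards [hv, hw, Lp.coeFn_add v w] with x h1 h2 h3 hx
  rw [h3, Pi.add_apply, h1 hx, h2 hx, bpoly_add]

theorem HasCoeffs.sub {v w : L2 Ω} {c c' : (Vec d →₀ ℕ) → Vec d} (hv : HasCoeffs Ω k K v c)
    (hw : HasCoeffs Ω k K w c') : HasCoeffs Ω k K (v - w : L2 Ω) (c - c') := by
  filter_upwards [hv, hw, Lp.coeFn_sub v w] with x h1 h2 h3 hx
  rw [h3, Pi.sub_apply, h1 hx, h2 hx, bpoly_sub]

theorem HasCoeffs.smul {v : L2 Ω} {c : (Vec d →₀ ℕ) → Vec d} (t : ℝ)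
    (hv : HasCoeffs Ω k K v c) : HasCoeffs Ω k K (t • v : L2 Ω) (t • c) := by
  filter_upwards [hv, Lp.coeFn_smul t v] with x h1 h3 hx
  rw [h3, Pi.smul_apply, h1 hx, bpoly_smul]

theorem HasCoeffs.congr {v : Vec d → Vec d} {c c' : (Vec d →₀ ℕ) → Vec d}
    (hv : HasCoeffs Ω k K v c) (h : ∀ α ∈ K.finsuppAntidiag k, c α = c' α) :
    HasCoeffs Ω k K v c' := by
  rw [HasCoeffs, ← bpoly_congr h]
  exact hv

theorem HasCoeffs.ae_eq {v : Vec d → Vec d} {c : (Vec d →₀ ℕ) → Vec d}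
    (hv : HasCoeffs Ω k K v c) (hK : interior (simplex K) ⊆ Ω) :
    v =ᵐ[volume.restrict (interior (simplex K))] bpoly k K c := by
  have h1 := ae_mono (Measure.restrict_mono (μ := volume) hK le_rfl) hv
  filter_upwards [h1, ae_restrict_mem isOpen_interior.measurableSet] with x hx hxK
  exact hx (interior_subset hxK)

theorem HasCoeffs.trace_eq {v : Vec d → Vec d} {c : (Vec d →₀ ℕ) → Vec d}
    (hv : HasCoeffs Ω k K v c) (hK : IsFullSimplex K) (hKΩ : interior (simplex K) ⊆ Ω) {x : Vec d}
    (hx : x ∈ simplex K) : trace (interior (simplex K)) v x = bpoly k K c x := by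
  refine DGVector.trace_eq isOpen_interior ?_ (bpoly_continuous k K c) (hv.ae_eq hKΩ)
  rwa [Mesh.closure_interior_simplex hK]

/-- Bernstein coefficients are unique. -/
theorem HasCoeffs.unique {v : Vec d → Vec d} {c c' : (Vec d →₀ ℕ) → Vec d}
    (hv : HasCoeffs Ω k K v c) (hv' : HasCoeffs Ω k K v c') (hK : IsFullSimplex K)
    (hKΩ : interior (simplex K) ⊆ Ω) : ∀ α ∈ K.finsuppAntidiag k, c α = c' α := by
  obtain ⟨C, -, h⟩ := exists_norm_coeff_le K.card k (by rw [hK.card_eq]; omega)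
  have key := h hK subset_rfl rfl (c - c') 0 fun x hx => by
    have h1 := bpoly_sub k K c c' x
    rw [← hv.trace_eq hK hKΩ hx, ← hv'.trace_eq hK hKΩ hx, sub_self] at h1
    exact (norm_le_zero_iff.2 h1 :)
  intro α hα
  have := key α hα
  rw [mul_zero, norm_le_zero_iff, Pi.sub_apply, sub_eq_zero] at this
  exact this

end HasCoeffs

open Classical in
/-- The Bernstein coefficients of a field on a simplex, when it has some; zero otherwise. -/
def coeffs (Ω : Set (Vec d)) (k : ℕ) (K : Finset (Vec d)) (v : Vec d → Vec d) :
    (Vec d →₀ ℕ) → Vec d :=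
  if h : ∃ c, HasCoeffs Ω k K v c then h.choose else 0

section Operator

variable {Ω : Set (Vec d)} {T : Mesh Ω} {p : ℕ}

theorem hasCoeffs_coeffs {v : L2 Ω} (hv : v ∈ V T p) {K : Finset (Vec d)} (hK : K ∈ T.elements) :
    HasCoeffs Ω (p - 1) K v (coeffs Ω (p - 1) K v) := by
  have hex : ∃ c, HasCoeffs Ω (p - 1) K v c := by
    obtain ⟨q, hq, hq2⟩ := hv K hK
    obtain ⟨c, hc⟩ := (Mesh.isFullSimplex hK).exists_bpoly_eq q hq
    refine ⟨c, ?_⟩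
    filter_upwards [hq2] with x hx hxK
    ext i
    rw [hx hxK, hc]
  rw [coeffs, dif_pos hex]
  exact hex.choose_spec

theorem mem_V_of_hasCoeffs {v : L2 Ω}
    (h : ∀ K ∈ T.elements, ∃ c, HasCoeffs Ω (p - 1) K v c) : v ∈ V T p := by
  intro K hK
  obtain ⟨c, hc⟩ := h K hK
  obtain ⟨q, hq, hq2⟩ := exists_eval_eq_bpoly (p - 1) K c
  refine ⟨q, hq, ?_⟩
  filter_upwards [hc] with x hx hxK i
  rw [hx hxK, hq2]

/-- A field is determined by its coefficients on the elements. -/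
theorem eq_of_hasCoeffs (hΩ : IsOpen Ω) {k : ℕ} {v w : L2 Ω}
    {c : Finset (Vec d) → (Vec d →₀ ℕ) → Vec d} (hv : ∀ K ∈ T.elements, HasCoeffs Ω k K v (c K))
    (hw : ∀ K ∈ T.elements, HasCoeffs Ω k K w (c K)) : v = w := by
  refine Lp.ext ?_
  have h1 : ∀ᵐ x ∂(volume.restrict Ω), ∀ K ∈ T.elements, x ∈ simplex K →
      (v : Vec d → Vec d) x = bpoly k K (c K) x := (Finset.eventually_all _).2 hv
  have h2 : ∀ᵐ x ∂(volume.restrict Ω), ∀ K ∈ T.elements, x ∈ simplex K →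
      (w : Vec d → Vec d) x = bpoly k K (c K) x := (Finset.eventually_all _).2 hw
  filter_upwards [h1, h2, ae_restrict_mem hΩ.measurableSet] with x h3 h4 hx
  obtain ⟨K, hK, hxK⟩ := Mesh.exists_mem_element (T := T) hΩ (subset_closure hx)
  rw [h3 K hK hxK, h4 K hK hxK]

open Classical in
/-- The continuous piecewise polynomial field with a single family of coefficients for all elements
of the mesh. On a common face of two elements it does not matter which one is chosen. -/
def glue (T : Mesh Ω) (k : ℕ) (c : (Vec d →₀ ℕ) → Vec d) (x : Vec d) : Vec d :=
  if h : ∃ K ∈ T.elements, x ∈ simplex K then bpoly k h.choose c x else 0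

theorem glue_eq (k : ℕ) (c : (Vec d →₀ ℕ) → Vec d) {K : Finset (Vec d)} (hK : K ∈ T.elements)
    {x : Vec d} (hx : x ∈ simplex K) : glue T k c x = bpoly k K c x := by
  have h : ∃ K ∈ T.elements, x ∈ simplex K := ⟨K, hK, hx⟩
  rw [glue, dif_pos h]
  have hK' := h.choose_spec.1
  exact (Mesh.isFullSimplex hK').bpoly_eq_of_mem_face (Mesh.isFullSimplex hK)
    Finset.inter_subset_left Finset.inter_subset_right k c
    (Mesh.mem_simplex_inter (T.mem_elements.1 hK').1 (T.mem_elements.1 hK).1 h.choose_spec.2 hx)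

/-- A field on a simplex is Lipschitz, with the constant given by the inball diameter. -/
theorem IsFullSimplex.norm_bpoly_sub_le_div {K : Finset (Vec d)} (hK : IsFullSimplex K)
    (hd : 0 < d) (k : ℕ) (c : (Vec d →₀ ℕ) → Vec d) {x y : Vec d} (hx : x ∈ simplex K)
    (hy : y ∈ simplex K) : ‖bpoly k K c x - bpoly k K c y‖ ≤
      (∑ α ∈ K.finsuppAntidiag k, ‖c α‖) * (k / inballDiameter (simplex K)) * ‖x - y‖ := by
  have hρ := hK.inballDiameter_pos hd
  refine (hK.norm_bpoly_sub_le c hx hy (δ := ‖x - y‖ / inballDiameter (simplex K))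
    fun a _ => ?_).trans_eq (by ring)
  rw [le_div_iff₀ hρ]
  exact hK.abs_bary_sub_mul_le a x y

theorem exists_lipschitzOnWith_glue (hd : 0 < d) (hΩ : IsConvexPolytopalDomain Ω) (k : ℕ)
    (c : (Vec d →₀ ℕ) → Vec d) : ∃ L : NNReal, LipschitzOnWith L (glue T k c) (closure Ω) := by
  let L : Finset (Vec d) → NNReal := fun K =>
    Real.toNNReal ((∑ α ∈ K.finsuppAntidiag k, ‖c α‖) * (k / inballDiameter (simplex K)))
  refine ⟨∑ K ∈ T.elements, L K, lipschitzOnWith_of_cover hΩ.convex.closure T.elements simplex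
    (fun K _ => isClosed_simplex K) (fun x hx => ?_) (fun K hK => ?_)⟩
  · obtain ⟨K, hK, hxK⟩ := Mesh.exists_mem_element (T := T) hΩ.isOpen hx
    exact Set.mem_biUnion (x := K) hK hxK
  · refine LipschitzOnWith.weaken (K := L K) ?_
      (Finset.single_le_sum (f := L) (fun _ _ => zero_le) hK)
    refine LipschitzOnWith.of_dist_le_mul fun x hx y hy => ?_
    rw [glue_eq k c hK hx, glue_eq k c hK hy, dist_eq_norm, dist_eq_norm]
    refine ((Mesh.isFullSimplex hK).norm_bpoly_sub_le_div hd k c hx hy).trans ?_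
    gcongr
    exact Real.le_coe_toNNReal _

/-- On a boundary face, coefficients in the normal spaces give a field normal to the face. -/
theorem bpoly_mem_orthogonal {k : ℕ} {c : (Vec d →₀ ℕ) → Vec d}
    (hc : ∀ α, c α ∈ normalSpace (T.tangentSpaces α.support)) {F K : Finset (Vec d)}
    (hF : F ∈ T.boundaryFaces) (hK : IsFullSimplex K) (hFK : F ⊆ K) {x : Vec d}
    (hx : x ∈ simplex F) : bpoly k K c x ∈ (vectorSpan ℝ (F : Set (Vec d)))ᗮ := by
  rw [hK.bpoly_face hFK k c hx]
  refine Submodule.sum_mem _ fun α hα => Submodule.smul_mem _ _ ?_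
  exact mem_normalSpace.1 (hc α) _
    (Mesh.mem_tangentSpaces.2 ⟨F, hF, (Finset.mem_finsuppAntidiag.1 hα).2, rfl⟩)

/-- Coefficients in the normal spaces define a conforming field. -/
theorem exists_conforming (hd : 2 ≤ d) (hΩ : IsConvexPolytopalDomain Ω) (p : ℕ)
    {c : (Vec d →₀ ℕ) → Vec d} (hc : ∀ α, c α ∈ normalSpace (T.tangentSpaces α.support)) :
    ∃ e : L2 Ω, e ∈ V T p ⊓ H1T Ω ∧ ∀ K ∈ T.elements, HasCoeffs Ω (p - 1) K e c := by
  obtain ⟨L, hL⟩ := exists_lipschitzOnWith_glue (T := T) (by omega) hΩ (p - 1) c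
  have hfin : IsFiniteMeasure (volume.restrict Ω) :=
    isFiniteMeasure_restrict.2 hΩ.isBounded.measure_lt_top.ne
  have hcomp : IsCompact (closure Ω) := hΩ.isBounded.isCompact_closure
  obtain ⟨B, hB⟩ := hcomp.exists_bound_of_continuousOn hL.continuousOn
  have hmem : MemLp (glue T (p - 1) c) 2 (volume.restrict Ω) := by
    refine MemLp.of_bound
      ((hL.continuousOn.mono subset_closure).aestronglyMeasurable hΩ.isOpen.measurableSet) B ?_
    filter_upwards [ae_restrict_mem hΩ.isOpen.measurableSet] with x hx
    exact hB x (subset_closure hx)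
  have hae : glue T (p - 1) c =ᵐ[volume.restrict Ω] (hmem.toLp _ : L2 Ω) := hmem.coeFn_toLp.symm
  have hcoef : ∀ K ∈ T.elements, HasCoeffs Ω (p - 1) K (hmem.toLp _ : L2 Ω) c := fun K hK => by
    filter_upwards [hae] with x hx hxK
    rw [← hx, glue_eq _ c hK hxK]
  refine ⟨hmem.toLp _, ⟨mem_V_of_hasCoeffs fun K hK => ⟨c, hcoef K hK⟩, ?_, ?_⟩, hcoef⟩
  · exact memH1_of_lipschitz hΩ.isOpen hΩ.isBounded (hL.mono subset_closure) _ hae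
  · refine TangentialTraceVanishes.congr ?_ hae
    filter_upwards [ae_mem_boundaryFace hd hΩ.isOpen T] with x ⟨hxf, hx⟩
    refine ⟨glue T (p - 1) c x, hasTraceAt_of_continuousWithinAt
      ((hL.continuousOn x (frontier_subset_closure hxf)).mono subset_closure)
      hΩ.isOpen.measurableSet, fun n hn => ?_⟩
    obtain ⟨F, hF, hxF, hg⟩ := hx n hn
    obtain ⟨K, hK⟩ := Mesh.exists_mem_adjacent hΩ.isOpen
      (T.mem_meshFaces.1 (T.mem_boundaryFaces.1 hF).1).1
    obtain ⟨hK, hFK⟩ := T.mem_adjacent.1 hK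
    refine hg _ ?_
    rw [glue_eq _ c hK (simplex_mono hFK hxF)]
    exact bpoly_mem_orthogonal hc hF (Mesh.isFullSimplex hK) hFK hxF

open Classical in
/-- A chosen element of the star of `σ`; the empty set if the star is empty. -/
def starElement (T : Mesh Ω) (σ : Finset (Vec d)) : Finset (Vec d) :=
  if h : ∃ K, K ∈ T.adjacent σ then h.choose else ∅

theorem starElement_mem {σ K : Finset (Vec d)} (h : K ∈ T.adjacent σ) :
    starElement T σ ∈ T.adjacent σ := by
  have h : ∃ K, K ∈ T.adjacent σ := ⟨K, h⟩
  rw [starElement, dif_pos h]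
  exact h.choose_spec

/-- The coefficients of the conforming field: for each multi-index, the coefficient of `v` on a
chosen element having the support of the multi-index as a face, projected to the normal space. -/
def conformingCoeffs (T : Mesh Ω) (k : ℕ) (v : Vec d → Vec d) (α : Vec d →₀ ℕ) : Vec d :=
  (normalSpace (T.tangentSpaces α.support)).starProjection
    (coeffs Ω k (starElement T α.support) v α)

theorem conformingCoeffs_mem (k : ℕ) (v : Vec d → Vec d) (α : Vec d →₀ ℕ) :
    conformingCoeffs T k v α ∈ normalSpace (T.tangentSpaces α.support) :=
  Submodule.starProjection_apply_mem _ _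

theorem mem_adjacent_support {k : ℕ} {K : Finset (Vec d)} (hK : K ∈ T.elements)
    {α : Vec d →₀ ℕ} (hα : α ∈ K.finsuppAntidiag k) : K ∈ T.adjacent α.support :=
  T.mem_adjacent.2 ⟨hK, (Finset.mem_finsuppAntidiag.1 hα).2⟩

theorem mem_finsuppAntidiag_of_support {k : ℕ} {K K' : Finset (Vec d)}
    {α : Vec d →₀ ℕ} (hα : α ∈ K.finsuppAntidiag k) (h : α.support ⊆ K') :
    α ∈ K'.finsuppAntidiag k :=
  Finset.mem_finsuppAntidiag'.2 ⟨(Finset.mem_finsuppAntidiag'.1 hα).1, h⟩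

theorem support_nonempty {k : ℕ} (hk : 0 < k) {K : Finset (Vec d)} {α : Vec d →₀ ℕ}
    (hα : α ∈ K.finsuppAntidiag k) : α.support.Nonempty := by
  rw [Finsupp.support_nonempty_iff]
  rintro rfl
  have := (Finset.mem_finsuppAntidiag'.1 hα).1
  simp at this
  omega

theorem coeffs_eq (hΩ : IsConvexPolytopalDomain Ω) {v : L2 Ω} (hv : v ∈ V T p)
    {K : Finset (Vec d)} (hK : K ∈ T.elements) {c : (Vec d →₀ ℕ) → Vec d}
    (h : HasCoeffs Ω (p - 1) K v c) {α : Vec d →₀ ℕ} (hα : α ∈ K.finsuppAntidiag (p - 1)) :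
    coeffs Ω (p - 1) K v α = c α :=
  (hasCoeffs_coeffs hv hK).unique h (Mesh.isFullSimplex hK)
    (Mesh.interior_simplex_subset hΩ.isOpen hΩ.convex hK) α hα

theorem conformingCoeffs_add (hΩ : IsConvexPolytopalDomain Ω) {v w : L2 Ω} (hv : v ∈ V T p)
    (hw : w ∈ V T p) {K : Finset (Vec d)} (hK : K ∈ T.elements) {α : Vec d →₀ ℕ}
    (hα : α ∈ K.finsuppAntidiag (p - 1)) :
    conformingCoeffs T (p - 1) (v + w : L2 Ω) α =
      conformingCoeffs T (p - 1) v α + conformingCoeffs T (p - 1) w α := by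
  obtain ⟨h1, h2⟩ := T.mem_adjacent.1 (starElement_mem (mem_adjacent_support hK hα))
  rw [conformingCoeffs, coeffs_eq hΩ (Submodule.add_mem _ hv hw) h1
    ((hasCoeffs_coeffs hv h1).add (hasCoeffs_coeffs hw h1))
    (mem_finsuppAntidiag_of_support hα h2), Pi.add_apply, map_add]
  rfl

theorem conformingCoeffs_smul (hΩ : IsConvexPolytopalDomain Ω) {v : L2 Ω} (hv : v ∈ V T p)
    (t : ℝ) {K : Finset (Vec d)} (hK : K ∈ T.elements) {α : Vec d →₀ ℕ}
    (hα : α ∈ K.finsuppAntidiag (p - 1)) :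
    conformingCoeffs T (p - 1) (t • v : L2 Ω) α = t • conformingCoeffs T (p - 1) v α := by
  obtain ⟨h1, h2⟩ := T.mem_adjacent.1 (starElement_mem (mem_adjacent_support hK hα))
  rw [conformingCoeffs, coeffs_eq hΩ (Submodule.smul_mem _ t hv) h1
    ((hasCoeffs_coeffs hv h1).smul t) (mem_finsuppAntidiag_of_support hα h2), Pi.smul_apply,
    map_smul]
  rfl

/-- The conforming averaging operator, described by its coefficients. -/
theorem exists_conforming_operator (hd : 2 ≤ d) (hΩ : IsConvexPolytopalDomain Ω) (T : Mesh Ω)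
    (p : ℕ) : ∃ E : V T p →ₗ[ℝ] ↥(V T p ⊓ H1T Ω), ∀ v : V T p, ∀ K ∈ T.elements,
      HasCoeffs Ω (p - 1) K (E v : L2 Ω) (conformingCoeffs T (p - 1) (v : L2 Ω)) := by
  choose e he hec using fun v : V T p => exists_conforming (T := T) hd hΩ p
    (c := conformingCoeffs T (p - 1) (v : L2 Ω)) (conformingCoeffs_mem (p - 1) _)
  refine ⟨{ toFun := fun v => ⟨e v, he v⟩, map_add' := fun v w => ?_, map_smul' := fun t v => ?_ },
    hec⟩
  · refine Subtype.ext (eq_of_hasCoeffs (T := T) hΩ.isOpen (fun K hK => ?_)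
      (fun K hK => (hec v K hK).add (hec w K hK)))
    exact (hec (v + w) K hK).congr fun α hα => conformingCoeffs_add hΩ v.2 w.2 hK hα
  · refine Subtype.ext (eq_of_hasCoeffs (T := T) hΩ.isOpen (fun K hK => ?_)
      (fun K hK => (hec v K hK).smul t))
    exact (hec (t • v) K hK).congr fun α hα => conformingCoeffs_smul hΩ v.2 t hK hα

end Operator

/-! ### The jump seminorm bounds the coefficients on faces -/

section FaceTerms

variable {Ω : Set (Vec d)} {T : Mesh Ω} {p : ℕ}

open Classical in
/-- The contribution of a face to the square of the jump seminorm. -/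
def faceJump (T : Mesh Ω) (v : Vec d → Vec d) (F : Finset (Vec d)) : ℝ :=
  if simplex F ⊆ frontier Ω then
    ∫ x in simplex F, (faceSize F)⁻¹ * tangentialSq T v F x ∂(surfaceMeasure d)
  else ∫ x in simplex F, (faceSize F)⁻¹ * jumpSq T v F x ∂(surfaceMeasure d)

theorem faceJump_interior {v : Vec d → Vec d} {F : Finset (Vec d)} (hF : F ∈ T.interiorFaces) :
    faceJump T v F =
      ∫ x in simplex F, (faceSize F)⁻¹ * jumpSq T v F x ∂(surfaceMeasure d) :=
  if_neg (T.mem_interiorFaces.1 hF).2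

theorem faceJump_boundary {v : Vec d → Vec d} {F : Finset (Vec d)} (hF : F ∈ T.boundaryFaces) :
    faceJump T v F =
      ∫ x in simplex F, (faceSize F)⁻¹ * tangentialSq T v F x ∂(surfaceMeasure d) :=
  if_pos (T.mem_boundaryFaces.1 hF).2

theorem jumpSeminormSq_eq_sum (v : Vec d → Vec d) :
    jumpSeminormSq T v = ∑ F ∈ T.meshFaces, faceJump T v F := by
  classical
  rw [jumpSeminormSq, ← Finset.sum_filter_add_sum_filter_not T.meshFaces
    (fun F : Finset (Vec d) => simplex F ⊆ frontier Ω), add_comm]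
  congr 1
  · refine Finset.sum_congr (by ext; simp [T.mem_boundaryFaces]) fun F hF => ?_
    exact (faceJump_boundary (T.mem_boundaryFaces.2 (Finset.mem_filter.1 hF))).symm
  · refine Finset.sum_congr (by ext; simp [T.mem_interiorFaces]) fun F hF => ?_
    exact (faceJump_interior (T.mem_interiorFaces.2 (Finset.mem_filter.1 hF))).symm

theorem jumpSq_nonneg (v : Vec d → Vec d) (F : Finset (Vec d)) (x : Vec d) :
    0 ≤ jumpSq T v F x := by
  unfold jumpSq
  positivity

theorem tangentialSq_nonneg (v : Vec d → Vec d) (F : Finset (Vec d)) (x : Vec d) :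
    0 ≤ tangentialSq T v F x := by
  unfold tangentialSq
  positivity

theorem faceJump_nonneg (v : Vec d → Vec d) (F : Finset (Vec d)) : 0 ≤ faceJump T v F := by
  unfold faceJump
  split_ifs
  · exact integral_nonneg fun x =>
      mul_nonneg (inv_nonneg.2 (faceSize_nonneg F)) (tangentialSq_nonneg v F x)
  · exact integral_nonneg fun x =>
      mul_nonneg (inv_nonneg.2 (faceSize_nonneg F)) (jumpSq_nonneg v F x)

theorem integrableOn_face (hd : 0 < d) {F : Finset (Vec d)}
    (hF : AffineIndependent ℝ ((↑) : F → Vec d)) (hc : F.card = d) {s : Vec d → ℝ}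
    (hs : Continuous s) : IntegrableOn s (simplex F) (surfaceMeasure d) := by
  obtain ⟨B, hB⟩ := (isCompact_simplex F).exists_bound_of_continuousOn hs.continuousOn
  exact Measure.integrableOn_of_bounded (M := B) (surfaceMeasure_simplex_lt_top hd hF hc).ne
    hs.aestronglyMeasurable
    ((ae_restrict_mem (measurableSet_simplex F)).mono fun x hx => hB x hx)

theorem faceSize_pos (hd : 2 ≤ d) {K F : Finset (Vec d)} (hK : IsFullSimplex K) (hF : F ⊆ K)
    (hc : F.card = d) : 0 < faceSize F := by
  obtain ⟨c, hc0, h⟩ := exists_le_faceSize hd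
  exact (mul_pos hc0 (hK.inballDiameter_pos (by omega))).trans_le (h hK hF hc)

theorem face_indep {K F : Finset (Vec d)} (hK : IsFullSimplex K) (hF : F ⊆ K) :
    AffineIndependent ℝ ((↑) : F → Vec d) :=
  hK.indep.mono (Finset.coe_subset.2 hF)

/-- The inverse inequality with the weight of the jump seminorm: if a quadratic density dominates
half the square of a polynomial field on a face, its weighted integral dominates the coefficients
of the field. -/
theorem exists_faceSize_pow_mul_le (hd : 2 ≤ d) (k : ℕ) : ∃ C : ℝ, 0 < C ∧
    ∀ {K F : Finset (Vec d)}, IsFullSimplex K → F ⊆ K → F.card = d →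
      ∀ (c : (Vec d →₀ ℕ) → Vec d) {s : Vec d → ℝ}, Continuous s →
      (∀ x ∈ simplex F, ‖∑ β ∈ F.finsuppAntidiag k, bern K β x • c β‖ ^ 2 ≤ 2 * s x) →
      ∀ α ∈ F.finsuppAntidiag k, faceSize F ^ (d - 2) * ‖c α‖ ^ 2 ≤
        C * ∫ x in simplex F, (faceSize F)⁻¹ * s x ∂(surfaceMeasure d) := by
  obtain ⟨C, hC, h⟩ := exists_inverse_inequality (d := d) k (by omega)
  refine ⟨2 * C, by positivity, fun {K F} hK hF hc c s hs hle α hα => ?_⟩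
  have hh := faceSize_pos hd hK hF hc
  have hi : ∫ x in simplex F, ‖∑ β ∈ F.finsuppAntidiag k, bern K β x • c β‖ ^ 2
      ∂(surfaceMeasure d) ≤ ∫ x in simplex F, 2 * s x ∂(surfaceMeasure d) := by
    refine setIntegral_mono_on
      (integrableOn_face (by omega) (face_indep hK hF) hc ?_)
      (integrableOn_face (by omega) (face_indep hK hF) hc (continuous_const.mul hs))
      (measurableSet_simplex F) hle
    exact ((continuous_finsetSum _ fun β _ => (bern_continuous K β).smul
      continuous_const).norm.pow 2)
  have h1 := (h hK hF hc c α hα).trans (mul_le_mul_of_nonneg_left hi hC.le)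
  rw [integral_const_mul, ← faceSize_pow hd, show d - 1 = d - 2 + 1 by omega,
    pow_succ (faceSize F)] at h1
  rw [integral_const_mul]
  calc faceSize F ^ (d - 2) * ‖c α‖ ^ 2
      = (faceSize F)⁻¹ * (‖c α‖ ^ 2 * (faceSize F ^ (d - 2) * faceSize F)) := by
        field_simp
    _ ≤ (faceSize F)⁻¹ * (C * (2 * ∫ x in simplex F, s x ∂(surfaceMeasure d))) := by gcongr
    _ = _ := by ring

/-- The trace from an element on one of its faces. -/
theorem trace_eq_of_mem_face (hΩ : IsConvexPolytopalDomain Ω) {k : ℕ} {v : Vec d → Vec d}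
    {K F : Finset (Vec d)} (hK : K ∈ T.elements) (hF : F ⊆ K) {c : (Vec d →₀ ℕ) → Vec d}
    (hv : HasCoeffs Ω k K v c) {x : Vec d} (hx : x ∈ simplex F) :
    trace (interior (simplex K)) v x = bpoly k K c x :=
  hv.trace_eq (Mesh.isFullSimplex hK) (Mesh.interior_simplex_subset hΩ.isOpen hΩ.convex hK)
    (simplex_mono hF hx)

theorem jumpSq_eq (hΩ : IsConvexPolytopalDomain Ω) {k : ℕ} {v : Vec d → Vec d}
    {c : Finset (Vec d) → (Vec d →₀ ℕ) → Vec d} (hv : ∀ K ∈ T.elements, HasCoeffs Ω k K v (c K))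
    {F : Finset (Vec d)} {x : Vec d} (hx : x ∈ simplex F) : jumpSq T v F x =
      1 / 2 * ∑ K ∈ T.adjacent F, ∑ K' ∈ T.adjacent F,
        ‖bpoly k K (c K) x - bpoly k K' (c K') x‖ ^ 2 := by
  unfold jumpSq
  refine congrArg (fun t => 1 / 2 * t) ?_
  refine Finset.sum_congr rfl fun K hK => Finset.sum_congr rfl fun K' hK' => ?_
  obtain ⟨h1, h2⟩ := T.mem_adjacent.1 hK
  obtain ⟨h3, h4⟩ := T.mem_adjacent.1 hK'
  rw [trace_eq_of_mem_face hΩ h1 h2 (hv K h1) hx, trace_eq_of_mem_face hΩ h3 h4 (hv K' h3) hx]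

theorem tangentialSq_eq (hΩ : IsConvexPolytopalDomain Ω) {k : ℕ} {v : Vec d → Vec d}
    {c : Finset (Vec d) → (Vec d →₀ ℕ) → Vec d} (hv : ∀ K ∈ T.elements, HasCoeffs Ω k K v (c K))
    {F : Finset (Vec d)} {x : Vec d} (hx : x ∈ simplex F) : tangentialSq T v F x =
      ∑ K ∈ T.adjacent F,
        ‖(vectorSpan ℝ (F : Set (Vec d))).starProjection (bpoly k K (c K) x)‖ ^ 2 := by
  unfold tangentialSq
  refine Finset.sum_congr rfl fun K hK => ?_
  obtain ⟨h1, h2⟩ := T.mem_adjacent.1 hK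
  rw [trace_eq_of_mem_face hΩ h1 h2 (hv K h1) hx]

/-- The jump across an interior face bounds the differences of coefficients. -/
theorem exists_norm_coeffs_sub_le_faceJump (hd : 2 ≤ d) (hΩ : IsConvexPolytopalDomain Ω) (k : ℕ) :
    ∃ C : ℝ, 0 < C ∧ ∀ (T : Mesh Ω) {v : Vec d → Vec d}
      {c : Finset (Vec d) → (Vec d →₀ ℕ) → Vec d}, (∀ K ∈ T.elements, HasCoeffs Ω k K v (c K)) →
      ∀ F ∈ T.interiorFaces, ∀ K ∈ T.adjacent F, ∀ K' ∈ T.adjacent F,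
      ∀ α ∈ F.finsuppAntidiag k,
        faceSize F ^ (d - 2) * ‖c K α - c K' α‖ ^ 2 ≤ C * faceJump T v F := by
  obtain ⟨C, hC, h⟩ := exists_faceSize_pow_mul_le hd k
  refine ⟨C, hC, fun T v c hv F hF K hK K' hK' α hα => ?_⟩
  obtain ⟨h1, h2⟩ := T.mem_adjacent.1 hK
  obtain ⟨h3, h4⟩ := T.mem_adjacent.1 hK'
  have hKf := Mesh.isFullSimplex h1
  have hKf' := Mesh.isFullSimplex h3
  have hFc := (T.mem_meshFaces.1 (T.mem_interiorFaces.1 hF).1).2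
  rw [faceJump_interior hF, setIntegral_congr_fun (measurableSet_simplex F)
    (fun x hx => congrArg (fun t => (faceSize F)⁻¹ * t) (jumpSq_eq hΩ hv hx))]
  refine h hKf h2 hFc (c K - c K') (s := fun x => 1 / 2 * ∑ K ∈ T.adjacent F, ∑ K' ∈ T.adjacent F,
        ‖bpoly k K (c K) x - bpoly k K' (c K') x‖ ^ 2) ?_ (fun x hx => ?_) α hα
  · exact continuous_const.mul (continuous_finsetSum _ fun K _ => continuous_finsetSum _ fun K' _ =>
      ((bpoly_continuous k K (c K)).sub (bpoly_continuous k K' (c K'))).norm.pow 2)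
  · have e : ∑ β ∈ F.finsuppAntidiag k, bern K β x • (c K - c K') β =
        bpoly k K (c K) x - bpoly k K' (c K') x := by
      rw [← hKf.bpoly_face h2 k (c K - c K') hx, bpoly_sub,
        hKf.bpoly_eq_of_mem_face hKf' h2 h4 k (c K') hx]
    rw [e, ← mul_assoc, show (2 : ℝ) * (1 / 2) = 1 by norm_num, one_mul]
    refine le_trans ?_ (Finset.single_le_sum (f := fun K => ∑ K' ∈ T.adjacent F,
        ‖bpoly k K (c K) x - bpoly k K' (c K') x‖ ^ 2)
        (fun _ _ => Finset.sum_nonneg fun _ _ => sq_nonneg _) hK)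
    exact Finset.single_le_sum (f := fun K' => ‖bpoly k K (c K) x - bpoly k K' (c K') x‖ ^ 2)
      (fun _ _ => sq_nonneg _) hK'

/-- The tangential trace on a boundary face bounds the tangential components of coefficients. -/
theorem exists_norm_starProjection_coeffs_le_faceJump (hd : 2 ≤ d)
    (hΩ : IsConvexPolytopalDomain Ω) (k : ℕ) :
    ∃ C : ℝ, 0 < C ∧ ∀ (T : Mesh Ω) {v : Vec d → Vec d}
      {c : Finset (Vec d) → (Vec d →₀ ℕ) → Vec d}, (∀ K ∈ T.elements, HasCoeffs Ω k K v (c K)) →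
      ∀ F ∈ T.boundaryFaces, ∀ K ∈ T.adjacent F, ∀ α ∈ F.finsuppAntidiag k,
        faceSize F ^ (d - 2) * ‖(vectorSpan ℝ (F : Set (Vec d))).starProjection (c K α)‖ ^ 2 ≤
          C * faceJump T v F := by
  obtain ⟨C, hC, h⟩ := exists_faceSize_pow_mul_le hd k
  refine ⟨C, hC, fun T v c hv F hF K hK α hα => ?_⟩
  obtain ⟨h1, h2⟩ := T.mem_adjacent.1 hK
  have hKf := Mesh.isFullSimplex h1
  have hFc := (T.mem_meshFaces.1 (T.mem_boundaryFaces.1 hF).1).2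
  rw [faceJump_boundary hF, setIntegral_congr_fun (measurableSet_simplex F)
    (fun x hx => congrArg (fun t => (faceSize F)⁻¹ * t) (tangentialSq_eq hΩ hv hx))]
  refine h hKf h2 hFc (fun β => (vectorSpan ℝ (F : Set (Vec d))).starProjection (c K β))
    (s := fun x => ∑ K ∈ T.adjacent F,
        ‖(vectorSpan ℝ (F : Set (Vec d))).starProjection (bpoly k K (c K) x)‖ ^ 2)
    ?_ (fun x hx => ?_) α hα
  · exact continuous_finsetSum _ fun K _ =>
      ((ContinuousLinearMap.continuous _).comp (bpoly_continuous k K (c K))).norm.pow 2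
  · have e : ∑ β ∈ F.finsuppAntidiag k,
        bern K β x • (vectorSpan ℝ (F : Set (Vec d))).starProjection (c K β) =
        (vectorSpan ℝ (F : Set (Vec d))).starProjection (bpoly k K (c K) x) := by
      rw [hKf.bpoly_face h2 k (c K) hx, map_sum]
      exact Finset.sum_congr rfl fun β _ => (map_smul _ _ _).symm
    rw [e]
    have h5 := Finset.single_le_sum (f := fun K =>
      ‖(vectorSpan ℝ (F : Set (Vec d))).starProjection (bpoly k K (c K) x)‖ ^ 2)
      (fun _ _ => sq_nonneg _) hK
    have h6 : 0 ≤ ∑ K ∈ T.adjacent F,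
        ‖(vectorSpan ℝ (F : Set (Vec d))).starProjection (bpoly k K (c K) x)‖ ^ 2 :=
      Finset.sum_nonneg fun _ _ => sq_nonneg _
    exact h5.trans (by linarith)

/-- A conforming field has neither jumps nor a tangential trace, so subtracting it does not change
the jump seminorm. -/
theorem jumpSeminormSq_eq_of_hasCoeffs (hΩ : IsConvexPolytopalDomain Ω) {k : ℕ}
    {v w : Vec d → Vec d} {c : Finset (Vec d) → (Vec d →₀ ℕ) → Vec d} {e : (Vec d →₀ ℕ) → Vec d}
    (hv : ∀ K ∈ T.elements, HasCoeffs Ω k K v (c K))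
    (hw : ∀ K ∈ T.elements, HasCoeffs Ω k K w (c K - e))
    (he : ∀ α, e α ∈ normalSpace (T.tangentSpaces α.support)) :
    jumpSeminormSq T w = jumpSeminormSq T v := by
  unfold jumpSeminormSq
  refine congrArg₂ (fun s t => s + t) ?_ ?_
  · refine Finset.sum_congr rfl fun F hF => setIntegral_congr_fun (measurableSet_simplex F)
      fun x hx => ?_
    rw [jumpSq_eq hΩ hv hx, jumpSq_eq (c := fun K => c K - e) hΩ hw hx]
    refine congrArg (fun t => (faceSize F)⁻¹ * (1 / 2 * t)) ?_
    refine Finset.sum_congr rfl fun K hK => Finset.sum_congr rfl fun K' hK' => ?_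
    obtain ⟨h1, h2⟩ := T.mem_adjacent.1 hK
    obtain ⟨h3, h4⟩ := T.mem_adjacent.1 hK'
    rw [bpoly_sub, bpoly_sub, (Mesh.isFullSimplex h1).bpoly_eq_of_mem_face
      (Mesh.isFullSimplex h3) h2 h4 k e hx, sub_sub_sub_cancel_right]
  · refine Finset.sum_congr rfl fun F hF => setIntegral_congr_fun (measurableSet_simplex F)
      fun x hx => ?_
    rw [tangentialSq_eq hΩ hv hx, tangentialSq_eq (c := fun K => c K - e) hΩ hw hx]
    refine congrArg (fun t => (faceSize F)⁻¹ * t) ?_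
    refine Finset.sum_congr rfl fun K hK => ?_
    obtain ⟨h1, h2⟩ := T.mem_adjacent.1 hK
    have h3 := bpoly_mem_orthogonal (k := k) he hF (Mesh.isFullSimplex h1) h2 hx
    rw [bpoly_sub, map_sub, (Submodule.starProjection_apply_eq_zero_iff _).2 h3, sub_zero]

end FaceTerms

/-! ### The jump seminorm bounds the coefficients on stars -/

section Stars

variable {Ω : Set (Vec d)} {T : Mesh Ω} {θ : ℝ}

/-- A bound for the number of elements in a star of a mesh with shape regularity at most `θ`. -/
def starBound (d : ℕ) (θ : ℝ) : ℕ := ⌈(4 * θ) ^ d⌉₊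

theorem Mesh.card_adjacent_le_starBound (hd : 0 < d) (hθ : T.shapeRegularity ≤ θ)
    {σ : Finset (Vec d)} (hσ : σ.Nonempty) : (T.adjacent σ).card ≤ starBound d θ := by
  exact_mod_cast (Mesh.card_adjacent_le hd hθ hσ).trans (Nat.le_ceil _)

theorem Mesh.mem_faces_of_adjacent {σ K : Finset (Vec d)} (hσ : σ.Nonempty)
    (hK : K ∈ T.adjacent σ) : σ ∈ T.faces := by
  obtain ⟨h1, h2⟩ := T.mem_adjacent.1 hK
  exact T.down_closed (T.mem_elements.1 h1).1 h2 hσ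

theorem Mesh.card_meshFaces_filter_le (hd : 0 < d) (hΩ : IsOpen Ω) (hθ : T.shapeRegularity ≤ θ)
    {σ : Finset (Vec d)} (hσ : σ.Nonempty) :
    (T.meshFaces.filter fun F => σ ⊆ F).card ≤ starBound d θ * 2 ^ (d + 1) := by
  classical
  have hsub : (T.meshFaces.filter fun F => σ ⊆ F) ⊆ (T.adjacent σ).biUnion Finset.powerset := by
    intro F hF
    obtain ⟨h1, h2⟩ := Finset.mem_filter.1 hF
    obtain ⟨K, hK⟩ := Mesh.exists_mem_adjacent hΩ (T.mem_meshFaces.1 h1).1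
    obtain ⟨h3, h4⟩ := T.mem_adjacent.1 hK
    exact Finset.mem_biUnion.2 ⟨K, T.mem_adjacent.2 ⟨h3, h2.trans h4⟩, Finset.mem_powerset.2 h4⟩
  refine (Finset.card_le_card hsub).trans ((Finset.card_biUnion_le_card_mul _ _ (2 ^ (d + 1))
    fun K hK => ?_).trans (Nat.mul_le_mul_right _ (Mesh.card_adjacent_le_starBound hd hθ hσ)))
  rw [Finset.card_powerset, (Mesh.isFullSimplex (T.mem_adjacent.1 hK).1).card_eq]

/-- In a star, the diameters of the elements are bounded by the sizes of the faces. -/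
theorem exists_diam_le_faceSize (hd : 2 ≤ d) (hΩ : IsConvexPolytopalDomain Ω) (θ : ℝ) :
    ∃ A : ℝ, 0 < A ∧ ∀ T : Mesh Ω, T.shapeRegularity ≤ θ → ∀ {σ K F : Finset (Vec d)},
      σ.Nonempty → K ∈ T.adjacent σ → F ∈ T.meshFaces → σ ⊆ F →
        Metric.diam (simplex K) ≤ A * faceSize F := by
  obtain ⟨c, hc, h⟩ := exists_le_faceSize hd
  refine ⟨(max 1 θ) ^ (starBound d θ + 1) / c, by positivity,
    fun T hθ σ K F hσ hK hF hσF => ?_⟩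
  obtain ⟨K', hK'⟩ := Mesh.exists_mem_adjacent hΩ.isOpen (T.mem_meshFaces.1 hF).1
  obtain ⟨h1, h2⟩ := T.mem_adjacent.1 hK'
  have hθ1 := Mesh.one_le_of_shapeRegularity (by omega) hθ h1
  have h3 := Mesh.diam_le_of_star hd hθ hΩ.isOpen hΩ.convex (Mesh.mem_faces_of_adjacent hσ hK)
    (Mesh.card_adjacent_le_starBound (by omega) hθ hσ) hK (T.mem_adjacent.2 ⟨h1, hσF.trans h2⟩)
  have h4 := Mesh.diam_le_of_shapeRegularity (by omega) hθ h1
  have h5 := h (Mesh.isFullSimplex h1) h2 (T.mem_meshFaces.1 hF).2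
  rw [max_eq_right hθ1, div_mul_eq_mul_div, le_div_iff₀ hc]
  calc Metric.diam (simplex K) * c
      ≤ θ ^ starBound d θ * (θ * inballDiameter (simplex K')) * c := by
        gcongr
        exact h3.trans (by gcongr)
    _ = θ ^ (starBound d θ + 1) * (c * inballDiameter (simplex K')) := by ring
    _ ≤ _ := by gcongr

/-- The contributions to the square of the jump seminorm of the faces around `σ`. -/
def starJump (T : Mesh Ω) (v : Vec d → Vec d) (σ : Finset (Vec d)) : ℝ :=
  ∑ F ∈ T.meshFaces with σ ⊆ F, faceJump T v F

theorem starJump_nonneg (v : Vec d → Vec d) (σ : Finset (Vec d)) : 0 ≤ starJump T v σ :=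
  Finset.sum_nonneg fun _ _ => faceJump_nonneg _ _

theorem faceJump_le_starJump (v : Vec d → Vec d) {σ F : Finset (Vec d)} (hF : F ∈ T.meshFaces)
    (h : σ ⊆ F) : faceJump T v F ≤ starJump T v σ :=
  Finset.single_le_sum (f := faceJump T v) (fun _ _ => faceJump_nonneg _ _)
    (Finset.mem_filter.2 ⟨hF, h⟩)

/-- Transfers a bound weighted by a power of the face size `h` to one weighted by the
diameter `R`. -/
theorem pow_mul_le_of_le_mul {A R h Y J C : ℝ} {n : ℕ} (hA : 0 ≤ A) (hR : 0 ≤ R) (hY : 0 ≤ Y)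
    (hle : R ≤ A * h) (hb : h ^ n * Y ≤ C * J) : R ^ n * Y ≤ A ^ n * C * J := by
  calc R ^ n * Y ≤ (A * h) ^ n * Y := by gcongr
    _ = A ^ n * (h ^ n * Y) := by ring
    _ ≤ A ^ n * (C * J) := by gcongr
    _ = _ := by ring

/-- The coefficients of one index on the elements around its support differ by at most the jumps
around the support. -/
theorem exists_norm_coeffs_sub_le_starJump (hd : 2 ≤ d) (hΩ : IsConvexPolytopalDomain Ω) {k : ℕ}
    (hk : 0 < k) (θ : ℝ) :
    ∃ C : ℝ, 0 ≤ C ∧ ∀ T : Mesh Ω, T.shapeRegularity ≤ θ → ∀ {v : Vec d → Vec d}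
      {c : Finset (Vec d) → (Vec d →₀ ℕ) → Vec d}, (∀ K ∈ T.elements, HasCoeffs Ω k K v (c K)) →
      ∀ K₀ ∈ T.elements, ∀ α ∈ K₀.finsuppAntidiag k,
      ∀ K ∈ T.adjacent α.support, ∀ K' ∈ T.adjacent α.support,
        Metric.diam (simplex K₀) ^ (d - 2) * ‖c K α - c K' α‖ ^ 2 ≤
          C * starJump T v α.support := by
  obtain ⟨A, hA, hsize⟩ := exists_diam_le_faceSize hd hΩ θ
  obtain ⟨B, hB, hface⟩ := exists_norm_coeffs_sub_le_faceJump hd hΩ k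
  refine ⟨(starBound d θ) ^ 2 * (A ^ (d - 2) * B), by positivity,
    fun T hθ v c hv K₀ hK₀ α hα K hK K' hK' => ?_⟩
  have hσ := support_nonempty hk hα
  have hR : 0 < Metric.diam (simplex K₀) ^ (d - 2) :=
    pow_pos ((Mesh.isFullSimplex hK₀).diam_pos (by omega)) _
  obtain ⟨J, hJ⟩ : ∃ J, starJump T v α.support = J := ⟨_, rfl⟩
  have hJ0 : 0 ≤ J := hJ ▸ starJump_nonneg _ _
  obtain ⟨R, hRd⟩ : ∃ R, Metric.diam (simplex K₀) ^ (d - 2) = R := ⟨_, rfl⟩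
  have h0 : 0 ≤ A ^ (d - 2) * B * J / R := by rw [← hRd]; positivity
  -- by the weighted inverse inequality, `√(A ^ (d - 2) * B * J / R)` bounds the difference across
  -- each interior face around the support
  have key := Mesh.norm_sub_le_of_star hΩ.isOpen hΩ.convex (Mesh.mem_faces_of_adjacent hσ hK)
    (N := starBound d θ)
    (by exact_mod_cast Mesh.card_adjacent_le_starBound (by omega) hθ hσ) (fun K => c K α)
    (Real.sqrt_nonneg (A ^ (d - 2) * B * J / R)) (fun F hF hσF K hK K' hK' hFK hFK' => by
      refine Real.le_sqrt_of_sq_le ?_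
      rw [le_div_iff₀ (hRd ▸ hR), mul_comm, ← hRd]
      have hFm := (T.mem_interiorFaces.1 hF).1
      have h1 := hface T hv F hF K (T.mem_adjacent.2 ⟨hK, hFK⟩) K' (T.mem_adjacent.2 ⟨hK', hFK'⟩)
        α (mem_finsuppAntidiag_of_support hα hσF)
      refine (pow_mul_le_of_le_mul hA.le Metric.diam_nonneg (sq_nonneg _)
        (hsize T hθ hσ (mem_adjacent_support hK₀ hα) hFm hσF) h1).trans ?_
      rw [← hJ]
      gcongr
      exact faceJump_le_starJump v hFm hσF) hK hK'
  rw [hRd] at hR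
  rw [hRd, hJ]
  calc R * ‖c K α - c K' α‖ ^ 2
      ≤ R * (starBound d θ * √(A ^ (d - 2) * B * J / R)) ^ 2 := by gcongr
    _ = R * ((starBound d θ) ^ 2 * (A ^ (d - 2) * B * J / R)) := by
        rw [mul_pow, Real.sq_sqrt h0]
    _ = _ := by field_simp

/-- The tangential components of a coefficient on the boundary faces around its support are bounded
by the jumps around the support, even on elements that have no boundary face. -/
theorem exists_norm_starProjection_coeffs_le_starJump (hd : 2 ≤ d)
    (hΩ : IsConvexPolytopalDomain Ω) {k : ℕ} (hk : 0 < k) (θ : ℝ) :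
    ∃ C : ℝ, 0 ≤ C ∧ ∀ T : Mesh Ω, T.shapeRegularity ≤ θ → ∀ {v : Vec d → Vec d}
      {c : Finset (Vec d) → (Vec d →₀ ℕ) → Vec d}, (∀ K ∈ T.elements, HasCoeffs Ω k K v (c K)) →
      ∀ K ∈ T.elements, ∀ α ∈ K.finsuppAntidiag k, ∀ F ∈ T.boundaryFaces, α.support ⊆ F →
        Metric.diam (simplex K) ^ (d - 2) *
          ‖(vectorSpan ℝ (F : Set (Vec d))).starProjection (c K α)‖ ^ 2 ≤
          C * starJump T v α.support := by
  obtain ⟨A, hA, hsize⟩ := exists_diam_le_faceSize hd hΩ θ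
  obtain ⟨B, hB, hface⟩ := exists_norm_starProjection_coeffs_le_faceJump hd hΩ k
  obtain ⟨D, hD, hstar⟩ := exists_norm_coeffs_sub_le_starJump hd hΩ hk θ
  refine ⟨2 * D + 2 * (A ^ (d - 2) * B), by positivity, fun T hθ v c hv K hK α hα F hF hσF => ?_⟩
  have hFm := (T.mem_boundaryFaces.1 hF).1
  obtain ⟨K', hK'⟩ := Mesh.exists_mem_adjacent hΩ.isOpen (T.mem_meshFaces.1 hFm).1
  obtain ⟨h1, h2⟩ := T.mem_adjacent.1 hK'
  have h3 := hstar T hθ hv K hK α hα K (mem_adjacent_support hK hα) K'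
    (T.mem_adjacent.2 ⟨h1, hσF.trans h2⟩)
  have h4 := pow_mul_le_of_le_mul hA.le Metric.diam_nonneg (sq_nonneg _)
    (hsize T hθ (support_nonempty hk hα) (mem_adjacent_support hK hα) hFm hσF)
    (hface T hv F hF K' hK' α (mem_finsuppAntidiag_of_support hα hσF))
  have h5 : A ^ (d - 2) * B * faceJump T v F ≤ A ^ (d - 2) * B * starJump T v α.support := by
    gcongr
    exact faceJump_le_starJump v hFm hσF
  have h6 : ‖(vectorSpan ℝ (F : Set (Vec d))).starProjection (c K α)‖ ≤
      ‖c K α - c K' α‖ + ‖(vectorSpan ℝ (F : Set (Vec d))).starProjection (c K' α)‖ := by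
    rw [← sub_add_cancel (c K α) (c K' α), map_add, sub_add_cancel]
    exact (norm_add_le _ _).trans (by
      gcongr
      exact Submodule.norm_starProjection_apply_le _ _)
  have h7 := (pow_le_pow_left₀ (norm_nonneg _) h6 2).trans (add_sq_le)
  calc _ ≤ Metric.diam (simplex K) ^ (d - 2) * (2 * (‖c K α - c K' α‖ ^ 2 +
        ‖(vectorSpan ℝ (F : Set (Vec d))).starProjection (c K' α)‖ ^ 2)) := by gcongr
    _ ≤ _ := by linarith

/-- The coefficients of a piecewise polynomial field are close to those of its conforming
approximation. -/
theorem exists_norm_sub_conformingCoeffs_le (hd : 2 ≤ d) (hΩ : IsConvexPolytopalDomain Ω) {k : ℕ}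
    (hk : 0 < k) (θ : ℝ) :
    ∃ C : ℝ, 0 ≤ C ∧ ∀ T : Mesh Ω, T.shapeRegularity ≤ θ → ∀ {v : Vec d → Vec d},
      (∀ K ∈ T.elements, HasCoeffs Ω k K v (coeffs Ω k K v)) →
      ∀ K ∈ T.elements, ∀ α ∈ K.finsuppAntidiag k,
        Metric.diam (simplex K) ^ (d - 2) *
          ‖coeffs Ω k K v α - conformingCoeffs T k v α‖ ^ 2 ≤ C * starJump T v α.support := by
  obtain ⟨B, hB, hproj⟩ := exists_norm_sub_le_sum_tangential (d := d) (by omega) hΩ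
  obtain ⟨C, hC, htan⟩ := exists_norm_starProjection_coeffs_le_starJump hd hΩ hk θ
  obtain ⟨D, hD, hstar⟩ := exists_norm_coeffs_sub_le_starJump hd hΩ hk θ
  refine ⟨2 * (B * ((starBound d θ * 2 ^ (d + 1) : ℕ) * C)) + 2 * D, by positivity,
    fun T hθ v hv K hK α hα => ?_⟩
  have hKσ := mem_adjacent_support hK hα
  have hd1 := hstar T hθ (c := fun K => coeffs Ω k K v) hv K hK α hα K hKσ _ (starElement_mem hKσ)
  have hp := hproj T α.support (coeffs Ω k K v α)
  obtain ⟨R, hRd⟩ : ∃ R, Metric.diam (simplex K) ^ (d - 2) = R := ⟨_, rfl⟩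
  have hR : 0 ≤ R := hRd ▸ pow_nonneg Metric.diam_nonneg _
  have hsum : R * ∑ F ∈ T.boundaryFaces with α.support ⊆ F,
      ‖(vectorSpan ℝ (F : Set (Vec d))).starProjection (coeffs Ω k K v α)‖ ^ 2 ≤
      (starBound d θ * 2 ^ (d + 1) : ℕ) * C * starJump T v α.support := by
    rw [Finset.mul_sum, mul_assoc]
    refine (Finset.sum_le_card_nsmul _ _ (C * starJump T v α.support) fun F hF => ?_).trans ?_
    · rw [← hRd]
      exact htan T hθ (c := fun K => coeffs Ω k K v) hv K hK α hα F (Finset.mem_filter.1 hF).1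
        (Finset.mem_filter.1 hF).2
    · rw [nsmul_eq_mul]
      refine mul_le_mul_of_nonneg_right ?_ (mul_nonneg hC (starJump_nonneg _ _))
      exact_mod_cast (Finset.card_le_card fun F hF => Finset.mem_filter.2
        ⟨(T.mem_boundaryFaces.1 (Finset.mem_filter.1 hF).1).1, (Finset.mem_filter.1 hF).2⟩).trans
        (Mesh.card_meshFaces_filter_le (by omega) hΩ.isOpen hθ (support_nonempty hk hα))
  -- `e = P c₀` for the projection `P` and the coefficient `c₀` on the chosen element, so that
  -- `‖c - e‖ ≤ ‖c - P c‖ + ‖P (c - c₀)‖`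
  have htri : ‖coeffs Ω k K v α - conformingCoeffs T k v α‖ ≤
      ‖coeffs Ω k K v α - (normalSpace (T.tangentSpaces α.support)).starProjection
        (coeffs Ω k K v α)‖ +
      ‖coeffs Ω k K v α - coeffs Ω k (starElement T α.support) v α‖ := by
    refine (norm_sub_le_norm_sub_add_norm_sub _ ((normalSpace
      (T.tangentSpaces α.support)).starProjection (coeffs Ω k K v α)) _).trans ?_
    gcongr
    rw [conformingCoeffs, ← map_sub]
    exact Submodule.norm_starProjection_apply_le _ _
  have h7 := (pow_le_pow_left₀ (norm_nonneg _) htri 2).trans (add_sq_le)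
  have h8 := (mul_le_mul_of_nonneg_left hsum hB)
  have h9 := mul_le_mul_of_nonneg_left hp hR
  rw [hRd] at hd1 ⊢
  have h10 := mul_le_mul_of_nonneg_left h7 hR
  linarith

end Stars

/-! ### The broken norm in terms of coefficients -/

section Elements

variable {Ω : Set (Vec d)} {T : Mesh Ω} {θ : ℝ}

theorem volume_real_simplex_le (K : Finset (Vec d)) :
    volume.real (simplex K) ≤
      Metric.diam (simplex K) ^ d * volume.real (Metric.ball (0 : Vec d) 1) := by
  rcases (simplex K).eq_empty_or_nonempty with h | ⟨x, hx⟩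
  · rw [h]
    simp only [measureReal_empty]
    positivity
  · have h1 : simplex K ⊆ Metric.closedBall x (Metric.diam (simplex K)) := fun y hy => by
      rw [mem_closedBall_iff_norm]
      exact dist_le_diam_simplex hy hx
    refine (measureReal_mono h1 Metric.isBounded_closedBall.measure_lt_top.ne).trans_eq ?_
    rw [Measure.addHaar_real_closedBall _ _ Metric.diam_nonneg, finrank_euclideanSpace_fin]

/-- The gradient of a polynomial field on an element is bounded by the coefficients. -/
theorem integral_weakGradient_sq_le (hd : 2 ≤ d) (hΩ : IsConvexPolytopalDomain Ω)
    (hθ : T.shapeRegularity ≤ θ) {k : ℕ} {v : L2 Ω} {K : Finset (Vec d)} (hK : K ∈ T.elements)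
    {c : (Vec d →₀ ℕ) → Vec d} (hv : HasCoeffs Ω k K v c) :
    ∫ x in interior (simplex K), (∑ i, ∑ j, (weakGradient (interior (simplex K)) v x i j) ^ 2) ≤
      (d ^ 2 * (k * θ) ^ 2 * volume.real (Metric.ball (0 : Vec d) 1)) *
        (Metric.diam (simplex K) ^ (d - 2) * (∑ α ∈ K.finsuppAntidiag k, ‖c α‖) ^ 2) := by
  have hKf := Mesh.isFullSimplex hK
  have hsub := Mesh.interior_simplex_subset hΩ.isOpen hΩ.convex hK
  have hD := hKf.diam_pos (by omega)
  have hρ := hKf.inballDiameter_pos (by omega)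
  have hθ1 := Mesh.one_le_of_shapeRegularity (by omega) hθ hK
  obtain ⟨S, hS⟩ : ∃ S, ∑ α ∈ K.finsuppAntidiag k, ‖c α‖ = S := ⟨_, rfl⟩
  have hS0 : 0 ≤ S := hS ▸ Finset.sum_nonneg fun _ _ => norm_nonneg _
  obtain ⟨D, hDd⟩ : ∃ D, Metric.diam (simplex K) = D := ⟨_, rfl⟩
  rw [hDd] at hD
  have hinv : (k : ℝ) / inballDiameter (simplex K) ≤ k * θ / D := by
    have h1 := Mesh.diam_le_of_shapeRegularity (by omega) hθ hK
    rw [hDd] at h1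
    rw [div_le_div_iff₀ hρ hD, mul_assoc]
    gcongr
  have hL0 : 0 ≤ S * (k * θ / D) := by positivity
  have hlip : LipschitzOnWith (S * (k * θ / D)).toNNReal (bpoly k K c) (interior (simplex K)) := by
    refine LipschitzOnWith.of_dist_le_mul fun x hx y hy => ?_
    rw [dist_eq_norm, dist_eq_norm, Real.coe_toNNReal _ hL0]
    refine (hKf.norm_bpoly_sub_le_div (by omega) k c (interior_subset hx)
      (interior_subset hy)).trans ?_
    rw [hS]
    gcongr
  have hae := fun i j => abs_weakGradient_le isOpen_interior hlip
    (fun i => (locallyIntegrableOn_component v i).mono_set hsub) (hv.ae_eq hsub).symm i j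
  have hae' : ∀ᵐ x ∂volume.restrict (interior (simplex K)), ∀ i j,
      |weakGradient (interior (simplex K)) v x i j| ≤ S * (k * θ / D) := by
    simp only [Real.coe_toNNReal _ hL0] at hae
    exact ae_all_iff.2 fun i => ae_all_iff.2 fun j => hae i j
  have hbd : ∀ᵐ x ∂volume.restrict (interior (simplex K)),
      ‖∑ i, ∑ j, (weakGradient (interior (simplex K)) v x i j) ^ 2‖ ≤
        d ^ 2 * (S * (k * θ / D)) ^ 2 := by
    filter_upwards [hae'] with x hx
    rw [Real.norm_of_nonneg (Finset.sum_nonneg fun _ _ => Finset.sum_nonneg fun _ _ => sq_nonneg _)]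
    refine (Finset.sum_le_sum fun i _ => Finset.sum_le_sum fun j _ =>
      sq_le_sq' (abs_le.1 (hx i j)).1 (abs_le.1 (hx i j)).2).trans_eq ?_
    simp only [Finset.sum_const, Finset.card_univ, Fintype.card_fin, nsmul_eq_mul]
    ring
  have hfin : volume (interior (simplex K)) < ⊤ :=
    (measure_mono interior_subset).trans_lt (isCompact_simplex K).measure_lt_top
  have hvol : volume.real (interior (simplex K)) ≤
      D ^ d * volume.real (Metric.ball (0 : Vec d) 1) := hDd ▸
    (measureReal_mono interior_subset (isCompact_simplex K).measure_lt_top.ne).trans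
      (volume_real_simplex_le K)
  refine (Real.le_norm_self _).trans
    ((norm_setIntegral_le_of_norm_le_const_ae hfin hbd).trans ?_)
  rw [hS, hDd]
  calc d ^ 2 * (S * (k * θ / D)) ^ 2 * volume.real (interior (simplex K))
      ≤ d ^ 2 * (S * (k * θ / D)) ^ 2 * (D ^ d * volume.real (Metric.ball (0 : Vec d) 1)) := by
        gcongr
    _ = _ := by
        obtain ⟨m, rfl⟩ : ∃ m, d = m + 2 := ⟨d - 2, by omega⟩
        rw [Nat.add_sub_cancel, pow_add D]
        field_simp

/-- The `L²` norm of a piecewise polynomial field is bounded by the coefficients. -/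
theorem integral_norm_sq_le (hd : 2 ≤ d) (hΩ : IsConvexPolytopalDomain Ω) {k : ℕ} {v : L2 Ω}
    {c : Finset (Vec d) → (Vec d →₀ ℕ) → Vec d} (hv : ∀ K ∈ T.elements, HasCoeffs Ω k K v (c K)) :
    ∫ x in Ω, ‖(v : Vec d → Vec d) x‖ ^ 2 ≤
      (Metric.diam (closure Ω) ^ 2 * volume.real (Metric.ball (0 : Vec d) 1)) *
        ∑ K ∈ T.elements, Metric.diam (simplex K) ^ (d - 2) *
          (∑ α ∈ K.finsuppAntidiag k, ‖c K α‖) ^ 2 := by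
  have hfin : IsFiniteMeasure (volume.restrict Ω) :=
    isFiniteMeasure_restrict.2 hΩ.isBounded.measure_lt_top.ne
  have hall : ∀ᵐ x ∂(volume.restrict Ω), ∀ K ∈ T.elements, x ∈ simplex K →
      (v : Vec d → Vec d) x = bpoly k K (c K) x := (Finset.eventually_all _).2 hv
  have hle : ∀ᵐ x ∂(volume.restrict Ω), ‖(v : Vec d → Vec d) x‖ ^ 2 ≤
      ∑ K ∈ T.elements, (simplex K).indicator
        (fun _ => (∑ α ∈ K.finsuppAntidiag k, ‖c K α‖) ^ 2) x := by
    filter_upwards [hall, ae_restrict_mem hΩ.isOpen.measurableSet] with x hx hxΩ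
    obtain ⟨K, hK, hxK⟩ := Mesh.exists_mem_element (T := T) hΩ.isOpen (subset_closure hxΩ)
    refine le_trans ?_ (Finset.single_le_sum (f := fun K => (simplex K).indicator
      (fun _ => (∑ α ∈ K.finsuppAntidiag k, ‖c K α‖) ^ 2) x)
      (fun K _ => Set.indicator_nonneg (fun _ _ => sq_nonneg _) x) hK)
    simp only [Set.indicator_of_mem hxK]
    rw [hx K hK hxK]
    exact pow_le_pow_left₀ (norm_nonneg _) ((Mesh.isFullSimplex hK).norm_bpoly_le hxK k (c K)) 2
  have hint : ∀ K ∈ T.elements, Integrable ((simplex K).indicator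
      (fun _ => (∑ α ∈ K.finsuppAntidiag k, ‖c K α‖) ^ 2)) (volume.restrict Ω) := fun K _ =>
    (integrable_const _).indicator (measurableSet_simplex K)
  refine (integral_mono_of_nonneg (Eventually.of_forall fun _ => sq_nonneg _)
    (integrable_finsetSum _ hint) hle).trans ?_
  rw [integral_finsetSum _ hint, Finset.mul_sum]
  refine Finset.sum_le_sum fun K hK => ?_
  rw [integral_indicator_const _ (measurableSet_simplex K), smul_eq_mul]
  have h1 : (volume.restrict Ω).real (simplex K) ≤ volume.real (simplex K) :=
    ENNReal.toReal_mono (isCompact_simplex K).measure_lt_top.ne (Measure.restrict_apply_le _ _)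
  have h2 : Metric.diam (simplex K) ≤ Metric.diam (closure Ω) :=
    Metric.diam_mono (Mesh.simplex_subset_closure (T.mem_elements.1 hK).1)
      hΩ.isBounded.closure
  have h3 : Metric.diam (simplex K) ^ d ≤
      Metric.diam (simplex K) ^ (d - 2) * Metric.diam (closure Ω) ^ 2 := by
    calc Metric.diam (simplex K) ^ d
        = Metric.diam (simplex K) ^ (d - 2) * Metric.diam (simplex K) ^ 2 := by
          rw [← pow_add, Nat.sub_add_cancel hd]
      _ ≤ _ := by gcongr
  calc (volume.restrict Ω).real (simplex K) * (∑ α ∈ K.finsuppAntidiag k, ‖c K α‖) ^ 2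
      ≤ (Metric.diam (simplex K) ^ (d - 2) * Metric.diam (closure Ω) ^ 2 *
          volume.real (Metric.ball (0 : Vec d) 1)) *
          (∑ α ∈ K.finsuppAntidiag k, ‖c K α‖) ^ 2 := by
        gcongr
        exact h1.trans ((volume_real_simplex_le K).trans (by gcongr))
    _ = _ := by ring

theorem sq_sum_norm_le {K : Finset (Vec d)} (hK : IsFullSimplex K) (k : ℕ)
    (c : (Vec d →₀ ℕ) → Vec d) : (∑ α ∈ K.finsuppAntidiag k, ‖c α‖) ^ 2 ≤
      numIndices (d + 1) k * ∑ α ∈ K.finsuppAntidiag k, ‖c α‖ ^ 2 := by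
  rw [← hK.card_eq, ← card_finsuppAntidiag]
  exact sq_sum_le_card_mul_sum_sq

/-- The gradient and the `L²` terms are bounded by the coefficients. -/
theorem exists_broken_norm_le (hd : 2 ≤ d) (hΩ : IsConvexPolytopalDomain Ω) (k : ℕ) (θ : ℝ) :
    ∃ C : ℝ, 0 ≤ C ∧ ∀ T : Mesh Ω, T.shapeRegularity ≤ θ → ∀ {v : L2 Ω}
      {c : Finset (Vec d) → (Vec d →₀ ℕ) → Vec d}, (∀ K ∈ T.elements, HasCoeffs Ω k K v (c K)) →
      (∑ K ∈ T.elements, (∫ x in interior (simplex K),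
        (∑ i, ∑ j, (weakGradient (interior (simplex K)) v x i j) ^ 2))) +
        (∫ x in Ω, ‖(v : Vec d → Vec d) x‖ ^ 2) ≤
      C * ∑ K ∈ T.elements, ∑ α ∈ K.finsuppAntidiag k,
        Metric.diam (simplex K) ^ (d - 2) * ‖c K α‖ ^ 2 := by
  obtain ⟨A, hA⟩ : ∃ A, d ^ 2 * (k * θ) ^ 2 * volume.real (Metric.ball (0 : Vec d) 1) = A :=
    ⟨_, rfl⟩
  obtain ⟨B, hB⟩ : ∃ B, Metric.diam (closure Ω) ^ 2 * volume.real (Metric.ball (0 : Vec d) 1) = B :=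
    ⟨_, rfl⟩
  have hA0 : 0 ≤ A := by rw [← hA]; positivity
  have hB0 : 0 ≤ B := by rw [← hB]; positivity
  refine ⟨(A + B) * numIndices (d + 1) k, by positivity, fun T hθ v c hv => ?_⟩
  have h1 := Finset.sum_le_sum fun K (hK : K ∈ T.elements) =>
    integral_weakGradient_sq_le hd hΩ hθ hK (hv K hK)
  have h2 := integral_norm_sq_le hd hΩ hv
  rw [hA, ← Finset.mul_sum] at h1
  rw [hB] at h2
  refine (add_le_add h1 h2).trans ?_
  rw [← add_mul, mul_assoc, Finset.mul_sum (T.elements) _ (numIndices (d + 1) k : ℝ)]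
  refine mul_le_mul_of_nonneg_left (Finset.sum_le_sum fun K hK => ?_) (by positivity)
  rw [← Finset.mul_sum, ← mul_assoc, mul_comm (numIndices (d + 1) k : ℝ), mul_assoc]
  exact mul_le_mul_of_nonneg_left (sq_sum_norm_le (Mesh.isFullSimplex hK) k (c K))
    (pow_nonneg Metric.diam_nonneg _)

/-- Each face is counted a bounded number of times in the jumps around the supports. -/
theorem sum_starJump_le (hd : 0 < d) (hθ : T.shapeRegularity ≤ θ) {k : ℕ} (hk : 0 < k)
    (v : Vec d → Vec d) :
    ∑ K ∈ T.elements, ∑ α ∈ K.finsuppAntidiag k, starJump T v α.support ≤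
      (numIndices d k * starBound d θ : ℕ) * jumpSeminormSq T v := by
  classical
  have hcount : ∀ F ∈ T.meshFaces, ∑ K ∈ T.elements,
      ((K.finsuppAntidiag k).filter fun α => α.support ⊆ F).card ≤
        numIndices d k * starBound d θ := fun F hF => by
    have h1 : ∀ K ∈ T.elements, ((K.finsuppAntidiag k).filter fun α => α.support ⊆ F).card ≤
        ∑ α ∈ F.finsuppAntidiag k, if α.support ⊆ K then 1 else 0 := fun K _ => by
      rw [← Finset.card_filter]
      refine Finset.card_le_card fun α hα => ?_
      obtain ⟨h2, h3⟩ := Finset.mem_filter.1 hα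
      exact Finset.mem_filter.2 ⟨mem_finsuppAntidiag_of_support h2 h3,
        (Finset.mem_finsuppAntidiag.1 h2).2⟩
    refine (Finset.sum_le_sum h1).trans ?_
    have hcard : numIndices d k = (F.finsuppAntidiag k).card := by
      rw [card_finsuppAntidiag, (T.mem_meshFaces.1 hF).2]
    rw [Finset.sum_comm, hcard, ← smul_eq_mul]
    refine Finset.sum_le_card_nsmul _ _ _ fun α hα => ?_
    rw [← Finset.card_filter]
    exact Mesh.card_adjacent_le_starBound hd hθ (support_nonempty hk hα)
  have hswap : ∑ K ∈ T.elements, ∑ α ∈ K.finsuppAntidiag k, starJump T v α.support =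
      ∑ F ∈ T.meshFaces, (∑ K ∈ T.elements,
        ((K.finsuppAntidiag k).filter fun α => α.support ⊆ F).card : ℕ) * faceJump T v F := by
    simp only [starJump, Finset.sum_filter, Finset.card_filter, Nat.cast_sum, Finset.sum_mul]
    rw [Finset.sum_comm]
    simp_rw [Finset.sum_comm (s := T.meshFaces)]
    simp only [Nat.cast_ite, Nat.cast_one, Nat.cast_zero, ite_mul, one_mul, zero_mul]
  rw [hswap, jumpSeminormSq_eq_sum, Finset.mul_sum]
  refine Finset.sum_le_sum fun F hF => mul_le_mul_of_nonneg_right ?_ (faceJump_nonneg v F)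
  exact_mod_cast hcount F hF

end Elements

end DGVector

end

open DGVector in
theorem theorem6p1 (d : ℕ) (hd : d = 2 ∨ d = 3) (p : ℕ) (hp : 2 ≤ p)
    (Ω : Set (Vec d)) (hΩ : IsConvexPolytopalDomain Ω) (θ : ℝ) :
    ∃ C : ℝ, 0 < C ∧ ∀ T : Mesh Ω, T.shapeRegularity ≤ θ →
      ∃ E : V T p →ₗ[ℝ] ↥(V T p ⊓ H1T Ω),
        ∀ v : V T p,
          dgNorm T ((v : L2 Ω) - (E v : L2 Ω) : L2 Ω) ≤ C * jumpSeminorm T (v : L2 Ω) := by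
  have hd2 : 2 ≤ d := by omega
  -- for piecewise constants the only multi-index has empty support, and its star is the whole mesh
  have hk : 0 < p - 1 := by omega
  obtain ⟨A, hA, hbroken⟩ := exists_broken_norm_le hd2 hΩ (p - 1) θ
  obtain ⟨B, hB, hcoef⟩ := exists_norm_sub_conformingCoeffs_le hd2 hΩ hk θ
  obtain ⟨N, hN⟩ : ∃ N : ℕ, numIndices d (p - 1) * starBound d θ = N := ⟨_, rfl⟩
  -- the summand `1` accounts for the jump seminorm of `v - E v`, which is that of `v`
  refine ⟨√(A * (B * N) + 1), by positivity, fun T hθ => ?_⟩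
  obtain ⟨E, hE⟩ := exists_conforming_operator hd2 hΩ T p
  refine ⟨E, fun v => ?_⟩
  have hv : ∀ K ∈ T.elements, HasCoeffs Ω (p - 1) K (v : L2 Ω) (coeffs Ω (p - 1) K (v : L2 Ω)) :=
    fun K hK => hasCoeffs_coeffs v.2 hK
  have hw := fun K (hK : K ∈ T.elements) => (hv K hK).sub (hE v K hK)
  have h1 := hbroken T hθ (c := fun K => coeffs Ω (p - 1) K (v : L2 Ω) -
    conformingCoeffs T (p - 1) (v : L2 Ω)) hw
  have h2 : ∑ K ∈ T.elements, ∑ α ∈ K.finsuppAntidiag (p - 1),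
      Metric.diam (simplex K) ^ (d - 2) * ‖coeffs Ω (p - 1) K (v : L2 Ω) α -
        conformingCoeffs T (p - 1) (v : L2 Ω) α‖ ^ 2 ≤
      B * (N * jumpSeminormSq T (v : L2 Ω)) := by
    rw [← hN]
    refine (Finset.sum_le_sum fun K hK => Finset.sum_le_sum fun α hα =>
      hcoef T hθ hv K hK α hα).trans ?_
    simp only [← Finset.mul_sum]
    exact mul_le_mul_of_nonneg_left (sum_starJump_le (by omega) hθ hk _) hB
  have h3 := jumpSeminormSq_eq_of_hasCoeffs hΩ (c := fun K => coeffs Ω (p - 1) K (v : L2 Ω)) hv hw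
    (conformingCoeffs_mem (p - 1) _)
  rw [dgNorm, jumpSeminorm, ← Real.sqrt_mul (by positivity), h3]
  refine Real.sqrt_le_sqrt ((add_le_add_left (h1.trans
    (mul_le_mul_of_nonneg_left h2 hA)) _).trans_eq (by ring))
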